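/- Conventions. $\lambda$ is the security parameter; QPT adversaries and PPT algorithms are non-uniform families of circuits of polynomial size (quantum circuits over a fixed universal gate set with measurements and oracle queries; Boolean circuits with uniform random coins). A function $\varepsilon$ is negligible if $\varepsilon(\lambda)=\lambda^{-\omega(1)}$. A keyed family $f_k:\{0,1\}^\lambda\to\{0,1\}^\lambda$, $k\in\{0,1\}^\lambda$, computable by polynomial-size circuits, is a quantum-secure PRF if for every QPT adversary $\mathcal A$ with superposition access to its oracle ($|x\rangle|z\rangle\mapsto|x\rangle|z\oplus g(x)\rangle$) there is a negligible $\mu$ with $|\Pr_k[\mathcal A^{f_k}=1]-\Pr_g[\mathcal A^{g}=1]|\le\mu(\lambda)$ for all $\lambda$, where $k$ is uniform in $\{0,1\}^\lambda$ and $g$ is a uniform function $\{0,1\}^\lambda\to\{0,1\}^\lambda$. A symmetric-key encryption scheme $\mathsf{SE}=(\mathsf{SE.Enc},\mathsf{SE.Dec})$ has keys in $\{0,1\}^\lambda$, plaintexts in $\{0,1\}^*$, PPT encryption, and deterministic polynomial-time decryption, which may return $\bot$. It is post-quantum IND-CCA secure if every QPT adversary wins the following game with probability at most $\frac12+\varepsilon(\lambda)$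 for some negligible $\varepsilon$ and all $\lambda$: a key $sk$ is chosen uniformly; with classical access to $\mathsf{SE.Enc}(sk,\cdot)$ and $\mathsf{SE.Dec}(sk,\cdot)$ the adversary outputs two plaintexts $m_0,m_1$ of equal length; for a uniform bit $b$ it receives $c^*\leftarrow\mathsf{SE.Enc}(sk,m_b)$; with further access to both oracles, where decryption now returns $\bot$ on $c^*$, it outputs a bit $b'$, and wins if $b'=b$. Construction. Given $\{f_k\}$ and $\mathsf{SE}$, define the following encryption scheme with quantum public keys. Key generation: $\mathsf{dk}$ is uniform in $\{0,1\}^\lambda$, and the public key is the pure state $|qpk\rangle=2^{-\lambda/2}\sum_{x\in\{0,1\}^\lambda}|x,f_{\mathsf{dk}}(x)\rangle$. $\mathsf{Enc}$: to encrypt $m\in\{0,1\}^*$, measure the public key in the computational basis to obtain $(x,y)$ and output the classical ciphertext $(x,\mathsf{SE.Enc}(y,m))$; the post-measurement state $|x,y\rangle$ is the recycled public key. $\mathsf{Dec}(\mathsf{dk},(c_0,c_1))=\mathsf{SE.Dec}(f_{\mathsf{dk}}(c_0),c_1)$. IND-CCA-EO game. The challenger generates $\mathsf{dk}$ and a key register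 holding one copy of $|qpk\rangle$. Throughout the game the adversary may request fresh copies of $|qpk\rangle$, and may send classical messages $m$, each of which the challenger encrypts with the current content of its key register, returning the ciphertext and keeping the recycled key in the register. Before the challenge the adversary also has classical access to $\mathsf{Dec}(\mathsf{dk},\cdot)$. It then sends two messages $m_0',m_1'$ of equal length and receives the encryption $c^*$ of $m_b'$, for a uniform bit $b$, under the current key register (which is again recycled). Afterwards the decryption oracle returns $\bot$ on $c^*$ and is otherwise unchanged. The adversary outputs a bit $b'$ and wins if $b'=b$. The scheme is IND-CCA-EO secure if for every QPT adversary there is a negligible $\varepsilon$ such that for all $\lambda$ the winning probability is at most $\frac12+\varepsilon(\lambda)$. Theorem. If $\{f_k\}$ is a quantum-secure PRF and $\mathsf{SE}$ is a post-quantum IND-CCA secure symmetric-key encryption scheme, then the scheme of the Construction is IND-CCA-EO secure. -/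

import Mathlib

open scoped BigOperators

noncomputable section

namespace QPKE

/-! ### Bit strings, encodings, averages, negligible functions -/

/-- Bit strings of length `n`; also the computational basis of `n` qubits. -/
abbrev Bits (n : ℕ) : Type := Fin n → Bool

/-- Uniform average over a finite type. -/
def avg {α : Type} [Fintype α] (g : α → ℝ) : ℝ := (∑ a, g a) / (Fintype.card α : ℝ)

/-- `ε(l) = l^{-ω(1)}`. -/
def Negligible (ε : ℕ → ℝ) : Prop :=
  Asymptotics.SuperpolynomialDecay Filter.atTop (fun l : ℕ => (l : ℝ)) ε

/-- Self-delimiting code of a string of arbitrary length: every bit `b` becomes the cell `1 b`.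
In a longer register the code is followed by zeros. -/
def encodeStr (s : List Bool) : List Bool := s.flatMap fun b => [true, b]

/-- The string held by a register: the bits of the cells before the first cell with flag `0`. -/
def decodeStr : List Bool → List Bool
  | true :: b :: t => b :: decodeStr t
  | _ => []

/-- Code of an answer that is a string or the symbol `⊥` (which is `none`, coded by zeros). -/
def encodeAns : Option (List Bool) → List Bool
  | none => []
  | some s => true :: encodeStr s

/-! ### Boolean circuits -/

/-- A Boolean circuit as a straight-line program over NAND. The gate `(i, j)` appends the NAND of
the values number `i` and `j` to the list of values, which starts with the input;
an index out of range refers to the constant `0`. -/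
structure BoolCircuit where
  gates : List (ℕ × ℕ)
  outs : List ℕ

namespace BoolCircuit

def runGates : List (ℕ × ℕ) → List Bool → List Bool
  | [], v => v
  | g :: gs, v => runGates gs (v ++ [!(v.getD g.1 false && v.getD g.2 false)])

def eval (C : BoolCircuit) (v : List Bool) : List Bool :=
  C.outs.map fun i => (runGates C.gates v).getD i false

def size (C : BoolCircuit) : ℕ := C.gates.length + C.outs.length

/-- The output of `C` on input `v` is the code `s` followed by zeros. -/
def Outputs (C : BoolCircuit) (v s : List Bool) : Prop :=
  ∃ j : ℕ, C.eval v = s ++ List.replicate j false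

end BoolCircuit

/-! ### Quantum states and operations

The adversary holds `n` qubits; `V` is the Hilbert space of the challenger's quantum register
(`V = ℂ` if there is none). A vector of `(ℂ²)^{⊗ n} ⊗ V` is a function `Bits n → V`. Vectors are not
normalised: the squared norm of a vector is the probability of the branch that led to it. -/

abbrev St (n : ℕ) (V : Type) : Type := Bits n → V

section Ops

variable {n : ℕ} {V : Type} [NormedAddCommGroup V] [InnerProductSpace ℂ V]

/-- `|0…0⟩ ⊗ v`. -/
def initSt (v : V) : St n V := fun w => if w = (fun _ => false) then v else 0

/-- Measure the wires `reg` in the computational basis and continue with `k`, which receives the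
outcome and the projected vector; the values of `k` are added up over all outcomes. -/
def measure (reg : List (Fin n)) (ψ : St n V) (k : List Bool → St n V → ℝ) : ℝ :=
  ∑ s ∈ (Finset.univ : Finset (Bits n)).image (fun w => reg.map w),
    k s (fun w => if reg.map w = s then ψ w else 0)

/-- The bits that XOR-ing the string `s` (padded with zeros) into the wires `out` flips. -/
def xorMask (out : List (Fin n)) (s : List Bool) : Bits n :=
  fun j => decide (j ∈ out) && s.getD (out.idxOf j) false

/-- XOR the classical string `s` into the wires `out`. -/
def xorInto (out : List (Fin n)) (s : List Bool) (ψ : St n V) : St n V :=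
  fun w => ψ (fun j => xor (w j) (xorMask out s j))

/-- The probability (in the given branch) that measuring the wire `out` gives `b`. -/
def outProb (out : Fin n) (b : Bool) (ψ : St n V) : ℝ :=
  ∑ w : Bits n, if w out = b then ‖ψ w‖ ^ 2 else 0

end Ops

/-- Elementary operations of a quantum circuit on `n` wires with oracle queries from `Q`: the gates
`H`, `T`, `X`, `CNOT`, Toffoli (target last), measurement in the computational basis, and
reset to `|0⟩`. -/
inductive Op (n : ℕ) (Q : Type) : Type
  | h (i : Fin n)
  | t (i : Fin n)
  | x (i : Fin n)
  | cnot (i j : Fin n) (hij : i ≠ j)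
  | ccx (i j k : Fin n) (hij : i ≠ j) (hik : i ≠ k) (hjk : j ≠ k)
  | meas (i : Fin n)
  | reset (i : Fin n)
  | query (q : Q)

namespace Op

variable {n : ℕ} {Q V : Type} [NormedAddCommGroup V] [InnerProductSpace ℂ V]

/-- Apply one operation and continue with `k`, adding up the values of `k` over the branches.
`ans` is the behaviour of the oracles. -/
def step (ans : Q → St n V → (St n V → ℝ) → ℝ) : Op n Q → St n V → (St n V → ℝ) → ℝ
  | h i, ψ, k => k fun w => ((Real.sqrt 2 : ℝ) : ℂ)⁻¹ •
      (ψ (Function.update w i false) +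
        (if w i then (-1 : ℂ) else 1) • ψ (Function.update w i true))
  | t i, ψ, k => k fun w =>
      (if w i then Complex.exp (Complex.I * (Real.pi / 4 : ℝ)) else 1) • ψ w
  | x i, ψ, k => k fun w => ψ (Function.update w i (!(w i)))
  | cnot i j _, ψ, k => k fun w => ψ (Function.update w j (xor (w j) (w i)))
  | ccx i j m _ _ _, ψ, k => k fun w => ψ (Function.update w m (xor (w m) (w i && w j)))
  | meas i, ψ, k => measure [i] ψ fun _ φ => k φ
  | reset i, ψ, k => ∑ b : Bool,
      k fun w => if w i = false then ψ (Function.update w i b) else 0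
  | query q, ψ, k => ans q ψ k

/-- Run a list of operations and continue with `k`. -/
def run (ans : Q → St n V → (St n V → ℝ) → ℝ) : List (Op n Q) → St n V → (St n V → ℝ) → ℝ
  | [], ψ, k => k ψ
  | o :: l, ψ, k => step ans o ψ fun φ => run ans l φ k

/-- Elementary operations count `1`, a query counts `1` plus the length of its registers. -/
def size (qsize : Q → ℕ) : Op n Q → ℕ
  | query q => 1 + qsize q
  | _ => 1

end Op

def sizeOps {n : ℕ} {Q : Type} (qsize : Q → ℕ) (l : List (Op n Q)) : ℕ :=
  (l.map (Op.size qsize)).sum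

/-! ### Quantum-secure pseudorandom functions -/

/-- The wires of a query: the argument `x` and the target `z`. -/
abbrev PRFQuery (l n : ℕ) : Type := (Fin l ⊕ Fin l) ↪ Fin n

/-- The superposition query `|x⟩|z⟩ ↦ |x⟩|z ⊕ g(x)⟩`. -/
def prfAns {l n : ℕ} (g : Bits l → Bits l) (q : PRFQuery l n) (ψ : St n ℂ)
    (k : St n ℂ → ℝ) : ℝ :=
  k fun w => ψ fun j => xor (w j)
    (Function.extend (fun i => q (Sum.inr i)) (g fun i => w (q (Sum.inl i))) (fun _ => false) j)

structure PRFAdversary (l : ℕ) where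
  n : ℕ
  ops : List (Op n (PRFQuery l n))
  out : Fin n

namespace PRFAdversary

def size {l : ℕ} (A : PRFAdversary l) : ℕ := A.n + sizeOps (fun _ => 2 * l) A.ops

/-- The probability that the adversary with oracle `g` outputs `1`. -/
def prob {l : ℕ} (A : PRFAdversary l) (g : Bits l → Bits l) : ℝ :=
  Op.run (prfAns g) A.ops (initSt 1) (outProb A.out true)

end PRFAdversary

/-- A keyed family `f_k : {0,1}^l → {0,1}^l`, `k ∈ {0,1}^l`. -/
abbrev KeyedFamily : Type := ∀ l : ℕ, Bits l → Bits l → Bits l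

/-- `(k, x) ↦ f_k(x)` is computed by Boolean circuits of polynomial size. -/
def KeyedFamily.Efficient (f : KeyedFamily) : Prop :=
  ∃ p : Polynomial ℕ, ∀ l : ℕ, ∃ C : BoolCircuit, C.size ≤ p.eval l ∧
    ∀ k x : Bits l, C.eval (List.ofFn k ++ List.ofFn x) = List.ofFn (f l k x)

/-- `f` is a quantum-secure pseudorandom function. -/
def KeyedFamily.IsQuantumSecurePRF (f : KeyedFamily) : Prop :=
  f.Efficient ∧
  ∀ A : (∀ l : ℕ, PRFAdversary l),
    (∃ p : Polynomial ℕ, ∀ l, (A l).size ≤ p.eval l) →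
    ∃ μ : ℕ → ℝ, Negligible μ ∧ ∀ l,
      |avg (fun k : Bits l => (A l).prob (f l k)) -
        avg (fun g : Bits l → Bits l => (A l).prob g)| ≤ μ l

/-! ### Symmetric-key encryption -/

/-- A symmetric-key encryption scheme with keys in `{0,1}^l` and plaintexts in `{0,1}^*`.
`enc l k m r` is the encryption of `m` with the coins `r ∈ {0,1}^(coins l |m|)`; decryption is
deterministic and may return `⊥` (`none`).

Both are polynomial-time in the non-uniform sense: for all `l` and `L`, one Boolean circuit of size
polynomial in `l + L` handles all plaintexts (ciphertexts) of at most `L` bits, which are held by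
a register of `L` cells; of the coins supplied, as many as needed are used. -/
structure SKE where
  coins : ℕ → ℕ → ℕ
  enc : ∀ l : ℕ, Bits l → List Bool → List Bool → List Bool
  dec : ∀ l : ℕ, Bits l → List Bool → Option (List Bool)
  enc_efficient : ∃ p : Polynomial ℕ, ∀ l L : ℕ, ∃ (R : ℕ) (C : BoolCircuit),
    R ≤ p.eval (l + L) ∧ C.size ≤ p.eval (l + L) ∧ (∀ i ≤ L, coins l i ≤ R) ∧
    ∀ (k : Bits l) (v r : List Bool), v.length = 2 * L → r.length = R →
      C.Outputs (List.ofFn k ++ v ++ r)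
        (encodeStr (enc l k (decodeStr v) (r.take (coins l (decodeStr v).length))))
  dec_efficient : ∃ p : Polynomial ℕ, ∀ l L : ℕ, ∃ C : BoolCircuit,
    C.size ≤ p.eval (l + L) ∧
    ∀ (k : Bits l) (v : List Bool), v.length = 2 * L →
      C.Outputs (List.ofFn k ++ v) (encodeAns (dec l k (decodeStr v)))

/-- A two-stage adversary on `n` wires. After the first stage the challenge plaintexts are read from
the registers `msg₀` and `msg₁`, and the challenge ciphertext is delivered into `chal`; after the
second stage the guess is the outcome of measuring `out`. -/
structure TwoStageAdversary (Q : ℕ → Type) where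
  n : ℕ
  stage₁ : List (Op n (Q n))
  msg₀ : List (Fin n)
  msg₁ : List (Fin n)
  chal : List (Fin n)
  stage₂ : List (Op n (Q n))
  out : Fin n

def TwoStageAdversary.size {Q : ℕ → Type} (qsize : ∀ n, Q n → ℕ) (A : TwoStageAdversary Q) : ℕ :=
  A.n + sizeOps (qsize A.n) A.stage₁ + A.msg₀.length + A.msg₁.length + A.chal.length +
    sizeOps (qsize A.n) A.stage₂

/-- Decryption that returns `⊥` on the forbidden ciphertext, if there is one. -/
def decExcept {α : Type} (forbidden : Option (List Bool)) (bot : α) (dec : List Bool → α)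
    (c : List Bool) : α :=
  if some c = forbidden then bot else dec c

/-- A classical query to the encryption or the decryption oracle: the string in `inp` is measured and
the code of the answer is XOR-ed into `out`. -/
inductive SKEQuery (n : ℕ) : Type
  | enc (inp out : List (Fin n))
  | dec (inp out : List (Fin n))

def SKEQuery.size {n : ℕ} : SKEQuery n → ℕ
  | enc inp out => inp.length + out.length
  | dec inp out => inp.length + out.length

namespace SKE

variable (S : SKE)

/-- The expected value of `k c` for `c ← Enc(sk, m)`. -/
def encAvg {l : ℕ} (sk : Bits l) (m : List Bool) (k : List Bool → ℝ) : ℝ :=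
  avg fun r : Bits (S.coins l m.length) => k (S.enc l sk m (List.ofFn r))

/-- The oracles `Enc(sk, ·)` and `Dec(sk, ·)`, the latter with at most one forbidden ciphertext. -/
def ans {l n : ℕ} (sk : Bits l) (forbidden : Option (List Bool)) :
    SKEQuery n → St n ℂ → (St n ℂ → ℝ) → ℝ
  | .enc inp out, ψ, k => measure inp ψ fun v φ =>
      S.encAvg sk (decodeStr v) fun c => k (xorInto out (encodeAns (some c)) φ)
  | .dec inp out, ψ, k => measure inp ψ fun v φ =>
      k (xorInto out (encodeAns (decExcept forbidden none (S.dec l sk) (decodeStr v))) φ)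

/-- The probability that the adversary guesses `b` when `b` is the challenge bit and `sk` the key.
Plaintexts of different lengths are answered by `⊥`. -/
def guessProb {l : ℕ} (A : TwoStageAdversary SKEQuery) (sk : Bits l) (b : Bool) : ℝ :=
  Op.run (S.ans sk none) A.stage₁ (initSt 1) fun ψ =>
    measure A.msg₀ ψ fun v₀ ψ₀ => measure A.msg₁ ψ₀ fun v₁ ψ₁ =>
      if (decodeStr v₀).length = (decodeStr v₁).length then
        S.encAvg sk (decodeStr (if b then v₁ else v₀)) fun c =>
          Op.run (S.ans sk (some c)) A.stage₂ (xorInto A.chal (encodeAns (some c)) ψ₁)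
            (outProb A.out b)
      else
        Op.run (S.ans sk none) A.stage₂ (xorInto A.chal (encodeAns none) ψ₁) (outProb A.out b)

def winProb (l : ℕ) (A : TwoStageAdversary SKEQuery) : ℝ :=
  avg fun sk : Bits l => avg fun b : Bool => S.guessProb A sk b

/-- Post-quantum IND-CCA security. -/
def IsPostQuantumINDCCA : Prop :=
  ∀ A : ℕ → TwoStageAdversary SKEQuery,
    (∃ p : Polynomial ℕ, ∀ l, (A l).size (fun _ => SKEQuery.size) ≤ p.eval l) →
    ∃ ε : ℕ → ℝ, Negligible ε ∧ ∀ l, S.winProb l (A l) ≤ 1 / 2 + ε l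

end SKE

/-! ### Encryption with quantum public keys and classical ciphertexts -/

/-- The algorithms of an encryption scheme with quantum public keys and classical ciphertexts.
The public key of security parameter `l` is a pure state of the qubits `Key l`. `Enc(·, m)` maps the
public key to a ciphertext and a recycled public key; it is given as a quantum instrument in Kraus
form: the branch `β` applies the operator `kraus β` to the key and outputs the ciphertext `ct β`. -/
structure Scheme where
  dkLen : ℕ → ℕ
  gen : ∀ l : ℕ, PMF (Bits (dkLen l))
  Key : ℕ → Type
  [fintypeKey : ∀ l, Fintype (Key l)]
  [decEqKey : ∀ l, DecidableEq (Key l)]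
  qpkGen : ∀ l : ℕ, Bits (dkLen l) → EuclideanSpace ℂ (Key l → Bool)
  norm_qpkGen : ∀ (l : ℕ) (dk : Bits (dkLen l)), ‖qpkGen l dk‖ = 1
  Branch : ℕ → List Bool → Type
  [fintypeBranch : ∀ l m, Fintype (Branch l m)]
  kraus : ∀ (l : ℕ) (m : List Bool), Branch l m →
    EuclideanSpace ℂ (Key l → Bool) →ₗ[ℂ] EuclideanSpace ℂ (Key l → Bool)
  ct : ∀ (l : ℕ) (m : List Bool), Branch l m → List Bool
  kraus_complete : ∀ (l : ℕ) (m : List Bool) (v : EuclideanSpace ℂ (Key l → Bool)),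
    ∑ β : Branch l m, ‖kraus l m β v‖ ^ 2 = ‖v‖ ^ 2
  dec : ∀ l : ℕ, Bits (dkLen l) → List Bool → PMF (Option (List Bool))

attribute [instance] Scheme.fintypeKey Scheme.decEqKey Scheme.fintypeBranch

/-- Queries in the IND-CCA-EO game: a fresh copy of the public key into the wires `tgt`, and
classical encryption and decryption queries. -/
inductive EOQuery (K : Type) (n : ℕ) : Type
  | qpk (tgt : K ↪ Fin n)
  | enc (inp out : List (Fin n))
  | dec (inp out : List (Fin n))

def EOQuery.size {K : Type} [Fintype K] {n : ℕ} : EOQuery K n → ℕ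
  | qpk _ => Fintype.card K
  | enc inp out => inp.length + out.length
  | dec inp out => inp.length + out.length

namespace Scheme

variable (E : Scheme)

abbrev KeySpace (l : ℕ) : Type := EuclideanSpace ℂ (E.Key l → Bool)

/-- Encrypt `m` with the challenger's current public key, and continue with `k`, which receives the
ciphertext and the new joint state (with the recycled key). -/
def encStep {l n : ℕ} (m : List Bool) (ψ : St n (E.KeySpace l))
    (k : List Bool → St n (E.KeySpace l) → ℝ) : ℝ :=
  ∑ β : E.Branch l m, k (E.ct l m β) fun w => E.kraus l m β (ψ w)

/-- The oracles of the game. A public-key query discards the content of the target wires and puts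
`|qpk⟩` there: its Kraus operators are `|qpk⟩⟨o|`, for `o` in the computational basis. -/
def ans {l n : ℕ} (dk : Bits (E.dkLen l)) (forbidden : Option (List Bool)) :
    EOQuery (E.Key l) n → St n (E.KeySpace l) → (St n (E.KeySpace l) → ℝ) → ℝ
  | .qpk tgt, ψ, k => ∑ o : E.Key l → Bool,
      k fun w => E.qpkGen l dk (fun i => w (tgt i)) • ψ (Function.extend tgt o w)
  | .enc inp out, ψ, k => measure inp ψ fun v φ =>
      E.encStep (decodeStr v) φ fun c χ => k (xorInto out (encodeAns (some c)) χ)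
  | .dec inp out, ψ, k => measure inp ψ fun v φ =>
      ∑' a : Option (List Bool),
        (decExcept forbidden (PMF.pure none) (E.dec l dk) (decodeStr v) a).toReal *
          k (xorInto out (encodeAns a) φ)

/-- The probability that the adversary guesses `b` when `b` is the challenge bit and `dk` the
decryption key. The challenger's key register starts as a public key and is recycled by every
encryption. Plaintexts of different lengths are answered by `⊥`. -/
def guessProb {l : ℕ} (A : TwoStageAdversary (EOQuery (E.Key l))) (dk : Bits (E.dkLen l))
    (b : Bool) : ℝ :=
  Op.run (E.ans dk none) A.stage₁ (initSt (E.qpkGen l dk)) fun ψ =>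
    measure A.msg₀ ψ fun v₀ ψ₀ => measure A.msg₁ ψ₀ fun v₁ ψ₁ =>
      if (decodeStr v₀).length = (decodeStr v₁).length then
        E.encStep (decodeStr (if b then v₁ else v₀)) ψ₁ fun c φ =>
          Op.run (E.ans dk (some c)) A.stage₂ (xorInto A.chal (encodeAns (some c)) φ)
            (outProb A.out b)
      else
        Op.run (E.ans dk none) A.stage₂ (xorInto A.chal (encodeAns none) ψ₁) (outProb A.out b)

def winProb (l : ℕ) (A : TwoStageAdversary (EOQuery (E.Key l))) : ℝ :=
  ∑ dk : Bits (E.dkLen l), (E.gen l dk).toReal * avg fun b : Bool => E.guessProb A dk b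

/-- IND-CCA-EO security: adaptive chosen-ciphertext attacks (CCA2) with an encryption oracle. -/
def IsINDCCAEO : Prop :=
  ∀ A : (∀ l : ℕ, TwoStageAdversary (EOQuery (E.Key l))),
    (∃ p : Polynomial ℕ, ∀ l, (A l).size (fun _ => EOQuery.size) ≤ p.eval l) →
    ∃ ε : ℕ → ℝ, Negligible ε ∧ ∀ l, E.winProb l (A l) ≤ 1 / 2 + ε l

end Scheme

/-! ### The construction -/

/-- `2^{-l/2} ∑_x |x, g(x)⟩`. -/
def graphState {l : ℕ} (g : Bits l → Bits l) : EuclideanSpace ℂ (Fin l ⊕ Fin l → Bool) :=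
  ((Real.sqrt (2 ^ l) : ℝ) : ℂ)⁻¹ • ∑ x : Bits l, EuclideanSpace.single (Sum.elim x (g x)) (1 : ℂ)

theorem norm_graphState {l : ℕ} (g : Bits l → Bits l) : ‖graphState g‖ = 1 := by
  have hinj : Function.Injective fun x : Bits l => (Sum.elim x (g x) : Fin l ⊕ Fin l → Bool) := by
    intro x y h
    funext i
    exact congrFun h (Sum.inl i)
  have ho : Orthonormal ℂ fun x : Bits l =>
      (EuclideanSpace.single (Sum.elim x (g x)) (1 : ℂ) :
        EuclideanSpace ℂ (Fin l ⊕ Fin l → Bool)) :=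
    (EuclideanSpace.orthonormal_single (𝕜 := ℂ) (ι := Fin l ⊕ Fin l → Bool)).comp _ hinj
  have hn : ‖∑ x : Bits l, (EuclideanSpace.single (Sum.elim x (g x)) (1 : ℂ) :
      EuclideanSpace ℂ (Fin l ⊕ Fin l → Bool))‖ ^ 2 = 2 ^ l := by
    have h := ho.inner_sum (fun _ => (1 : ℂ)) (fun _ => (1 : ℂ)) Finset.univ
    simp only [one_smul] at h
    rw [inner_self_eq_norm_sq_to_K] at h
    simp only [map_one, mul_one, Finset.sum_const, Finset.card_univ, Fintype.card_pi,
      Fintype.card_bool, Finset.prod_const, Fintype.card_fin, nsmul_eq_mul] at h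
    have h' := congrArg Complex.re h
    norm_cast at h'
    exact_mod_cast h'
  rw [graphState, norm_smul, norm_inv, Complex.norm_real, Real.norm_of_nonneg (Real.sqrt_nonneg _),
    ← hn, Real.sqrt_sq (norm_nonneg _)]
  refine inv_mul_cancel₀ fun h0 => ?_
  rw [h0] at hn
  have : (0 : ℝ) < 2 ^ l := by positivity
  rw [← hn] at this
  norm_num at this

/-- `v ↦ a ⟨z|v⟩ |z⟩`: the computational-basis measurement outcome `z`, scaled by `a`. -/
def basisKraus {ι : Type} [Fintype ι] [DecidableEq ι] (a : ℂ) (z : ι) :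
    EuclideanSpace ℂ ι →ₗ[ℂ] EuclideanSpace ℂ ι where
  toFun v := EuclideanSpace.single z (a * v z)
  map_add' u v := by
    ext i
    by_cases h : i = z <;> simp [h, mul_add]
  map_smul' c v := by
    ext i
    by_cases h : i = z <;> simp [h]
    ring

theorem basisKraus_complete {ι : Type} [Fintype ι] [DecidableEq ι] (c : ℕ)
    (v : EuclideanSpace ℂ ι) :
    ∑ β : ι × Bits c, ‖basisKraus (((Real.sqrt (2 ^ c) : ℝ) : ℂ)⁻¹) β.1 v‖ ^ 2 = ‖v‖ ^ 2 := by
  rw [Fintype.sum_prod_type, EuclideanSpace.norm_sq_eq]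
  refine Finset.sum_congr rfl fun z _ => ?_
  have h2 : (0 : ℝ) < 2 ^ c := by positivity
  simp [basisKraus, mul_pow, abs_of_nonneg (Real.sqrt_nonneg _), Real.sq_sqrt h2.le]

/-- The encryption scheme built from `f` and `S`. A ciphertext `(x, c)` with `x ∈ {0,1}^l` is the
string `x ++ c`.
* `Gen`: `dk` uniform in `{0,1}^l`. Public key: `2^{-l/2} ∑_x |x, f_dk(x)⟩`.
* `Enc`: measure the key in the computational basis, with outcome `z = (x, y)`; choose uniform
  coins `r`; output `(x, S.Enc(y, m; r))`. The recycled key is the measured state `|x, y⟩`.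
* `Dec`: on `(x, c)` return `S.Dec(f_dk(x), c)`; strings that are too short give `⊥`. -/
def construction (f : KeyedFamily) (S : SKE) : Scheme where
  dkLen l := l
  gen l := PMF.uniformOfFintype (Bits l)
  Key l := Fin l ⊕ Fin l
  qpkGen l dk := graphState (f l dk)
  norm_qpkGen _ _ := norm_graphState _
  Branch l m := (Fin l ⊕ Fin l → Bool) × Bits (S.coins l m.length)
  kraus l m β := basisKraus (((Real.sqrt (2 ^ S.coins l m.length) : ℝ) : ℂ)⁻¹) β.1
  ct l m β := List.ofFn (fun i => β.1 (Sum.inl i)) ++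
    S.enc l (fun i => β.1 (Sum.inr i)) m (List.ofFn β.2)
  kraus_complete _ _ v := basisKraus_complete _ v
  dec l dk c := PMF.pure
    (if c.length < l then none
      else S.dec l (f l dk fun i => c.getD i false) (c.drop l))

end QPKE

end

open scoped BigOperators

noncomputable section

namespace QPKE

/-! ### Effects and instruments -/

/-! The challenger's key register is touched only by encryption, which measures it in the
computational basis. It may therefore be measured once and for all at the start: the game is the
average, over a uniform `x`, of a game in which every encryption uses the classical pair `(x, f_dk
x)` (`Splits`, `guessProb_construction`). It remains to show that the symmetric key `f_dk x` is as
good as an independent uniform key, although the public keys contain it in superposition and the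
decryption oracle uses it.

For this, `measuredGuess S A x y g h b` separates the roles of the function: `y` is the key in the
register, `g` prepares the public keys and `h` decrypts. Fix `x` and `b`, and write `g[x:=y]` for
`Function.update g x y`. The hybrids `(y, g, h)` are as follows. From `(f x, f, f)` one passes to
`(g x, g, g)` with a uniform function `g`, by pseudorandomness. This is `(y, g[x:=y], g[x:=y])` with
a fresh uniform `y` (`avg_update`). Public keys of functions that differ at one point are at
distance at most `2 · 2^(-l/2)`, so `(y, g, g[x:=y])` is negligibly close (`measuredGuess_dist`). A
second use of pseudorandomness gives `(y, f, f[x:=y])`. There `y` is independent of `x` and `dk`,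
and serves only to encrypt and to decrypt ciphertexts with first component `x`. So this is the
IND-CCA game of the symmetric scheme, played by an adversary that knows `x` and `dk`
(`exists_skeAdversary`). The return from `g` to `f` is needed because that adversary prepares public
keys and decrypts by itself, which takes a small circuit for the function.

Since adversaries are non-uniform, the worst values of `x`, `y`, `b`, `dk` can be hardwired into the
reductions (the two lemmas `uniform`), and each comparison then holds for all values at once.

Most of the length comes from exhibiting the reductions as circuits. They run the adversary next to
a block of memory wires. Inputs of classical queries are measured first, so in every branch the
memory holds a definite string (`emb`), and an answer is computed by a circuit and the scratch space
is reset. Existence and size of the circuits come from the calculus of `Computable` and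
`ComputableStr`, and `exists_simulation` assembles the answers into a whole stage. Only the
preparation of public keys is coherent: a uniform superposition followed by one superposition query
(`exists_qpk_prf`), or by a reversible circuit that is uncomputed afterwards (`act_coherentOps`). -/

/-- `k(aψ) = |a|² k(ψ)`. -/
def QuadHom {n : ℕ} (k : St n ℂ → ℝ) : Prop :=
  ∀ (a : ℂ) (ψ : St n ℂ), k (a • ψ) = ‖a‖ ^ 2 * k ψ

theorem QuadHom.zero {n : ℕ} {k : St n ℂ → ℝ} (h : QuadHom k) : k 0 = 0 := by
  simpa using h 0 0

def normSq {n : ℕ} (ψ : St n ℂ) : ℝ := ∑ w, ‖ψ w‖ ^ 2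

theorem normSq_nonneg {n : ℕ} (ψ : St n ℂ) : 0 ≤ normSq ψ :=
  Finset.sum_nonneg fun _ _ => by positivity

/-- The acceptance probability of a test, as a function of the unnormalised state: a positive
quadratic form bounded by the squared norm. -/
structure IsEffect {n : ℕ} (k : St n ℂ → ℝ) : Prop where
  hom : QuadHom k
  nonneg : ∀ ψ, 0 ≤ k ψ
  -- Minimising over `t` gives the triangle inequality for the square root of `k`. This form
  -- survives sums and composition with linear maps, so no sesquilinear form has to be carried
  -- along.
  add_le : ∀ t : ℝ, 0 < t → ∀ ψ φ, k (ψ + φ) ≤ (1 + t) * k ψ + (1 + t⁻¹) * k φ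
  le : ∀ ψ, k ψ ≤ normSq ψ

/-- An operation with classical outcomes in `β`, which maps effects to effects and does not increase
the distance of continuations. -/
structure IsInstrument {n : ℕ} {β : Type} (T : St n ℂ → (β → St n ℂ → ℝ) → ℝ) : Prop where
  hom : ∀ k, (∀ b, QuadHom (k b)) → QuadHom fun ψ => T ψ k
  effect : ∀ k, (∀ b, IsEffect (k b)) → IsEffect fun ψ => T ψ k
  dist : ∀ (k k' : β → St n ℂ → ℝ) (e : ℝ), 0 ≤ e →
    (∀ b φ, |k b φ - k' b φ| ≤ e * normSq φ) → ∀ ψ, |T ψ k - T ψ k'| ≤ e * normSq ψ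

/-- An instrument without classical outcome. -/
def IsChannel {n : ℕ} (T : St n ℂ → (St n ℂ → ℝ) → ℝ) : Prop :=
  IsInstrument fun ψ (k : Unit → St n ℂ → ℝ) => T ψ (k ())

theorem IsChannel.hom {n : ℕ} {T : St n ℂ → (St n ℂ → ℝ) → ℝ} (h : IsChannel T)
    {k : St n ℂ → ℝ} (hk : QuadHom k) : QuadHom fun ψ => T ψ k :=
  IsInstrument.hom h (fun _ => k) fun _ => hk

theorem IsChannel.effect {n : ℕ} {T : St n ℂ → (St n ℂ → ℝ) → ℝ} (h : IsChannel T)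
    {k : St n ℂ → ℝ} (hk : IsEffect k) : IsEffect fun ψ => T ψ k :=
  IsInstrument.effect h (fun _ => k) fun _ => hk

theorem IsChannel.dist {n : ℕ} {T : St n ℂ → (St n ℂ → ℝ) → ℝ} (h : IsChannel T)
    {k k' : St n ℂ → ℝ} {e : ℝ} (he : 0 ≤ e) (hk : ∀ φ, |k φ - k' φ| ≤ e * normSq φ)
    (ψ : St n ℂ) : |T ψ k - T ψ k'| ≤ e * normSq ψ :=
  IsInstrument.dist h (fun _ => k) (fun _ => k') e he (fun _ => hk) ψ

theorem IsInstrument.bind {n : ℕ} {β γ : Type} {T : St n ℂ → (β → St n ℂ → ℝ) → ℝ}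
    (hT : IsInstrument T) {U : β → St n ℂ → (γ → St n ℂ → ℝ) → ℝ}
    (hU : ∀ b, IsInstrument (U b)) :
    IsInstrument fun ψ k => T ψ fun b φ => U b φ k where
  hom k hk := hT.hom _ fun b => (hU b).hom k hk
  effect k hk := hT.effect _ fun b => (hU b).effect k hk
  dist k k' e he h := hT.dist _ _ e he fun b => (hU b).dist k k' e he h

theorem IsInstrument.bindChannel {n : ℕ} {β : Type} {T : St n ℂ → (β → St n ℂ → ℝ) → ℝ}
    (hT : IsInstrument T) {U : β → St n ℂ → (St n ℂ → ℝ) → ℝ}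
    (hU : ∀ b, IsChannel (U b)) :
    IsChannel fun ψ k => T ψ fun b φ => U b φ k :=
  IsInstrument.bind hT hU

/-- An instrument in Kraus form, with weights. -/
theorem IsInstrument.of_kraus {n : ℕ} {β ι : Type} (s : Finset ι) (c : ι → ℝ) (o : ι → β)
    (K : ι → St n ℂ → St n ℂ) (hc : ∀ i, 0 ≤ c i)
    (hadd : ∀ i ψ φ, K i (ψ + φ) = K i ψ + K i φ)
    (hsmul : ∀ i (a : ℂ) ψ, K i (a • ψ) = a • K i ψ)
    (hnorm : ∀ ψ, ∑ i ∈ s, c i * normSq (K i ψ) ≤ normSq ψ) :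
    IsInstrument fun ψ (k : β → St n ℂ → ℝ) => ∑ i ∈ s, c i * k (o i) (K i ψ) where
  hom k hk a ψ := by
    rw [Finset.mul_sum]
    refine Finset.sum_congr rfl fun i _ => ?_
    rw [hsmul, hk (o i)]; ring
  effect k hk :=
    { hom := fun a ψ => by
        rw [Finset.mul_sum]
        refine Finset.sum_congr rfl fun i _ => ?_
        rw [hsmul, (hk (o i)).hom]; ring
      nonneg := fun ψ => Finset.sum_nonneg fun i _ => mul_nonneg (hc i) ((hk _).nonneg _)
      add_le := fun t ht ψ φ => by
        rw [Finset.mul_sum, Finset.mul_sum, ← Finset.sum_add_distrib]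
        refine Finset.sum_le_sum fun i _ => ?_
        rw [hadd]
        have := mul_le_mul_of_nonneg_left ((hk (o i)).add_le t ht (K i ψ) (K i φ)) (hc i)
        linarith
      le := fun ψ => le_trans (Finset.sum_le_sum fun i _ =>
        mul_le_mul_of_nonneg_left ((hk _).le _) (hc i)) (hnorm ψ) }
  dist k k' e he h ψ := by
    rw [← Finset.sum_sub_distrib]
    refine (Finset.abs_sum_le_sum_abs _ _).trans ?_
    refine le_trans (Finset.sum_le_sum (g := fun i => e * (c i * normSq (K i ψ)))
      fun i _ => ?_) ?_
    · rw [← mul_sub, abs_mul, abs_of_nonneg (hc i)]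
      have := mul_le_mul_of_nonneg_left (h (o i) (K i ψ)) (hc i)
      linarith
    · rw [← Finset.mul_sum]
      exact mul_le_mul_of_nonneg_left (hnorm ψ) he

theorem IsChannel.of_isometry {n : ℕ} (K : St n ℂ → St n ℂ)
    (hadd : ∀ ψ φ, K (ψ + φ) = K ψ + K φ) (hsmul : ∀ (a : ℂ) ψ, K (a • ψ) = a • K ψ)
    (hnorm : ∀ ψ, normSq (K ψ) = normSq ψ) : IsChannel fun ψ k => k (K ψ) := by
  have := IsInstrument.of_kraus (β := Unit) ({()} : Finset Unit) (fun _ => 1) id (fun _ => K)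
    (fun _ => zero_le_one) (fun _ => hadd) (fun _ => hsmul) (fun ψ => by simp [hnorm])
  simpa [IsChannel] using this

/-- Precomposition with a permutation of the computational basis. -/
theorem IsChannel.of_involutive {n : ℕ} (σ : Bits n → Bits n) (hσ : Function.Involutive σ) :
    IsChannel fun ψ k => k fun w => ψ (σ w) :=
  IsChannel.of_isometry (fun ψ w => ψ (σ w)) (fun _ _ => rfl) (fun _ _ => rfl) fun ψ => by
    simpa [normSq] using Equiv.sum_comp hσ.toPerm fun w => ‖ψ w‖ ^ 2

theorem IsInstrument.avg {n : ℕ} {α β : Type} [Fintype α] [Nonempty α] (o : α → β) :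
    IsInstrument fun (ψ : St n ℂ) (k : β → St n ℂ → ℝ) => avg fun a => k (o a) ψ := by
  have := IsInstrument.of_kraus (n := n) (Finset.univ : Finset α)
    (fun _ => (Fintype.card α : ℝ)⁻¹) o (fun _ ψ => ψ) (fun _ => by positivity) (fun _ _ _ => rfl)
    (fun _ _ _ => rfl) (fun ψ => by
      rw [Finset.sum_const, Finset.card_univ, nsmul_eq_mul, ← mul_assoc,
        mul_inv_cancel₀ (by simp), one_mul])
  simpa [QPKE.avg, div_eq_inv_mul, Finset.mul_sum] using this

/-- Each basis vector belongs to exactly one outcome, so exchanging the sums leaves a single term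
for each `w`. -/
theorem sum_normSq_measure {n : ℕ} (reg : List (Fin n)) (ψ : St n ℂ) :
    ∑ s ∈ (Finset.univ : Finset (Bits n)).image (fun w => reg.map w),
      normSq (fun w => if reg.map w = s then ψ w else 0) = normSq ψ := by
  simp only [normSq]
  rw [Finset.sum_comm]
  refine Finset.sum_congr rfl fun w _ => ?_
  rw [Finset.sum_eq_single (reg.map w)]
  · simp
  · intro s _ hs
    simp [hs.symm]
  · intro h
    exact absurd (Finset.mem_image_of_mem _ (Finset.mem_univ w)) h

theorem isInstrument_measure {n : ℕ} (reg : List (Fin n)) :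
    IsInstrument fun (ψ : St n ℂ) k => measure reg ψ k := by
  have := IsInstrument.of_kraus (β := List Bool)
    ((Finset.univ : Finset (Bits n)).image (fun w => reg.map w)) (fun _ => 1) id
    (fun s (ψ : St n ℂ) w => if reg.map w = s then ψ w else 0) (fun _ => zero_le_one)
    (fun s ψ φ => by funext w; by_cases h : reg.map w = s <;> simp [h])
    (fun s a ψ => by funext w; by_cases h : reg.map w = s <;> simp [h])
    (fun ψ => by simp only [one_mul]; exact (sum_normSq_measure reg ψ).le)
  simpa [measure] using this

theorem xorInto_involutive {n : ℕ} (m : Bits n) :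
    Function.Involutive fun (w : Bits n) j => xor (w j) (m j) := by
  intro w; funext j; simp

theorem isChannel_xorInto {n : ℕ} (out : List (Fin n)) (s : List Bool) :
    IsChannel fun (ψ : St n ℂ) k => k (xorInto out s ψ) :=
  IsChannel.of_involutive _ (xorInto_involutive (xorMask out s))

theorem flip_involutive {n : ℕ} (i : Fin n) :
    Function.Involutive fun w : Bits n => Function.update w i (!(w i)) := by
  intro w; simp

theorem cnot_involutive {n : ℕ} (i j : Fin n) (hij : i ≠ j) :
    Function.Involutive fun w : Bits n => Function.update w j (xor (w j) (w i)) := by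
  intro w; simp [hij]

theorem ccx_involutive {n : ℕ} (i j m : Fin n) (him : i ≠ m) (hjm : j ≠ m) :
    Function.Involutive fun w : Bits n => Function.update w m (xor (w m) (w i && w j)) := by
  intro w; simp [him, hjm]

/-- The right-hand sum meets each pair of basis vectors that differ on wire `i` twice. Norm
identities for operations on one wire thereby become identities between two amplitudes. -/
theorem sum_eq_half_flip {n : ℕ} (i : Fin n) (F : Bits n → ℝ) :
    ∑ w, F w = (∑ w, (F (Function.update w i false) + F (Function.update w i true))) / 2 := by
  have h1 : ∑ w, F (Function.update w i (!(w i))) = ∑ w, F w :=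
    Equiv.sum_comp (flip_involutive i).toPerm F
  have h2 : ∀ w : Bits n, F (Function.update w i false) + F (Function.update w i true) =
      F w + F (Function.update w i (!(w i))) := by
    intro w
    cases h : w i
    · conv_rhs => rw [← Function.update_eq_self i w]
      simp [h]
    · conv_rhs => rw [← Function.update_eq_self i w]
      simp [h]; ring
  simp only [h2, Finset.sum_add_distrib, h1]; ring

/-- The parallelogram law for the two amplitudes on wire `i`; its factor 2 cancels the
normalisation. -/
theorem normSq_hadamard {n : ℕ} (i : Fin n) (ψ : St n ℂ) :
    normSq (fun w => ((Real.sqrt 2 : ℝ) : ℂ)⁻¹ •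
      (ψ (Function.update w i false) +
        (if w i then (-1 : ℂ) else 1) • ψ (Function.update w i true))) = normSq ψ := by
  unfold normSq
  rw [sum_eq_half_flip i, sum_eq_half_flip i (fun w => ‖ψ w‖ ^ 2)]
  congr 1
  refine Finset.sum_congr rfl fun w _ => ?_
  have hs : ‖((Real.sqrt 2 : ℝ) : ℂ)⁻¹‖ ^ 2 = 1 / 2 := by
    rw [norm_inv, Complex.norm_real, Real.norm_of_nonneg (Real.sqrt_nonneg _), inv_pow,
      Real.sq_sqrt (by norm_num)]; norm_num
  have hp := parallelogram_law_with_norm ℝ (ψ (Function.update w i false))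
    (ψ (Function.update w i true))
  simp only [norm_smul, mul_pow, hs, Function.update_self, Function.update_idem,
    Bool.false_eq_true, if_false, if_true, one_smul, neg_one_smul]
  rw [← sub_eq_add_neg]
  nlinarith

theorem isChannel_reset {n : ℕ} (i : Fin n) :
    IsChannel fun (ψ : St n ℂ) (k : St n ℂ → ℝ) => ∑ b : Bool,
      k fun w => if w i = false then ψ (Function.update w i b) else 0 := by
  have := IsInstrument.of_kraus (β := Unit) (Finset.univ : Finset Bool) (fun _ => 1) (fun _ => ())
    (fun b (ψ : St n ℂ) w => if w i = false then ψ (Function.update w i b) else 0)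
    (fun _ => zero_le_one)
    (fun s ψ φ => by funext w; by_cases h : w i = false <;> simp [h])
    (fun s a ψ => by funext w; by_cases h : w i = false <;> simp [h])
    (fun ψ => by
      simp only [one_mul, normSq, Fintype.sum_bool]
      rw [← Finset.sum_add_distrib, sum_eq_half_flip i, sum_eq_half_flip i (fun w => ‖ψ w‖ ^ 2)]
      refine le_of_eq ?_
      congr 1
      refine Finset.sum_congr rfl fun w _ => ?_
      simp [add_comm])
  simpa [IsChannel] using this

theorem isChannel_step {n : ℕ} {Q : Type} {ans : Q → St n ℂ → (St n ℂ → ℝ) → ℝ}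
    (hans : ∀ q, IsChannel (ans q)) (o : Op n Q) : IsChannel (Op.step ans o) := by
  cases o with
  | h i =>
    exact IsChannel.of_isometry (fun ψ w => ((Real.sqrt 2 : ℝ) : ℂ)⁻¹ •
      (ψ (Function.update w i false) +
        (if w i then (-1 : ℂ) else 1) • ψ (Function.update w i true)))
      (fun ψ φ => by funext w; simp only [Pi.add_apply, smul_eq_mul]; ring)
      (fun a ψ => by funext w; simp only [Pi.smul_apply, smul_eq_mul]; ring)
      (normSq_hadamard i)
  | t i =>
    refine IsChannel.of_isometry (fun ψ w =>
      (if w i then Complex.exp (Complex.I * (Real.pi / 4 : ℝ)) else 1) • ψ w)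
      (fun ψ φ => by funext w; simp [mul_add])
      (fun a ψ => by funext w; simp only [Pi.smul_apply, smul_eq_mul]; ring)
      (fun ψ => Finset.sum_congr rfl fun w _ => ?_)
    by_cases h : w i
    · simp only [h, if_true, norm_smul]
      rw [mul_comm Complex.I, Complex.norm_exp_ofReal_mul_I, one_mul]
    · simp [h]
  | x i => exact IsChannel.of_involutive _ (flip_involutive i)
  | cnot i j hij => exact IsChannel.of_involutive _ (cnot_involutive i j hij)
  | ccx i j m hij him hjm => exact IsChannel.of_involutive _ (ccx_involutive i j m him hjm)
  | meas i =>
    exact (isInstrument_measure [i]).bindChannel fun _ =>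
      IsChannel.of_isometry id (fun _ _ => rfl) (fun _ _ => rfl) fun _ => rfl
  | reset i => exact isChannel_reset i
  | query q => exact hans q

theorem isChannel_run {n : ℕ} {Q : Type} {ans : Q → St n ℂ → (St n ℂ → ℝ) → ℝ}
    (hans : ∀ q, IsChannel (ans q)) (l : List (Op n Q)) : IsChannel (Op.run ans l) := by
  induction l with
  | nil => exact IsChannel.of_isometry id (fun _ _ => rfl) (fun _ _ => rfl) fun _ => rfl
  | cons o l ih =>
    exact IsInstrument.bindChannel (isChannel_step hans o) fun _ => ih

theorem run_append {n : ℕ} {Q V : Type} [NormedAddCommGroup V] [InnerProductSpace ℂ V]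
    (ans : Q → St n V → (St n V → ℝ) → ℝ) (l₁ l₂ : List (Op n Q)) (ψ : St n V)
    (k : St n V → ℝ) :
    Op.run ans (l₁ ++ l₂) ψ k = Op.run ans l₁ ψ fun φ => Op.run ans l₂ φ k := by
  induction l₁ generalizing ψ with
  | nil => rfl
  | cons o l ih => simp only [List.cons_append, Op.run, ih]

theorem isEffect_outProb {n : ℕ} (out : Fin n) (b : Bool) :
    IsEffect (outProb (V := ℂ) out b) where
  hom a ψ := by
    rw [outProb, outProb, Finset.mul_sum]
    refine Finset.sum_congr rfl fun w _ => ?_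
    by_cases h : w out = b <;> simp [h, mul_pow]
  nonneg ψ := Finset.sum_nonneg fun w _ => by split_ifs <;> positivity
  add_le t ht ψ φ := by
    rw [outProb, outProb, outProb, Finset.mul_sum, Finset.mul_sum, ← Finset.sum_add_distrib]
    refine Finset.sum_le_sum fun w _ => ?_
    by_cases h : w out = b
    · simp only [h, if_true, Pi.add_apply]
      have h1 := norm_add_le (ψ w) (φ w)
      have h2 : ‖ψ w + φ w‖ ^ 2 ≤ (‖ψ w‖ + ‖φ w‖) ^ 2 := by gcongr
      -- Expand `t⁻¹ (t a - b)² ≥ 0`.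
      have h3 : 2 * (‖ψ w‖ * ‖φ w‖) ≤ t * ‖ψ w‖ ^ 2 + t⁻¹ * ‖φ w‖ ^ 2 := by
        have h4 := mul_nonneg (inv_nonneg.2 ht.le) (sq_nonneg (t * ‖ψ w‖ - ‖φ w‖))
        have h5 : t⁻¹ * (t * ‖ψ w‖ - ‖φ w‖) ^ 2 =
          t * ‖ψ w‖ ^ 2 + t⁻¹ * ‖φ w‖ ^ 2 - 2 * (‖ψ w‖ * ‖φ w‖) := by field_simp; ring
        linarith
      nlinarith
    · simp [h]
  le ψ := Finset.sum_le_sum fun w _ => by split_ifs <;> simp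

/-- The target wires are disjoint from the argument wires, so a second application XORs the same
value of `g` and cancels the first. -/
theorem isChannel_prfAns {l n : ℕ} (g : Bits l → Bits l) (q : PRFQuery l n) :
    IsChannel (prfAns g q) := by
  refine IsChannel.of_involutive (fun w j => xor (w j)
    (Function.extend (fun i => q (Sum.inr i)) (g fun i => w (q (Sum.inl i))) (fun _ => false) j))
    fun w => ?_
  funext j
  simp

instance {l : ℕ} : Nonempty (Bits l) := ⟨fun _ => false⟩

theorem isInstrument_encAvg (S : SKE) {l n : ℕ} (sk : Bits l) (m : List Bool) :
    IsInstrument fun (ψ : St n ℂ) (k : List Bool → St n ℂ → ℝ) =>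
      S.encAvg sk m fun c => k c ψ :=
  IsInstrument.avg fun r : Bits (S.coins l m.length) => S.enc l sk m (List.ofFn r)

theorem isChannel_skeAns (S : SKE) {l n : ℕ} (sk : Bits l) (forb : Option (List Bool))
    (q : SKEQuery n) : IsChannel (S.ans sk forb q) := by
  cases q with
  | enc inp out =>
    exact (isInstrument_measure inp).bindChannel fun v =>
      (isInstrument_encAvg S sk _).bindChannel fun c => isChannel_xorInto out _
  | dec inp out =>
    exact (isInstrument_measure inp).bindChannel fun v => isChannel_xorInto out _

/-! ### The game with a measured key register -/

/-- Decryption in the construction, with an arbitrary function in place of `f_dk`. -/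
def keyDec (S : SKE) {l : ℕ} (h : Bits l → Bits l) (c : List Bool) : Option (List Bool) :=
  if c.length < l then none else S.dec l (h fun i => c.getD i false) (c.drop l)

/-- Replace the content of the wires `tgt` by the state `G`. -/
def prepare {K : Type} [Fintype K] [DecidableEq K] {n : ℕ} (G : EuclideanSpace ℂ (K → Bool))
    (tgt : K ↪ Fin n) (ψ : St n ℂ) (k : St n ℂ → ℝ) : ℝ :=
  ∑ o : K → Bool, k fun w => G (fun i => w (tgt i)) • ψ (Function.extend tgt o w)

/-- The oracles of the game when the challenger's key register holds `|x, y⟩`. Public keys are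
prepared with `g`, and decryption uses `h`. -/
def measuredAns (S : SKE) {l n : ℕ} (x y : Bits l) (g h : Bits l → Bits l)
    (forbidden : Option (List Bool)) :
    EOQuery (Fin l ⊕ Fin l) n → St n ℂ → (St n ℂ → ℝ) → ℝ
  | .qpk tgt, ψ, k => prepare (graphState g) tgt ψ k
  | .enc inp out, ψ, k => measure inp ψ fun v φ =>
      S.encAvg y (decodeStr v) fun c => k (xorInto out (encodeAns (some (List.ofFn x ++ c))) φ)
  | .dec inp out, ψ, k => measure inp ψ fun v φ =>
      k (xorInto out (encodeAns (decExcept forbidden none (keyDec S h) (decodeStr v))) φ)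

/-- The part of the game that follows the first stage. -/
def measuredChallenge (S : SKE) {l : ℕ} (A : TwoStageAdversary (EOQuery (Fin l ⊕ Fin l)))
    (x y : Bits l) (g h : Bits l → Bits l) (b : Bool) (ψ : St A.n ℂ) : ℝ :=
  measure A.msg₀ ψ fun v₀ ψ₀ => measure A.msg₁ ψ₀ fun v₁ ψ₁ =>
    if (decodeStr v₀).length = (decodeStr v₁).length then
      S.encAvg y (decodeStr (if b then v₁ else v₀)) fun c =>
        Op.run (measuredAns S x y g h (some (List.ofFn x ++ c))) A.stage₂
          (xorInto A.chal (encodeAns (some (List.ofFn x ++ c))) ψ₁) (outProb A.out b)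
    else
      Op.run (measuredAns S x y g h none) A.stage₂ (xorInto A.chal (encodeAns none) ψ₁)
        (outProb A.out b)

def measuredGuess (S : SKE) {l : ℕ} (A : TwoStageAdversary (EOQuery (Fin l ⊕ Fin l)))
    (x y : Bits l) (g h : Bits l → Bits l) (b : Bool) : ℝ :=
  Op.run (measuredAns S x y g h none) A.stage₁ (initSt 1) (measuredChallenge S A x y g h b)

/-! ### Wires of a target register -/

/-- Replacing the content of `tgt` by `o` while keeping the old content is a swap of two registers.
-/
theorem extend_swap {K : Type} {n : ℕ} (tgt : K ↪ Fin n) :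
    Function.Involutive fun p : Bits n × (K → Bool) =>
      ((Function.extend tgt p.2 p.1, fun i => p.1 (tgt i)) : Bits n × (K → Bool)) := by
  rintro ⟨w, o⟩
  refine Prod.ext ?_ ?_
  · funext j
    by_cases hj : ∃ a, tgt a = j
    · obtain ⟨a, rfl⟩ := hj
      simp [tgt.injective.extend_apply]
    · simp [Function.extend_apply' _ _ _ hj]
  · funext a
    simp [tgt.injective.extend_apply]

/-- After the swap of `tgt` with the register `o`, the two factors depend on different variables. -/
theorem sum_prepare {K : Type} [Fintype K] [DecidableEq K] {n : ℕ} (tgt : K ↪ Fin n)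
    (F : (K → Bool) → ℝ) (H : Bits n → ℝ) :
    ∑ o : K → Bool, ∑ w, F (fun i => w (tgt i)) * H (Function.extend tgt o w) =
      (∑ o, F o) * ∑ w, H w := by
  rw [Finset.sum_comm, Finset.sum_mul_sum, Finset.sum_comm (s := Finset.univ (α := K → Bool)),
    ← Fintype.sum_prod_type', ← Fintype.sum_prod_type']
  exact Equiv.sum_comp (extend_swap tgt).toPerm fun p : Bits n × (K → Bool) => F p.2 * H p.1

theorem sum_normSq_prepare {K : Type} [Fintype K] [DecidableEq K] {n : ℕ}
    (G : EuclideanSpace ℂ (K → Bool)) (tgt : K ↪ Fin n) (ψ : St n ℂ) :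
    ∑ o : K → Bool, normSq (fun w => G (fun i => w (tgt i)) • ψ (Function.extend tgt o w)) =
      ‖G‖ ^ 2 * normSq ψ := by
  rw [EuclideanSpace.norm_sq_eq, normSq, ← sum_prepare tgt]
  simp [normSq, mul_pow]

theorem isChannel_prepare {K : Type} [Fintype K] [DecidableEq K] {n : ℕ}
    (G : EuclideanSpace ℂ (K → Bool)) (hG : ‖G‖ = 1) (tgt : K ↪ Fin n) :
    IsChannel (prepare G tgt) := by
  have := IsInstrument.of_kraus (β := Unit) (Finset.univ : Finset (K → Bool)) (fun _ => 1)
    (fun _ => ())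
    (fun o (ψ : St n ℂ) w => G (fun i => w (tgt i)) • ψ (Function.extend tgt o w))
    (fun _ => zero_le_one)
    (fun o ψ φ => by funext w; simp [mul_add])
    (fun o a ψ => by funext w; simp only [Pi.smul_apply, smul_eq_mul]; ring)
    (fun ψ => by simp only [one_mul]; rw [sum_normSq_prepare, hG]; simp)
  simpa [IsChannel, prepare] using this

theorem isChannel_measuredAns (S : SKE) {l n : ℕ} (x y : Bits l) (g h : Bits l → Bits l)
    (forb : Option (List Bool)) (q : EOQuery (Fin l ⊕ Fin l) n) :
    IsChannel (measuredAns S x y g h forb q) := by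
  cases q with
  | qpk tgt => exact isChannel_prepare _ (norm_graphState g) tgt
  | enc inp out =>
    exact (isInstrument_measure inp).bindChannel fun v =>
      (isInstrument_encAvg S y _).bindChannel fun c => isChannel_xorInto out _
  | dec inp out =>
    exact (isInstrument_measure inp).bindChannel fun v => isChannel_xorInto out _

theorem isEffect_measuredRun (S : SKE) {l n : ℕ} (x y : Bits l) (g h : Bits l → Bits l)
    (forb : Option (List Bool)) (ops : List (Op n (EOQuery (Fin l ⊕ Fin l) n)))
    (out : List (Fin n)) (s : List Bool) {k : St n ℂ → ℝ} (hk : IsEffect k) :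
    IsEffect fun ψ => Op.run (measuredAns S x y g h forb) ops (xorInto out s ψ) k :=
  (isChannel_xorInto out s).effect
    ((isChannel_run (isChannel_measuredAns S x y g h forb) ops).effect hk)

/-- Everything after the first stage is one test on the state, so statements about runs apply to the
first stage with this test as continuation. -/
theorem isEffect_measuredChallenge (S : SKE) {l : ℕ}
    (A : TwoStageAdversary (EOQuery (Fin l ⊕ Fin l)))
    (x y : Bits l) (g h : Bits l → Bits l) (b : Bool) :
    IsEffect (measuredChallenge S A x y g h b) := by
  refine (isInstrument_measure A.msg₀).effect _ fun v₀ =>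
    (isInstrument_measure A.msg₁).effect _ fun v₁ => ?_
  by_cases hlen : (decodeStr v₀).length = (decodeStr v₁).length
  · simp only [hlen, if_true]
    exact (isInstrument_encAvg S y _).effect _ fun c =>
      isEffect_measuredRun S x y g h _ _ _ _ (isEffect_outProb _ _)
  · simp only [hlen, if_false]
    exact isEffect_measuredRun S x y g h _ _ _ _ (isEffect_outProb _ _)

/-! ### Public keys of functions that differ at one point -/

/-- Apply `add_le` to `ψ = φ + (ψ - φ)` and bound the effect by the squared norm. -/
theorem IsEffect.sub_le {n : ℕ} {k : St n ℂ → ℝ} (hk : IsEffect k) {t : ℝ} (ht : 0 < t)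
    (ψ φ : St n ℂ) : k ψ - k φ ≤ t * normSq φ + (1 + t⁻¹) * normSq (ψ - φ) := by
  have h1 := hk.add_le t ht φ (ψ - φ)
  rw [add_sub_cancel] at h1
  have h2 := mul_le_mul_of_nonneg_left (hk.le φ) ht.le
  have h3 := mul_le_mul_of_nonneg_left (hk.le (ψ - φ)) (show 0 ≤ 1 + t⁻¹ by positivity)
  linarith

/-- The number `t` is both the bound on the distance of the states and the free parameter of
`add_le`; with this choice the error is `t + (1 + t⁻¹) t² = 2t + t²`. -/
theorem prepare_sub_le {K : Type} [Fintype K] [DecidableEq K] {n : ℕ}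
    (G G' : EuclideanSpace ℂ (K → Bool)) (hG' : ‖G'‖ = 1) {t : ℝ} (ht : 0 < t)
    (hGG : ‖G - G'‖ ≤ t) (tgt : K ↪ Fin n) {k : St n ℂ → ℝ} (hk : IsEffect k) (ψ : St n ℂ) :
    prepare G tgt ψ k - prepare G' tgt ψ k ≤ (2 * t + t ^ 2) * normSq ψ := by
  have hd : ∀ o : K → Bool,
      (fun w => G (fun i => w (tgt i)) • ψ (Function.extend tgt o w)) -
        (fun w => G' (fun i => w (tgt i)) • ψ (Function.extend tgt o w)) =
      fun w => (G - G') (fun i => w (tgt i)) • ψ (Function.extend tgt o w) := by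
    intro o; funext w; simp [sub_mul]
  rw [prepare, prepare, ← Finset.sum_sub_distrib]
  refine (Finset.sum_le_sum fun o _ => hk.sub_le ht _ _).trans ?_
  rw [Finset.sum_add_distrib, ← Finset.mul_sum, ← Finset.mul_sum]
  simp only [hd]
  rw [sum_normSq_prepare, sum_normSq_prepare, hG']
  have h1 : ‖G - G'‖ ^ 2 ≤ t ^ 2 := by gcongr
  have h2 : (1 + t⁻¹) * (‖G - G'‖ ^ 2 * normSq ψ) ≤ (1 + t⁻¹) * (t ^ 2 * normSq ψ) := by
    have := normSq_nonneg ψ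
    gcongr
  have h3 : (1 + t⁻¹) * (t ^ 2 * normSq ψ) = (t ^ 2 + t) * normSq ψ := by field_simp
  nlinarith

theorem prepare_dist {K : Type} [Fintype K] [DecidableEq K] {n : ℕ}
    (G G' : EuclideanSpace ℂ (K → Bool)) (hG : ‖G‖ = 1) (hG' : ‖G'‖ = 1) {t : ℝ} (ht : 0 < t)
    (hGG : ‖G - G'‖ ≤ t) (tgt : K ↪ Fin n) {k : St n ℂ → ℝ} (hk : IsEffect k) (ψ : St n ℂ) :
    |prepare G tgt ψ k - prepare G' tgt ψ k| ≤ (2 * t + t ^ 2) * normSq ψ := by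
  rw [abs_le]
  constructor
  · have := prepare_sub_le G' G hG ht (by rwa [norm_sub_rev]) tgt hk ψ
    linarith
  · exact prepare_sub_le G G' hG' ht hGG tgt hk ψ

/-- Only the summand at `x` changes, from one basis vector to another, and its amplitude is
`2^(-l/2)`. -/
theorem norm_graphState_update_sub {l : ℕ} (g : Bits l → Bits l) (x y : Bits l) :
    ‖graphState (Function.update g x y) - graphState g‖ ≤ 2 * (Real.sqrt (2 ^ l))⁻¹ := by
  have h : graphState (Function.update g x y) - graphState g =
      ((Real.sqrt (2 ^ l) : ℝ) : ℂ)⁻¹ • (EuclideanSpace.single (Sum.elim x y) (1 : ℂ) -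
        EuclideanSpace.single (Sum.elim x (g x)) (1 : ℂ)) := by
    rw [graphState, graphState, ← smul_sub, ← Finset.sum_sub_distrib,
      Finset.sum_eq_single x]
    · simp
    · intro x' _ hx'
      simp [hx']
    · simp
  rw [h, norm_smul, norm_inv, Complex.norm_real, Real.norm_of_nonneg (Real.sqrt_nonneg _), mul_comm]
  gcongr
  refine (norm_sub_le _ _).trans ?_
  simp
  norm_num

/-- Bound for the effect of one public key. -/
def keyError (l : ℕ) : ℝ :=
  2 * (2 * (Real.sqrt (2 ^ l))⁻¹) + (2 * (Real.sqrt (2 ^ l))⁻¹) ^ 2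

theorem keyError_nonneg (l : ℕ) : 0 ≤ keyError l := by unfold keyError; positivity

/-- A hybrid argument over the operations. Switching one operation from `Function.update g x y` to
`g` matters only for a public-key query and costs at most `keyError`; differences among the later
operations are not amplified by a channel. Decryption uses the same `h` on both sides and
contributes no error. -/
theorem measuredRun_dist (S : SKE) {l n : ℕ} (x y : Bits l) (g h : Bits l → Bits l)
    (forb : Option (List Bool)) (ops : List (Op n (EOQuery (Fin l ⊕ Fin l) n)))
    {k k' : St n ℂ → ℝ} (hk : IsEffect k) {e : ℝ} (he : 0 ≤ e)
    (hkk : ∀ φ, |k φ - k' φ| ≤ e * normSq φ) (ψ : St n ℂ) :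
    |Op.run (measuredAns S x y (Function.update g x y) h forb) ops ψ k -
      Op.run (measuredAns S x y g h forb) ops ψ k'| ≤
      (e + ops.length * keyError l) * normSq ψ := by
  induction ops generalizing ψ with
  | nil => simpa [Op.run] using hkk ψ
  | cons o ops ih =>
    have hK : IsEffect fun φ =>
        Op.run (measuredAns S x y (Function.update g x y) h forb) ops φ k :=
      (isChannel_run (isChannel_measuredAns S x y _ h forb) ops).effect hk
    have h1 := (isChannel_step (isChannel_measuredAns S x y g h forb) o).dist
      (show 0 ≤ e + ops.length * keyError l by have := keyError_nonneg l; positivity) ih ψ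
    have h2 : |Op.step (measuredAns S x y (Function.update g x y) h forb) o ψ
          (fun φ => Op.run (measuredAns S x y (Function.update g x y) h forb) ops φ k) -
        Op.step (measuredAns S x y g h forb) o ψ
          (fun φ => Op.run (measuredAns S x y (Function.update g x y) h forb) ops φ k)| ≤
        keyError l * normSq ψ := by
      have h0 : 0 ≤ keyError l * normSq ψ := mul_nonneg (keyError_nonneg l) (normSq_nonneg ψ)
      cases o with
      | query q =>
        cases q with
        | qpk tgt =>
          exact prepare_dist _ _ (norm_graphState _) (norm_graphState _) (by positivity)
            (norm_graphState_update_sub g x y) tgt hK ψ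
        | enc inp out => simpa [Op.step, measuredAns] using h0
        | dec inp out => simpa [Op.step, measuredAns] using h0
      | _ => simpa [Op.step] using h0
    rw [Op.run, Op.run]
    refine (abs_sub_le _ _ _).trans ((add_le_add h2 h1).trans (le_of_eq ?_))
    push_cast [List.length_cons]
    ring

theorem normSq_initSt {n : ℕ} : normSq (initSt 1 : St n ℂ) = 1 := by
  rw [normSq, Finset.sum_eq_single (fun _ => false)]
  · simp [initSt]
  · intro w _ hw; simp [initSt, hw]
  · simp

theorem normSq_xorInto {n : ℕ} (out : List (Fin n)) (s : List Bool) (ψ : St n ℂ) :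
    normSq (xorInto out s ψ) = normSq ψ :=
  Equiv.sum_comp (xorInto_involutive (xorMask out s)).toPerm fun w => ‖ψ w‖ ^ 2

/-- Reprogramming the function of the public keys at one point changes little. -/
theorem measuredGuess_dist (S : SKE) {l : ℕ} (A : TwoStageAdversary (EOQuery (Fin l ⊕ Fin l)))
    (x y : Bits l) (g h : Bits l → Bits l) (b : Bool) :
    |measuredGuess S A x y (Function.update g x y) h b - measuredGuess S A x y g h b| ≤
      (A.stage₁.length + A.stage₂.length : ℕ) * keyError l := by
  have he : 0 ≤ 0 + A.stage₂.length * keyError l := by have := keyError_nonneg l; positivity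
  have hrun : ∀ (forb : Option (List Bool)) (s : List Bool) (φ : St A.n ℂ),
      |Op.run (measuredAns S x y (Function.update g x y) h forb) A.stage₂
          (xorInto A.chal s φ) (outProb A.out b) -
        Op.run (measuredAns S x y g h forb) A.stage₂ (xorInto A.chal s φ) (outProb A.out b)| ≤
      (0 + A.stage₂.length * keyError l) * normSq φ := by
    intro forb s φ
    rw [← normSq_xorInto A.chal s φ]
    exact measuredRun_dist S x y g h forb A.stage₂ (isEffect_outProb _ _) le_rfl (by simp) _
  have hch : ∀ φ, |measuredChallenge S A x y (Function.update g x y) h b φ -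
      measuredChallenge S A x y g h b φ| ≤ (0 + A.stage₂.length * keyError l) * normSq φ := by
    refine (isInstrument_measure A.msg₀).dist _ _ _ he fun v₀ =>
      (isInstrument_measure A.msg₁).dist _ _ _ he fun v₁ => ?_
    by_cases hlen : (decodeStr v₀).length = (decodeStr v₁).length
    · simp only [hlen, if_true]
      exact (isInstrument_encAvg S y _).dist _ _ _ he fun c => hrun _ _
    · simp only [hlen, if_false]
      exact hrun _ _
  have := measuredRun_dist S x y g h none A.stage₁
    (isEffect_measuredChallenge S A x y (Function.update g x y) h b) he hch (initSt 1)
  rw [normSq_initSt] at this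
  refine this.trans (le_of_eq ?_)
  push_cast
  ring

/-! ### Measuring the key register at the beginning -/

/-- The component of a joint state at the basis vector `z` of the key register. -/
def component {n : ℕ} {ι : Type} [Fintype ι] (z : ι) (ψ : St n (EuclideanSpace ℂ ι)) : St n ℂ :=
  fun w => ψ w z

/-- `k` is the sum of the `kz z`, each applied to the component at `z`. -/
def Splits {n : ℕ} {ι : Type} [Fintype ι] (k : St n (EuclideanSpace ℂ ι) → ℝ)
    (kz : ι → St n ℂ → ℝ) : Prop :=
  ∀ ψ, k ψ = ∑ z, kz z (component z ψ)

theorem splits_outProb {n : ℕ} {ι : Type} [Fintype ι] (out : Fin n) (b : Bool) :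
    Splits (ι := ι) (outProb out b) fun _ => outProb out b := by
  intro ψ
  simp only [outProb]
  rw [Finset.sum_comm]
  refine Finset.sum_congr rfl fun w _ => ?_
  by_cases h : w out = b
  · simp [h, EuclideanSpace.norm_sq_eq, component]
  · simp [h]

theorem splits_measure {n : ℕ} {ι : Type} [Fintype ι] (reg : List (Fin n))
    {k : List Bool → St n (EuclideanSpace ℂ ι) → ℝ} {kz : ι → List Bool → St n ℂ → ℝ}
    (h : ∀ s, Splits (k s) fun z => kz z s) :
    Splits (fun ψ => measure reg ψ k) fun z ψ => measure reg ψ (kz z) := by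
  intro ψ
  simp only [measure]
  rw [Finset.sum_comm]
  refine Finset.sum_congr rfl fun s _ => ?_
  rw [h s]
  refine Finset.sum_congr rfl fun z _ => congrArg _ ?_
  funext w
  simp only [component]
  split_ifs <;> simp

theorem splits_xorInto {n : ℕ} {ι : Type} [Fintype ι] (out : List (Fin n)) (s : List Bool)
    {k : St n (EuclideanSpace ℂ ι) → ℝ} {kz : ι → St n ℂ → ℝ} (h : Splits k kz) :
    Splits (fun ψ => k (xorInto out s ψ)) fun z ψ => kz z (xorInto out s ψ) := by
  exact fun ψ => h _

/-- The squared amplitude of the Kraus operator for one coin string is the probability of that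
string. -/
theorem avg_bits {c : ℕ} (h : Bits c → ℝ) :
    avg h = ∑ r, ‖((Real.sqrt (2 ^ c) : ℝ) : ℂ)⁻¹‖ ^ 2 * h r := by
  have h2 : ‖((Real.sqrt (2 ^ c) : ℝ) : ℂ)⁻¹‖ ^ 2 = ((2 : ℝ) ^ c)⁻¹ := by
    rw [norm_inv, Complex.norm_real, Real.norm_of_nonneg (Real.sqrt_nonneg _), inv_pow,
      Real.sq_sqrt (by positivity)]
  rw [h2, ← Finset.mul_sum, avg]
  simp [div_eq_inv_mul]

/-- The two halves of a basis vector of the key register. -/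
def fstHalf {l : ℕ} (z : Fin l ⊕ Fin l → Bool) : Bits l := fun i => z (Sum.inl i)

def sndHalf {l : ℕ} (z : Fin l ⊕ Fin l → Bool) : Bits l := fun i => z (Sum.inr i)

/-- Encryption with the key register, for the construction. -/
def registerEnc (S : SKE) {l n : ℕ} (m : List Bool)
    (ψ : St n (EuclideanSpace ℂ (Fin l ⊕ Fin l → Bool)))
    (k : List Bool → St n (EuclideanSpace ℂ (Fin l ⊕ Fin l → Bool)) → ℝ) : ℝ :=
  ∑ β : (Fin l ⊕ Fin l → Bool) × Bits (S.coins l m.length),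
    k (List.ofFn (fstHalf β.1) ++ S.enc l (sndHalf β.1) m (List.ofFn β.2)) fun w =>
      basisKraus (((Real.sqrt (2 ^ S.coins l m.length) : ℝ) : ℂ)⁻¹) β.1 (ψ w)

/-- The oracles of the game with the key register, for the construction with `g` as `f_dk`. -/
def registerAns (S : SKE) {l n : ℕ} (g : Bits l → Bits l) (forbidden : Option (List Bool)) :
    EOQuery (Fin l ⊕ Fin l) n → St n (EuclideanSpace ℂ (Fin l ⊕ Fin l → Bool)) →
      (St n (EuclideanSpace ℂ (Fin l ⊕ Fin l → Bool)) → ℝ) → ℝ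
  | .qpk tgt, ψ, k => ∑ o : Fin l ⊕ Fin l → Bool,
      k fun w => graphState g (fun i => w (tgt i)) • ψ (Function.extend tgt o w)
  | .enc inp out, ψ, k => measure inp ψ fun v φ =>
      registerEnc S (decodeStr v) φ fun c χ => k (xorInto out (encodeAns (some c)) χ)
  | .dec inp out, ψ, k => measure inp ψ fun v φ =>
      k (xorInto out (encodeAns (decExcept forbidden none (keyDec S g) (decodeStr v))) φ)

/-- Decryption in the construction is deterministic, so the series over answers has one nonzero
term. -/
theorem ans_construction (f : KeyedFamily) (S : SKE) {l n : ℕ} (dk : Bits l)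
    (forb : Option (List Bool)) :
    ((construction f S).ans (l := l) (n := n) dk forb) = registerAns S (f l dk) forb := by
  funext q ψ k
  cases q with
  | qpk tgt => rfl
  | enc inp out => rfl
  | dec inp out =>
    simp only [Scheme.ans, registerAns]
    refine congrArg (measure inp ψ) (funext fun s => funext fun φ => ?_)
    have hd : decExcept forb (PMF.pure none) ((construction f S).dec l dk) (decodeStr s) =
        PMF.pure (decExcept forb none (keyDec S (f l dk)) (decodeStr s)) := by
      unfold decExcept
      split_ifs <;> rfl
    rw [hd, tsum_eq_single (decExcept forb none (keyDec S (f l dk)) (decodeStr s))]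
    · rw [PMF.pure_apply, if_pos rfl, ENNReal.toReal_one, one_mul]
      rfl
    · intro a ha
      rw [PMF.pure_apply, if_neg ha, ENNReal.toReal_zero, zero_mul]

/-- The branch with outcome `z` annihilates every other component and rescales the component at `z`.
Quadratic homogeneity turns the scale into the weight of the coins, so encryption acts on each
component separately, with the classical key `z`. -/
theorem splits_registerEnc (S : SKE) {l n : ℕ} (m : List Bool)
    {k : List Bool → St n (EuclideanSpace ℂ (Fin l ⊕ Fin l → Bool)) → ℝ}
    {kz : (Fin l ⊕ Fin l → Bool) → List Bool → St n ℂ → ℝ}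
    (hkz : ∀ z c, QuadHom (kz z c))
    (h : ∀ c, Splits (k c) fun z => kz z c) :
    Splits (fun ψ => registerEnc S m ψ k) fun z ψ =>
      S.encAvg (sndHalf z) m fun c => kz z (List.ofFn (fstHalf z) ++ c) ψ := by
  intro ψ
  simp only [registerEnc]
  rw [Fintype.sum_prod_type]
  refine Finset.sum_congr rfl fun z _ => ?_
  simp only [SKE.encAvg]
  rw [avg_bits]
  refine Finset.sum_congr rfl fun r _ => ?_
  rw [h, Finset.sum_eq_single z]
  · rw [← hkz]
    refine congrArg _ ?_
    funext w
    simp [component, basisKraus]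
  · intro z' _ hz'
    have : component z' (fun w => basisKraus
        (((Real.sqrt (2 ^ S.coins l m.length) : ℝ) : ℂ)⁻¹) z (ψ w)) = 0 := by
      funext w
      simp [component, basisKraus, hz']
    simp only [this, (hkz _ _).zero]
  · simp

/-- No operation couples different basis vectors of the key register: gates and the other oracles
leave the register alone, and encryption is diagonal in it. This is why a measurement of the
register commutes with the whole game. -/
theorem splits_step (S : SKE) {l n : ℕ} (g : Bits l → Bits l)
    (forb : Option (List Bool)) (o : Op n (EOQuery (Fin l ⊕ Fin l) n))
    {k : St n (EuclideanSpace ℂ (Fin l ⊕ Fin l → Bool)) → ℝ}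
    {kz : (Fin l ⊕ Fin l → Bool) → St n ℂ → ℝ} (hkz : ∀ z, QuadHom (kz z)) (h : Splits k kz) :
    Splits (fun ψ => Op.step (registerAns S g forb) o ψ k) fun z ψ =>
      Op.step (measuredAns S (fstHalf z) (sndHalf z) g g forb) o ψ (kz z) := by
  intro ψ
  cases o with
  | h i =>
    simp only [Op.step]
    rw [h]
    refine Finset.sum_congr rfl fun z _ => congrArg _ ?_
    funext w
    simp only [component]
    split_ifs <;> simp <;> ring
  | t i =>
    simp only [Op.step]
    rw [h]
    refine Finset.sum_congr rfl fun z _ => congrArg _ ?_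
    funext w
    simp only [component]
    split_ifs <;> simp
  | x i => exact h _
  | cnot i j hij => exact h _
  | ccx i j m hij him hjm => exact h _
  | meas i => exact splits_measure [i] (fun _ => h) ψ
  | reset i =>
    simp only [Op.step]
    rw [Finset.sum_comm]
    refine Finset.sum_congr rfl fun b _ => ?_
    rw [h]
    refine Finset.sum_congr rfl fun z _ => congrArg _ ?_
    funext w
    simp only [component]
    split_ifs <;> simp
  | query q =>
    cases q with
    | qpk tgt =>
      simp only [Op.step, measuredAns, prepare]
      rw [Finset.sum_comm]
      refine Finset.sum_congr rfl fun o _ => ?_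
      rw [h]
      refine Finset.sum_congr rfl fun z _ => congrArg _ ?_
      funext w
      simp only [component]
      rfl
    | enc inp out =>
      exact splits_measure inp (fun s => splits_registerEnc S (decodeStr s)
        (kz := fun z c φ => kz z (xorInto out (encodeAns (some c)) φ))
        (fun z c => (isChannel_xorInto out _).hom (hkz z))
        fun c => splits_xorInto out (encodeAns (some c)) h) ψ
    | dec inp out =>
      exact splits_measure inp (fun s => splits_xorInto out _ h) ψ

theorem splits_run (S : SKE) {l n : ℕ} (g : Bits l → Bits l)
    (forb : Option (List Bool)) (ops : List (Op n (EOQuery (Fin l ⊕ Fin l) n)))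
    {k : St n (EuclideanSpace ℂ (Fin l ⊕ Fin l → Bool)) → ℝ}
    {kz : (Fin l ⊕ Fin l → Bool) → St n ℂ → ℝ} (hkz : ∀ z, QuadHom (kz z)) (h : Splits k kz) :
    Splits (fun ψ => Op.run (registerAns S g forb) ops ψ k) fun z ψ =>
      Op.run (measuredAns S (fstHalf z) (sndHalf z) g g forb) ops ψ (kz z) := by
  induction ops with
  | nil => exact h
  | cons o ops ih =>
    exact splits_step S g forb o
      (fun z => (isChannel_run (isChannel_measuredAns S _ _ _ _ forb) ops).hom (hkz z)) ih

theorem graphState_apply {l : ℕ} (g : Bits l → Bits l) (z : Fin l ⊕ Fin l → Bool) :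
    graphState g z = if g (fstHalf z) = sndHalf z then ((Real.sqrt (2 ^ l) : ℝ) : ℂ)⁻¹ else 0 := by
  have hz : ∀ x : Bits l, z = Sum.elim x (g x) ↔ x = fstHalf z ∧ g (fstHalf z) = sndHalf z := by
    intro x
    constructor
    · rintro rfl
      exact ⟨rfl, rfl⟩
    · rintro ⟨rfl, h⟩
      rw [h]
      funext i
      cases i <;> rfl
  simp only [graphState, PiLp.smul_apply, WithLp.ofLp_sum, Finset.sum_apply, smul_eq_mul,
    PiLp.single_apply, hz]
  by_cases h : g (fstHalf z) = sndHalf z <;> simp [h]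

theorem sum_key {l : ℕ} (F : (Fin l ⊕ Fin l → Bool) → ℝ) :
    ∑ z, F z = ∑ x : Bits l, ∑ y : Bits l, F (Sum.elim x y) := by
  rw [← Fintype.sum_prod_type']
  exact (Equiv.sum_comp (Equiv.sumArrowEquivProdArrow (Fin l) (Fin l) Bool).symm F).symm

/-- By `splits_run` the game is a sum over the contents `z` of the key register. The initial state
contributes the weight of `z` in the public key, which is `2^(-l)` on the graph of `f_dk` and zero
elsewhere. -/
theorem guessProb_construction (f : KeyedFamily) (S : SKE) {l : ℕ}
    (A : TwoStageAdversary (EOQuery (Fin l ⊕ Fin l))) (dk : Bits l) (b : Bool) :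
    (construction f S).guessProb (l := l) A dk b =
      avg fun x : Bits l => measuredGuess S A x (f l dk x) (f l dk) (f l dk) b := by
  have hch := splits_run S (f l dk) none A.stage₁ (n := A.n)
    (kz := fun z => measuredChallenge S A (fstHalf z) (sndHalf z) (f l dk) (f l dk) b)
    (fun z => (isEffect_measuredChallenge S A _ _ _ _ b).hom)
    (splits_measure A.msg₀ fun v₀ => splits_measure A.msg₁ (k := fun v₁ ψ₁ =>
      if (decodeStr v₀).length = (decodeStr v₁).length then
        registerEnc S (decodeStr (if b then v₁ else v₀)) ψ₁ fun c φ =>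
          Op.run (registerAns S (f l dk) (some c)) A.stage₂
            (xorInto A.chal (encodeAns (some c)) φ) (outProb A.out b)
      else
        Op.run (registerAns S (f l dk) none) A.stage₂
          (xorInto A.chal (encodeAns none) ψ₁) (outProb A.out b)) fun v₁ => by
      by_cases hlen : (decodeStr v₀).length = (decodeStr v₁).length
      · simp only [hlen, if_true]
        exact splits_registerEnc S _ (kz := fun z c φ =>
          Op.run (measuredAns S (fstHalf z) (sndHalf z) (f l dk) (f l dk) (some c)) A.stage₂
            (xorInto A.chal (encodeAns (some c)) φ) (outProb A.out b))
          (fun z c => (isEffect_measuredRun S _ _ _ _ _ _ _ _ (isEffect_outProb _ _)).hom)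
          fun c => splits_xorInto _ _ (splits_run S (f l dk) (some c) A.stage₂
            (fun _ => (isEffect_outProb _ _).hom) (splits_outProb _ _))
      · simp only [hlen, if_false]
        exact splits_xorInto _ _ (splits_run S (f l dk) none A.stage₂
            (fun _ => (isEffect_outProb _ _).hom) (splits_outProb _ _)))
    (initSt (graphState (f l dk)))
  unfold Scheme.guessProb
  simp only [ans_construction]
  refine Eq.trans hch ?_
  have hinit : ∀ z : Fin l ⊕ Fin l → Bool,
      component z (initSt (n := A.n) (graphState (f l dk))) =
        graphState (f l dk) z • (initSt 1 : St A.n ℂ) := by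
    intro z; funext w
    simp only [component, initSt, Pi.smul_apply, smul_eq_mul]
    split_ifs <;> simp
  have hz : ∀ z : Fin l ⊕ Fin l → Bool,
      Op.run (measuredAns S (fstHalf z) (sndHalf z) (f l dk) (f l dk) none) A.stage₁
        (component z (initSt (n := A.n) (graphState (f l dk))))
        (measuredChallenge S A (fstHalf z) (sndHalf z) (f l dk) (f l dk) b) =
      ‖graphState (f l dk) z‖ ^ 2 *
        measuredGuess S A (fstHalf z) (sndHalf z) (f l dk) (f l dk) b := by
    intro z
    rw [hinit]
    exact (isChannel_run (isChannel_measuredAns S _ _ _ _ _) A.stage₁).hom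
      (isEffect_measuredChallenge S A _ _ _ _ b).hom _ _
  simp only [hz, graphState_apply]
  rw [sum_key, avg_bits]
  refine Finset.sum_congr rfl fun x _ => ?_
  -- Off the graph the amplitude of the public key vanishes.
  rw [Finset.sum_eq_single (f l dk x)]
  · have h1 : fstHalf (Sum.elim x (f l dk x)) = x := rfl
    have h2 : sndHalf (Sum.elim x (f l dk x)) = f l dk x := rfl
    rw [h1, h2, if_pos rfl]
  · intro y _ hy
    have h1 : fstHalf (Sum.elim x y) = x := rfl
    have h2 : sndHalf (Sum.elim x y) = y := rfl
    rw [h1, h2, if_neg (Ne.symm hy)]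
    simp
  · simp

/-! ### Permutations of the computational basis -/

section Perm

variable {n : ℕ} {Q : Type}

/-- The operations `X`, `CNOT` and Toffoli. -/
def Op.IsPerm : Op n Q → Prop
  | .x _ => True
  | .cnot _ _ _ => True
  | .ccx _ _ _ _ _ _ => True
  | _ => False

/-- The action of an operation on basis vectors. -/
def Op.perm : Op n Q → Bits n → Bits n
  | .x i, w => Function.update w i (!(w i))
  | .cnot i j _, w => Function.update w j (xor (w j) (w i))
  | .ccx i j m _ _ _, w => Function.update w m (xor (w m) (w i && w j))
  | _, w => w

theorem Op.perm_involutive (o : Op n Q) : Function.Involutive o.perm := by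
  cases o with
  | x i => exact flip_involutive i
  | cnot i j h => exact cnot_involutive i j h
  | ccx i j m hij him hjm => exact ccx_involutive i j m him hjm
  | _ => exact fun _ => rfl

/-- States are transformed by precomposition, so the first operation of the list is the outermost
map on basis vectors. -/
def permAll : List (Op n Q) → Bits n → Bits n
  | [], w => w
  | o :: L, w => o.perm (permAll L w)

theorem permAll_append (L₁ L₂ : List (Op n Q)) (w : Bits n) :
    permAll (L₁ ++ L₂) w = permAll L₁ (permAll L₂ w) := by
  induction L₁ with
  | nil => rfl
  | cons o L ih => simp only [List.cons_append, permAll, ih]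

theorem permAll_reverse_apply (L : List (Op n Q)) (w : Bits n) :
    permAll L.reverse (permAll L w) = w := by
  induction L with
  | nil => rfl
  | cons o L ih =>
    rw [List.reverse_cons, permAll_append]
    simp only [permAll]
    rw [o.perm_involutive, ih]

/-- The action of a list of basis permutations on states. -/
def act (L : List (Op n Q)) (ψ : St n ℂ) : St n ℂ := fun w => ψ (permAll L w)

theorem act_append (L₁ L₂ : List (Op n Q)) (ψ : St n ℂ) :
    act (L₁ ++ L₂) ψ = act L₂ (act L₁ ψ) := by
  funext w
  simp only [act, permAll_append]

/-- Every basis permutation among the gates is its own inverse, so running the list backwards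
uncomputes it. -/
theorem act_reverse (L : List (Op n Q)) (ψ : St n ℂ) : act L.reverse (act L ψ) = ψ := by
  funext w
  have := permAll_reverse_apply L.reverse w
  rw [List.reverse_reverse] at this
  simp only [act, this]

theorem run_perm (ans : Q → St n ℂ → (St n ℂ → ℝ) → ℝ) (L : List (Op n Q))
    (hL : ∀ o ∈ L, o.IsPerm) (ψ : St n ℂ) (k : St n ℂ → ℝ) :
    Op.run ans L ψ k = k (act L ψ) := by
  induction L generalizing ψ with
  | nil => rfl
  | cons o L ih =>
    rw [Op.run]
    have ho := hL o (by simp)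
    have hL' := fun o' h => hL o' (List.mem_cons_of_mem o h)
    cases o with
    | x i => exact ih hL' _
    | cnot i j h => exact ih hL' _
    | ccx i j m h1 h2 h3 => exact ih hL' _
    | _ => exact ho.elim

end Perm

/-! ### A classical memory next to the adversary's wires -/

/-- The content of `m` memory wires: the string `mem`, followed by zeros. -/
def pad (m : ℕ) (mem : List Bool) : Bits m := fun i => mem.getD i false

/-- `ψ ⊗ |a⟩`. -/
def embBits {n m : ℕ} (a : Bits m) (ψ : St n ℂ) : St (n + m) ℂ := fun w =>
  if (fun i => w (Fin.natAdd n i)) = a then ψ (fun i => w (Fin.castAdd m i)) else 0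

/-- `ψ ⊗ |mem⟩`, for a classical memory of `m` wires. -/
def emb {n : ℕ} (m : ℕ) (mem : List Bool) (ψ : St n ℂ) : St (n + m) ℂ := embBits (pad m mem) ψ

section Memory

variable {n m : ℕ} {Q : Type}

theorem forall_bits_append {P : Bits (n + m) → Prop} :
    (∀ w, P w) ↔ ∀ (u : Bits n) (a : Bits m), P (Fin.append u a) := by
  refine ⟨fun h u a => h _, fun h w => ?_⟩
  have := h (fun i => w (Fin.castAdd m i)) (fun i => w (Fin.natAdd n i))
  rwa [Fin.append_castAdd_natAdd] at this

theorem st_ext {φ χ : St (n + m) ℂ}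
    (h : ∀ (u : Bits n) (a : Bits m), φ (Fin.append u a) = χ (Fin.append u a)) : φ = χ :=
  funext (forall_bits_append.2 h)

theorem embBits_append (a a' : Bits m) (ψ : St n ℂ) (u : Bits n) :
    embBits a ψ (Fin.append u a') = if a' = a then ψ u else 0 := by
  simp [embBits]

theorem update_append_left (u : Bits n) (a : Bits m) (i : Fin n) (b : Bool) :
    Function.update (Fin.append u a) (Fin.castAdd m i) b =
      Fin.append (Function.update u i b) a := by
  funext j
  refine Fin.addCases (fun j => ?_) (fun j => ?_) j
  · by_cases h : j = i
    · subst h; simp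
    · have : Fin.castAdd m j ≠ Fin.castAdd m i := fun h' => h (Fin.castAdd_injective n m h')
      simp [h, this]
  · have : Fin.natAdd n j ≠ Fin.castAdd m i := fun h' => by
      have := congrArg Fin.val h'; simp at this; omega
    simp [this]

theorem update_append_right (u : Bits n) (a : Bits m) (i : Fin m) (b : Bool) :
    Function.update (Fin.append u a) (Fin.natAdd n i) b =
      Fin.append u (Function.update a i b) := by
  funext j
  refine Fin.addCases (fun j => ?_) (fun j => ?_) j
  · have : Fin.castAdd m j ≠ Fin.natAdd n i := fun h' => by
      have := congrArg Fin.val h'; simp at this; omega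
    simp [this]
  · by_cases h : j = i
    · subst h; simp
    · have : Fin.natAdd n j ≠ Fin.natAdd n i := fun h' => h (Fin.natAdd_injective m n h')
      simp [h, this]

theorem embBits_zero (a : Bits m) : embBits a (0 : St n ℂ) = 0 := by
  funext w; simp [embBits]

theorem emb_zero (mem : List Bool) : emb m mem (0 : St n ℂ) = 0 := embBits_zero _

theorem pad_append_singleton (mem : List Bool) (b : Bool) (h : mem.length < m) :
    pad m (mem ++ [b]) = Function.update (pad m mem) ⟨mem.length, h⟩ b := by
  funext i
  by_cases hi : i = ⟨mem.length, h⟩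
  · subst hi; simp [pad]
  · have hi' : (i : ℕ) ≠ mem.length := fun h' => hi (Fin.ext h')
    rw [Function.update_of_ne hi]
    simp only [pad]
    rcases lt_or_gt_of_ne hi' with h1 | h1
    · rw [List.getD_append _ _ _ _ h1]
    · rw [List.getD_eq_default _ _ (by simp; omega), List.getD_eq_default _ _ (by omega)]

theorem pad_append_replicate (mem : List Bool) (r : ℕ) :
    pad m (mem ++ List.replicate r false) = pad m mem := by
  funext i
  simp only [pad]
  rcases lt_or_ge (i : ℕ) mem.length with h | h
  · rw [List.getD_append _ _ _ _ h]
  · rw [List.getD_append_right _ _ _ _ h, List.getD_eq_default mem _ h]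
    by_cases h2 : (i : ℕ) - mem.length < r
    · rw [List.getD_replicate _ h2]
    · rw [List.getD_eq_default _ _ (by simpa using h2)]

/-- Memory wires beyond the string hold zeros, so fields can count as allocated, with value zero,
before anything is written there. -/
theorem emb_append_replicate (mem : List Bool) (r : ℕ) (ψ : St n ℂ) :
    emb m (mem ++ List.replicate r false) ψ = emb m mem ψ := by
  rw [emb, pad_append_replicate, emb]

theorem pad_apply_length (mem : List Bool) (h : mem.length < m) :
    pad m mem ⟨mem.length, h⟩ = false := by
  simp [pad]

theorem emb_initSt : emb m [] (initSt 1 : St n ℂ) = initSt 1 := by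
  refine st_ext fun u a => ?_
  rw [emb, embBits_append]
  have h : Fin.append u a = (fun _ => false) ↔ a = (fun _ => false) ∧ u = fun _ => false := by
    constructor
    · intro h
      constructor
      · funext i; simpa using congrFun h (Fin.natAdd n i)
      · funext i; simpa using congrFun h (Fin.castAdd m i)
    · rintro ⟨rfl, rfl⟩
      funext i
      refine Fin.addCases (fun j => ?_) (fun j => ?_) i <;> simp
  have hp : pad m [] = fun _ => false := by funext i; simp [pad]
  simp only [initSt, h, hp, ite_and]

theorem outProb_emb (out : Fin n) (b : Bool) (mem : List Bool) (ψ : St n ℂ) :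
    outProb (Fin.castAdd m out) b (emb m mem ψ) = outProb out b ψ := by
  simp only [outProb]
  rw [← (Fin.appendEquiv n m).sum_comp, Fintype.sum_prod_type]
  refine Finset.sum_congr rfl fun u _ => ?_
  rw [Finset.sum_eq_single (pad m mem)]
  · simp [emb, embBits_append, Fin.appendEquiv]
  · intro a _ ha
    simp [emb, embBits_append, Fin.appendEquiv, ha]
  · simp

/-! #### Measurements -/

theorem sum_bits_succ {r : ℕ} (F : Bits (r + 1) → ℝ) :
    ∑ s, F s = ∑ b : Bool, ∑ s : Bits r, F (Fin.cons b s) := by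
  rw [← Fintype.sum_prod_type']
  exact ((Fin.consEquiv (fun _ : Fin (r + 1) => Bool)).sum_comp F).symm

theorem measure_eq_sum (reg : List (Fin n)) (ψ : St n ℂ) {k : List Bool → St n ℂ → ℝ}
    (hk : ∀ s, k s 0 = 0) :
    measure reg ψ k = ∑ s : Bits reg.length,
      k (List.ofFn s) (fun w => if reg.map w = List.ofFn s then ψ w else 0) := by
  rw [measure, ← Finset.sum_image (s := Finset.univ) (g := fun s : Bits reg.length => List.ofFn s)
    (f := fun s => k s (fun w => if reg.map w = s then ψ w else 0))
    (fun a _ b _ h => List.ofFn_injective h)]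
  refine Finset.sum_subset (fun s hs => ?_) fun s _ hs => ?_
  · obtain ⟨w, -, rfl⟩ := Finset.mem_image.1 hs
    refine Finset.mem_image.2 ⟨fun i => w (reg.get i), Finset.mem_univ _, ?_⟩
    apply List.ext_getElem <;> simp
  · have : (fun w => if reg.map w = s then ψ w else 0) = (0 : St n ℂ) := by
      funext w
      refine if_neg fun h => hs ?_
      exact Finset.mem_image.2 ⟨w, Finset.mem_univ _, h⟩
    rw [this, hk]

/-- In a branch the outcome has the length of the register and the state is supported on that
outcome; continuations need to agree only there. -/
theorem measure_congr (reg : List (Fin n)) (ψ : St n ℂ) {k k' : List Bool → St n ℂ → ℝ}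
    (h : ∀ s φ, s.length = reg.length → (∀ w, reg.map w ≠ s → φ w = 0) → k s φ = k' s φ) :
    measure reg ψ k = measure reg ψ k' := by
  refine Finset.sum_congr rfl fun s hs => h s _ ?_ fun w hw => if_neg hw
  obtain ⟨w, -, rfl⟩ := Finset.mem_image.1 hs
  simp

theorem measure_cons (i : Fin n) (reg : List (Fin n)) (ψ : St n ℂ) {k : St n ℂ → ℝ}
    (hk : k 0 = 0) :
    measure (i :: reg) ψ (fun _ φ => k φ) =
      measure [i] ψ fun _ φ => measure reg φ fun _ χ => k χ := by
  have h0 : ∀ s : List Bool, (fun (_ : List Bool) φ => measure reg φ fun _ χ => k χ) s 0 = 0 := by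
    intro s
    simp only [measure]
    refine Finset.sum_eq_zero fun s _ => ?_
    rw [← hk]; congr 1; funext w; simp
  rw [measure_eq_sum _ _ (fun _ => hk), measure_eq_sum _ _ h0]
  simp only [List.length_cons, List.length_nil, sum_bits_succ]
  refine Finset.sum_congr rfl fun b _ => ?_
  rw [Fintype.sum_subsingleton _ (fun i : Fin 0 => (i.elim0 : Bool)),
    measure_eq_sum _ _ (fun _ => hk)]
  refine Finset.sum_congr rfl fun s _ => congrArg k ?_
  funext w
  simp only [List.map_cons, List.map_nil, List.ofFn_cons, List.cons.injEq, List.ofFn_zero, and_true]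
  by_cases h1 : w i = b <;> by_cases h2 : reg.map w = List.ofFn s <;> simp [h1, h2]

/-- Successive measurements of single wires produce the same projections as the joint one;
contradictory outcomes on repeated wires give the zero state, where `k` vanishes. -/
theorem run_meas (ans : Q → St n ℂ → (St n ℂ → ℝ) → ℝ) (reg : List (Fin n)) (ψ : St n ℂ)
    {k : St n ℂ → ℝ} (hk : k 0 = 0) :
    Op.run ans (reg.map Op.meas) ψ k = measure reg ψ fun _ φ => k φ := by
  induction reg generalizing ψ with
  | nil =>
    rw [measure_eq_sum _ _ (fun _ => hk)]
    simp [Op.run]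
  | cons i reg ih =>
    rw [measure_cons i reg ψ hk]
    simp only [List.map_cons, Op.run, Op.step, ih]

theorem measure_emb (reg : List (Fin n)) (mem : List Bool) (ψ : St n ℂ)
    (k : List Bool → St (n + m) ℂ → ℝ) :
    measure (reg.map (Fin.castAdd m)) (emb m mem ψ) k =
      measure reg ψ fun s φ => k s (emb m mem φ) := by
  have hi : (Finset.univ : Finset (Bits (n + m))).image
      (fun w => (reg.map (Fin.castAdd m)).map w) =
      (Finset.univ : Finset (Bits n)).image (fun w => reg.map w) := by
    ext s
    simp only [Finset.mem_image, Finset.mem_univ, true_and, List.map_map]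
    constructor
    · rintro ⟨w, rfl⟩
      exact ⟨fun i => w (Fin.castAdd m i), rfl⟩
    · rintro ⟨w, rfl⟩
      refine ⟨Fin.append w (fun _ => false), ?_⟩
      refine List.map_congr_left fun i _ => ?_
      simp
  rw [measure, measure, hi]
  refine Finset.sum_congr rfl fun s _ => congrArg _ ?_
  refine st_ext fun u a => ?_
  have : List.map (Fin.append u a) (List.map (Fin.castAdd m) reg) = reg.map u := by
    rw [List.map_map]
    exact List.map_congr_left fun i _ => by simp
  rw [this, emb, emb, embBits_append, embBits_append]
  split_ifs <;> rfl

/-- Measuring a register with definite content has one outcome and leaves the state unchanged. -/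
theorem measure_of_support (reg : List (Fin n)) (ψ : St n ℂ) (w₀ : Bits n)
    (hψ : ∀ w, reg.map w ≠ reg.map w₀ → ψ w = 0) {k : List Bool → St n ℂ → ℝ}
    (hk : ∀ s, k s 0 = 0) : measure reg ψ k = k (reg.map w₀) ψ := by
  rw [measure, Finset.sum_eq_single (reg.map w₀)]
  · congr 1
    funext w
    by_cases h : reg.map w = reg.map w₀
    · simp [h]
    · simp [h, hψ w h]
  · intro s _ hs
    rw [← hk s]
    congr 1
    funext w
    by_cases h : reg.map w = s
    · rw [if_pos h]
      exact hψ w (by rw [h]; exact hs)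
    · simp [h]
  · intro h
    exact absurd (Finset.mem_image_of_mem _ (Finset.mem_univ w₀)) h

/-! #### Operations on the adversary's wires -/

/-- The operation on the larger set of wires; `q` translates queries. -/
def liftOp {Q' : Type} (m : ℕ) (q : Q → List (Op (n + m) Q')) : Op n Q → List (Op (n + m) Q')
  | .h i => [.h (Fin.castAdd m i)]
  | .t i => [.t (Fin.castAdd m i)]
  | .x i => [.x (Fin.castAdd m i)]
  | .cnot i j h => [.cnot (Fin.castAdd m i) (Fin.castAdd m j)
      fun h' => h (Fin.castAdd_injective n m h')]
  | .ccx i j k hij hik hjk => [.ccx (Fin.castAdd m i) (Fin.castAdd m j) (Fin.castAdd m k)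
      (fun h' => hij (Fin.castAdd_injective n m h')) (fun h' => hik (Fin.castAdd_injective n m h'))
      (fun h' => hjk (Fin.castAdd_injective n m h'))]
  | .meas i => [.meas (Fin.castAdd m i)]
  | .reset i => [.reset (Fin.castAdd m i)]
  | .query x => q x

/-- The hypothesis `hq` concerns only the operation `o` itself, so for elementary operations it is
vacuous and `q` is arbitrary. -/
theorem run_liftOp {Q' : Type} (ans : Q → St n ℂ → (St n ℂ → ℝ) → ℝ)
    (ans' : Q' → St (n + m) ℂ → (St (n + m) ℂ → ℝ) → ℝ) (q : Q → List (Op (n + m) Q'))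
    (mem : List Bool) {k : St (n + m) ℂ → ℝ} (o : Op n Q)
    (hq : ∀ x ψ, o = .query x → Op.run ans' (q x) (emb m mem ψ) k =
      ans x ψ fun φ => k (emb m mem φ)) (ψ : St n ℂ) :
    Op.run ans' (liftOp m q o) (emb m mem ψ) k = Op.step ans o ψ fun φ => k (emb m mem φ) := by
  cases o with
  | h i =>
    simp only [liftOp, Op.run, Op.step]
    refine congrArg k (st_ext fun u a => ?_)
    simp only [emb, update_append_left, embBits_append, Fin.append_left]
    split_ifs <;> simp
  | t i =>
    simp only [liftOp, Op.run, Op.step]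
    refine congrArg k (st_ext fun u a => ?_)
    simp only [emb, embBits_append, Fin.append_left]
    split_ifs <;> simp
  | x i =>
    simp only [liftOp, Op.run, Op.step]
    refine congrArg k (st_ext fun u a => ?_)
    simp only [emb, update_append_left, embBits_append, Fin.append_left]
  | cnot i j h =>
    simp only [liftOp, Op.run, Op.step]
    refine congrArg k (st_ext fun u a => ?_)
    simp only [emb, update_append_left, embBits_append, Fin.append_left]
  | ccx i j l hij hil hjl =>
    simp only [liftOp, Op.run, Op.step]
    refine congrArg k (st_ext fun u a => ?_)
    simp only [emb, update_append_left, embBits_append, Fin.append_left]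
  | meas i => exact measure_emb [i] mem ψ fun _ φ => k φ
  | reset i =>
    simp only [liftOp, Op.run, Op.step]
    refine Finset.sum_congr rfl fun b _ => congrArg k (st_ext fun u a => ?_)
    simp only [emb, update_append_left, embBits_append, Fin.append_left]
    split_ifs <;> simp
  | query x => exact hq x ψ rfl

end Memory

/-! ### Reversible computation, coin tosses and resets on the memory wires -/

section MemoryOps

variable {n m : ℕ} {Q : Type}

/-- The memory wire number `j`. -/
abbrev memWire (n : ℕ) {m : ℕ} (j : ℕ) (h : j < m) : Fin (n + m) := Fin.natAdd n ⟨j, h⟩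

theorem memWire_ne {i j : ℕ} (hi : i < m) (hj : j < m) (h : i ≠ j) :
    memWire n i hi ≠ memWire n j hj := fun h' => h <| by
  have := congrArg Fin.val h'
  simpa using this

theorem memWire_ne_castAdd {j : ℕ} (hj : j < m) (i : Fin n) :
    memWire n j hj ≠ Fin.castAdd m i := fun h' => by
  have := congrArg Fin.val h'
  simp at this
  omega

/-- States are pulled back along `τ`, and `τ a' = a` amounts to `a' = τ a` because `τ` is an
involution. -/
theorem act_memory (o : Op (n + m) Q) (τ : Bits m → Bits m) (hτ : Function.Involutive τ)
    (ho : ∀ (u : Bits n) (a : Bits m), o.perm (Fin.append u a) = Fin.append u (τ a))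
    (a : Bits m) (ψ : St n ℂ) : act [o] (embBits a ψ) = embBits (τ a) ψ := by
  refine st_ext fun u a' => ?_
  simp only [act, permAll, ho, embBits_append]
  have : τ a' = a ↔ a' = τ a := ⟨fun h => by rw [← h, hτ], fun h => by rw [h, hτ]⟩
  simp only [this]

/-- Flip a memory wire. -/
theorem act_x_mem (j : Fin m) (a : Bits m) (ψ : St n ℂ) :
    act [(Op.x (Fin.natAdd n j) : Op (n + m) Q)] (embBits a ψ) =
      embBits (Function.update a j (!(a j))) ψ :=
  act_memory _ _ (flip_involutive j) (fun u a => by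
    simp only [Op.perm, update_append_right, Fin.append_right]) a ψ

theorem act_cnot_mem (i j : Fin m) (hij : i ≠ j) (h) (a : Bits m) (ψ : St n ℂ) :
    act [(Op.cnot (Fin.natAdd n i) (Fin.natAdd n j) h : Op (n + m) Q)] (embBits a ψ) =
      embBits (Function.update a j (xor (a j) (a i))) ψ :=
  act_memory _ _ (cnot_involutive i j hij) (fun u a => by
    simp only [Op.perm, update_append_right, Fin.append_right]) a ψ

theorem act_ccx_mem (i j t : Fin m) (hit : i ≠ t) (hjt : j ≠ t) (h₁ h₂ h₃) (a : Bits m)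
    (ψ : St n ℂ) :
    act [(Op.ccx (Fin.natAdd n i) (Fin.natAdd n j) (Fin.natAdd n t) h₁ h₂ h₃ : Op (n + m) Q)]
      (embBits a ψ) = embBits (Function.update a t (xor (a t) (a i && a j))) ψ :=
  act_memory _ _ (ccx_involutive i j t hit hjt) (fun u a => by
    simp only [Op.perm, update_append_right, Fin.append_right]) a ψ

/-! #### Constants -/

/-- Write the constant string `s` into the memory, from position `t` on. -/
def constOps (n m : ℕ) (Q : Type) : ℕ → List Bool → List (Op (n + m) Q)
  | _, [] => []
  | t, b :: s => (if h : t < m then if b then [.x (memWire n t h)] else [] else []) ++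
      constOps n m Q (t + 1) s

theorem constOps_length (t : ℕ) (s : List Bool) : (constOps n m Q t s).length ≤ s.length := by
  induction s generalizing t with
  | nil => simp [constOps]
  | cons b s ih =>
    have := ih (t + 1)
    simp only [constOps, List.length_append, List.length_cons]
    split_ifs <;> simp <;> omega

theorem constOps_isPerm (t : ℕ) (s : List Bool) : ∀ o ∈ constOps n m Q t s, o.IsPerm := by
  induction s generalizing t with
  | nil => simp [constOps]
  | cons b s ih =>
    intro o ho
    rcases List.mem_append.1 ho with ho | ho
    · split_ifs at ho
      · rw [List.mem_singleton.1 ho]; trivial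
      · simp at ho
      · simp at ho
    · exact ih _ o ho

theorem act_constOps (mem s : List Bool) (h : mem.length + s.length ≤ m) (ψ : St n ℂ) :
    act (constOps n m Q mem.length s) (emb m mem ψ) = emb m (mem ++ s) ψ := by
  induction s generalizing mem with
  | nil => rw [List.append_nil]; rfl
  | cons b s ih =>
    simp only [List.length_cons] at h
    have hl : mem.length < m := by omega
    have h1 := ih (mem ++ [b]) (by simp; omega)
    simp only [List.length_append, List.length_singleton, List.append_assoc,
      List.singleton_append] at h1
    rw [constOps, act_append, ← h1]
    congr 1
    rw [dif_pos hl, emb, emb, pad_append_singleton mem b hl]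
    cases b with
    | true =>
      rw [if_pos rfl, act_x_mem, pad_apply_length]; rfl
    | false =>
      have : Function.update (pad m mem) ⟨mem.length, hl⟩ false = pad m mem := by
        rw [← pad_apply_length mem hl, Function.update_eq_self]
      rw [this]
      rfl

/-! #### Gates -/

/-- Compute the NAND gate `g` of the values before position `t` into the memory wire `t`. -/
def gateOps (n m : ℕ) (Q : Type) (t : ℕ) (g : ℕ × ℕ) : List (Op (n + m) Q) :=
  if ht : t < m then
    (if h : g.1 < t ∧ g.2 < t then
      -- A Toffoli gate needs distinct controls; for equal inputs the conjunction is the bit itself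
      -- and a CNOT suffices.
      if he : g.1 = g.2 then
        [.cnot (memWire n g.1 (h.1.trans ht)) (memWire n t ht) (memWire_ne _ _ h.1.ne)]
      else
        [.ccx (memWire n g.1 (h.1.trans ht)) (memWire n g.2 (h.2.trans ht)) (memWire n t ht)
          (memWire_ne _ _ he) (memWire_ne _ _ h.1.ne) (memWire_ne _ _ h.2.ne)]
    -- An index out of range reads the constant 0, so the conjunction is 0 and only the final
    -- negation of NAND remains.
    else []) ++ [.x (memWire n t ht)]
  else []

theorem gateOps_length (t : ℕ) (g : ℕ × ℕ) : (gateOps n m Q t g).length ≤ 2 := by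
  unfold gateOps
  split_ifs <;> simp

theorem gateOps_isPerm (t : ℕ) (g : ℕ × ℕ) : ∀ o ∈ gateOps n m Q t g, o.IsPerm := by
  unfold gateOps
  intro o ho
  split_ifs at ho with h1 h2 h3
  · simp only [List.mem_append, List.mem_singleton] at ho
    rcases ho with rfl | rfl <;> trivial
  · simp only [List.mem_append, List.mem_singleton] at ho
    rcases ho with rfl | rfl <;> trivial
  · simp only [List.nil_append, List.mem_singleton] at ho
    subst ho; trivial
  · simp at ho

theorem act_gateOps (mem : List Bool) (g : ℕ × ℕ) (h : mem.length < m) (ψ : St n ℂ) :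
    act (gateOps n m Q mem.length g) (emb m mem ψ) =
      emb m (mem ++ [!(mem.getD g.1 false && mem.getD g.2 false)]) ψ := by
  rw [gateOps, dif_pos h, emb, emb, pad_append_singleton mem _ h, act_append]
  have h0 := pad_apply_length mem h
  by_cases hg : g.1 < mem.length ∧ g.2 < mem.length
  · rw [dif_pos hg]
    by_cases he : g.1 = g.2
    · rw [dif_pos he, act_cnot_mem _ _ (fun h' => hg.1.ne (congrArg Fin.val h')), act_x_mem]
      congr 1
      simp only [h0, Function.update_self, Function.update_idem, Bool.false_xor]
      congr 1
      simp [pad, he]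
    · rw [dif_neg he, act_ccx_mem _ _ _ (fun h' => hg.1.ne (congrArg Fin.val h'))
        (fun h' => hg.2.ne (congrArg Fin.val h')), act_x_mem]
      congr 1
      simp only [h0, Function.update_self, Function.update_idem, Bool.false_xor]
      rfl
  · rw [dif_neg hg]
    have : (mem.getD g.1 false && mem.getD g.2 false) = false := by
      rw [not_and_or, not_lt, not_lt] at hg
      rcases hg with hg | hg
      · rw [List.getD_eq_default _ _ hg, Bool.false_and]
      · rw [List.getD_eq_default mem false hg, Bool.and_false]
    rw [this]
    change act [_] (embBits (pad m mem) ψ) = _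
    rw [act_x_mem, h0]

def gatesOps (n m : ℕ) (Q : Type) : ℕ → List (ℕ × ℕ) → List (Op (n + m) Q)
  | _, [] => []
  | t, g :: gs => gateOps n m Q t g ++ gatesOps n m Q (t + 1) gs

theorem gatesOps_length (t : ℕ) (gs : List (ℕ × ℕ)) :
    (gatesOps n m Q t gs).length ≤ 2 * gs.length := by
  induction gs generalizing t with
  | nil => simp [gatesOps]
  | cons g gs ih =>
    have := ih (t + 1)
    have := gateOps_length (n := n) (m := m) (Q := Q) t g
    simp only [gatesOps, List.length_append, List.length_cons]
    omega

theorem gatesOps_isPerm (t : ℕ) (gs : List (ℕ × ℕ)) : ∀ o ∈ gatesOps n m Q t gs, o.IsPerm := by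
  induction gs generalizing t with
  | nil => simp [gatesOps]
  | cons g gs ih =>
    intro o ho
    rcases List.mem_append.1 ho with ho | ho
    · exact gateOps_isPerm t g o ho
    · exact ih _ o ho

theorem runGates_length (gs : List (ℕ × ℕ)) (v : List Bool) :
    (BoolCircuit.runGates gs v).length = v.length + gs.length := by
  induction gs generalizing v with
  | nil => rfl
  | cons g gs ih => simp [BoolCircuit.runGates, ih]; omega

theorem act_gatesOps (mem : List Bool) (gs : List (ℕ × ℕ)) (h : mem.length + gs.length ≤ m)
    (ψ : St n ℂ) :
    act (gatesOps n m Q mem.length gs) (emb m mem ψ) = emb m (BoolCircuit.runGates gs mem) ψ := by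
  induction gs generalizing mem with
  | nil => rfl
  | cons g gs ih =>
    simp only [List.length_cons] at h
    rw [gatesOps, act_append, act_gateOps mem g (by omega)]
    have := ih (mem ++ [!(mem.getD g.1 false && mem.getD g.2 false)]) (by simp; omega)
    rw [List.length_append, List.length_singleton] at this
    rw [this]
    rfl

/-! #### Copying wires into the memory -/

/-- Copy the wires `reg` into the memory, from position `t` on. -/
def copyOps (n m : ℕ) (Q : Type) : ℕ → List (Fin n) → List (Op (n + m) Q)
  | _, [] => []
  | t, i :: reg => (if h : t < m then
      [.cnot (Fin.castAdd m i) (memWire n t h) (memWire_ne_castAdd h i).symm] else []) ++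
      copyOps n m Q (t + 1) reg

theorem copyOps_length (t : ℕ) (reg : List (Fin n)) :
    (copyOps n m Q t reg).length ≤ reg.length := by
  induction reg generalizing t with
  | nil => simp [copyOps]
  | cons i reg ih =>
    have := ih (t + 1)
    simp only [copyOps, List.length_append, List.length_cons]
    split_ifs <;> simp <;> omega

theorem copyOps_isPerm (t : ℕ) (reg : List (Fin n)) :
    ∀ o ∈ copyOps n m Q t reg, o.IsPerm := by
  induction reg generalizing t with
  | nil => simp [copyOps]
  | cons b s ih =>
    intro o ho
    rcases List.mem_append.1 ho with ho | ho
    · split_ifs at ho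
      · rw [List.mem_singleton.1 ho]; trivial
      · simp at ho
    · exact ih _ o ho

/-- On the support of `ψ` the wires `reg` have the definite content `s`, so each CNOT writes a known
bit and no entanglement with the memory arises. -/
theorem act_copyOps (mem : List Bool) (reg : List (Fin n)) (s : List Bool)
    (hm : mem.length + reg.length ≤ m) (ψ : St n ℂ) (hψ : ∀ w, reg.map w ≠ s → ψ w = 0) :
    act (copyOps n m Q mem.length reg) (emb m mem ψ) = emb m (mem ++ s) ψ := by
  -- For `ψ = 0` the string `s` may have any length; otherwise the support condition forces the
  -- length of `reg`.
  by_cases h0 : ψ = 0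
  · subst h0
    rw [emb_zero, emb_zero]; rfl
  have hs : s.length = reg.length := by
    by_contra hs
    refine h0 (funext fun w => hψ w fun h => hs ?_)
    rw [← h, List.length_map]
  clear h0
  induction reg generalizing mem s with
  | nil =>
    rw [List.length_nil, List.length_eq_zero_iff] at hs
    subst hs
    rw [List.append_nil]; rfl
  | cons i reg ih =>
    obtain ⟨b, s, rfl⟩ := List.exists_cons_of_length_eq_add_one hs
    simp only [List.length_cons] at hm
    have hl : mem.length < m := by omega
    have h1 := ih (mem ++ [b]) s (by simp; omega) (fun w hw => hψ w fun h => hw (by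
      simpa using (List.cons.inj h).2)) (by simpa using hs)
    simp only [List.length_append, List.length_singleton, List.append_assoc,
      List.singleton_append] at h1
    rw [copyOps, act_append, ← h1]
    congr 1
    rw [dif_pos hl, emb, emb, pad_append_singleton mem b hl]
    refine st_ext fun u a => ?_
    simp only [act, permAll, Op.perm, Fin.append_left, Fin.append_right, update_append_right,
      embBits_append]
    by_cases hu : ψ u = 0
    · simp [hu]
    · have hb : u i = b := by
        by_contra hb
        exact hu (hψ u fun h => hb (List.cons.inj h).1)
      rw [hb]
      have : Function.update a ⟨mem.length, hl⟩ (xor (a ⟨mem.length, hl⟩) b) = pad m mem ↔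
          a = Function.update (pad m mem) ⟨mem.length, hl⟩ b := by
        have h2 := pad_apply_length mem hl
        constructor
        · intro h
          rw [← h] at h2
          simp only [Function.update_self] at h2
          rw [← h, Function.update_idem]
          have : b = a ⟨mem.length, hl⟩ := by
            revert h2; cases b <;> cases a ⟨mem.length, hl⟩ <;> simp
          rw [this, Function.update_eq_self]
        · rintro rfl
          simp only [Function.update_self, Function.update_idem, Bool.xor_self]
          rw [← h2, Function.update_eq_self]
      simp only [this]

/-- Measure the wires `reg` and record the outcome in the memory. -/
def pushReg (n m : ℕ) (Q : Type) (t : ℕ) (reg : List (Fin n)) : List (Op (n + m) Q) :=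
  (reg.map (Fin.castAdd m)).map Op.meas ++ copyOps n m Q t reg

/-- The measurement establishes the support condition of `act_copyOps` in each branch. -/
theorem run_pushReg (ans : Q → St (n + m) ℂ → (St (n + m) ℂ → ℝ) → ℝ) (mem : List Bool)
    (reg : List (Fin n)) (hm : mem.length + reg.length ≤ m) (ψ : St n ℂ)
    {k : St (n + m) ℂ → ℝ} (hk : QuadHom k) :
    Op.run ans (pushReg n m Q mem.length reg) (emb m mem ψ) k =
      measure reg ψ fun s φ => k (emb m (mem ++ s) φ) := by
  rw [pushReg, run_append]
  simp only [run_perm ans _ (copyOps_isPerm mem.length reg)]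
  rw [run_meas (k := fun φ => k (act (copyOps n m Q mem.length reg) φ)) _ _ _ hk.zero, measure_emb]
  refine measure_congr reg ψ fun s φ _ hφ => ?_
  rw [act_copyOps mem reg s hm φ hφ]

/-! #### Coins -/

/-- Toss `r` coins and record them in the memory, from position `t` on. -/
def coinOps (n m : ℕ) (Q : Type) : ℕ → ℕ → List (Op (n + m) Q)
  | _, 0 => []
  | t, r + 1 => (if h : t < m then [.h (memWire n t h), .meas (memWire n t h)] else []) ++
      coinOps n m Q (t + 1) r

theorem coinOps_length (t r : ℕ) : (coinOps n m Q t r).length ≤ 2 * r := by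
  induction r generalizing t with
  | zero => simp [coinOps]
  | succ r ih =>
    have := ih (t + 1)
    simp only [coinOps, List.length_append]
    split_ifs <;> simp <;> omega

theorem avg_bits_succ {r : ℕ} (F : Bits (r + 1) → ℝ) :
    avg F = (∑ b : Bool, avg fun s : Bits r => F (Fin.cons b s)) / 2 := by
  simp only [avg, Fintype.card_pi, Fintype.card_bool, Finset.prod_const, Finset.card_univ,
    Fintype.card_fin, Nat.cast_pow, Nat.cast_ofNat, sum_bits_succ F, Fintype.sum_bool]
  rw [← add_div, div_div, pow_succ]

/-- The wire holds 0, so a Hadamard gate gives both values the amplitude `1/√2`; the sign in the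
gate only multiplies a vanishing amplitude. By homogeneity, each outcome gets weight one half. -/
theorem run_coin (ans : Q → St (n + m) ℂ → (St (n + m) ℂ → ℝ) → ℝ) (mem : List Bool)
    (h : mem.length < m) (ψ : St n ℂ) {k : St (n + m) ℂ → ℝ} (hk : QuadHom k) :
    Op.run ans [.h (memWire n mem.length h), .meas (memWire n mem.length h)] (emb m mem ψ) k =
      (∑ b : Bool, k (emb m (mem ++ [b]) ψ)) / 2 := by
  simp only [Op.run, Op.step]
  rw [measure_eq_sum _ _ (fun _ => hk.zero)]
  simp only [List.length_cons, List.length_nil]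
  rw [sum_bits_succ, Finset.sum_div]
  refine Finset.sum_congr rfl fun b _ => ?_
  rw [Fintype.sum_subsingleton _ (fun i : Fin 0 => (i.elim0 : Bool))]
  have hs : ‖((Real.sqrt 2 : ℝ) : ℂ)⁻¹‖ ^ 2 = 1 / 2 := by
    rw [norm_inv, Complex.norm_real, Real.norm_of_nonneg (Real.sqrt_nonneg _), inv_pow,
      Real.sq_sqrt (by norm_num)]; norm_num
  have : k (emb m (mem ++ [b]) ψ) / 2 =
      k (((Real.sqrt 2 : ℝ) : ℂ)⁻¹ • emb m (mem ++ [b]) ψ) := by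
    rw [hk, hs]; ring
  rw [this]
  refine congrArg k (st_ext fun u a => ?_)
  simp only [List.map_cons, List.map_nil, List.ofFn_cons, List.cons.injEq, List.ofFn_zero,
    and_true, Fin.append_right, update_append_right, emb, embBits_append, Pi.smul_apply,
    pad_append_singleton mem b h]
  have h1 : Function.update a ⟨mem.length, h⟩ true ≠ pad m mem := fun h' => by
    have := pad_apply_length mem h
    rw [← h'] at this
    simp at this
  have h2 : (Function.update a ⟨mem.length, h⟩ false = pad m mem ∧ a ⟨mem.length, h⟩ = b) ↔
      a = Function.update (pad m mem) ⟨mem.length, h⟩ b := by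
    constructor
    · rintro ⟨h', rfl⟩
      rw [← h', Function.update_idem, Function.update_eq_self]
    · rintro rfl
      rw [Function.update_idem, Function.update_self, ← pad_apply_length mem h,
        Function.update_eq_self]
      exact ⟨rfl, rfl⟩
  simp only [h1, if_false, smul_zero, add_zero, ← h2]
  by_cases h3 : a ⟨mem.length, h⟩ = b <;>
    by_cases h4 : Function.update a ⟨mem.length, h⟩ false = pad m mem <;> simp [h3, h4]

theorem run_coinOps {ans : Q → St (n + m) ℂ → (St (n + m) ℂ → ℝ) → ℝ}
    (hans : ∀ q, IsChannel (ans q)) (mem : List Bool) (r : ℕ) (h : mem.length + r ≤ m)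
    (ψ : St n ℂ) {k : St (n + m) ℂ → ℝ} (hk : QuadHom k) :
    Op.run ans (coinOps n m Q mem.length r) (emb m mem ψ) k =
      avg fun s : Bits r => k (emb m (mem ++ List.ofFn s) ψ) := by
  induction r generalizing mem with
  | zero => simp [coinOps, Op.run, avg]
  | succ r ih =>
    have hl : mem.length < m := by omega
    rw [coinOps, dif_pos hl, run_append, run_coin ans mem hl ψ ((isChannel_run hans _).hom hk),
      avg_bits_succ]
    congr 1
    refine Finset.sum_congr rfl fun b _ => ?_
    have := ih (mem ++ [b]) (by simp; omega)
    rw [List.length_append, List.length_singleton] at this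
    rw [this]
    simp

/-! #### Clearing the memory -/

/-- A reset adds up two Kraus branches, but the wire holds the definite bit `a j`, so the other
branch is the zero state. -/
theorem run_reset_mem (ans : Q → St (n + m) ℂ → (St (n + m) ℂ → ℝ) → ℝ) (js : List (Fin m))
    (a : Bits m) (ψ : St n ℂ) {k : St (n + m) ℂ → ℝ} (hk : QuadHom k) :
    Op.run ans (js.map fun j => .reset (Fin.natAdd n j)) (embBits a ψ) k =
      k (embBits (fun i => if i ∈ js then false else a i) ψ) := by
  induction js generalizing a ψ with
  | nil => simp [Op.run]
  | cons j js ih =>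
    simp only [List.map_cons, Op.run, Op.step]
    have hb : ∀ b, (fun w : Bits (n + m) => if w (Fin.natAdd n j) = false then
        embBits a ψ (Function.update w (Fin.natAdd n j) b) else 0) =
        if b = a j then embBits (Function.update a j false) ψ else 0 := by
      intro b
      refine st_ext fun u a' => ?_
      rw [Fin.append_right, update_append_right, embBits_append]
      by_cases hba : b = a j
      · subst hba
        rw [if_pos rfl, embBits_append]
        have : (a' j = false ∧ Function.update a' j (a j) = a) ↔
            a' = Function.update a j false := by
          constructor
          · rintro ⟨h1, h2⟩
            rw [← h2, Function.update_idem, ← h1, Function.update_eq_self]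
          · rintro rfl
            simp
        simp only [← this]
        by_cases h1 : a' j = false <;> simp [h1]
      · have : Function.update a' j b ≠ a := fun h => hba (by rw [← h]; simp)
        simp [hba, this]
    simp only [hb]
    rw [Fintype.sum_eq_single (a j)]
    · rw [if_pos rfl, ih]
      congr 2
      funext i
      by_cases h1 : i ∈ js
      · simp [h1]
      · by_cases h2 : i = j
        · subst h2; simp
        · simp [h1, h2]
    · intro b hb
      rw [if_neg hb, ← embBits_zero a, ih, embBits_zero]
      exact hk.zero

/-- Reset the memory wires from position `t` on. -/
def resetFrom (n m : ℕ) (Q : Type) (t : ℕ) : List (Op (n + m) Q) :=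
  ((List.finRange m).filter fun j : Fin m => t ≤ (j : ℕ)).map fun j => .reset (Fin.natAdd n j)

theorem resetFrom_length (t : ℕ) : (resetFrom n m Q t).length ≤ m := by
  rw [resetFrom, List.length_map]
  exact (List.length_filter_le _ _).trans (by simp)

theorem run_resetFrom (ans : Q → St (n + m) ℂ → (St (n + m) ℂ → ℝ) → ℝ) (mem s : List Bool)
    (ψ : St n ℂ) {k : St (n + m) ℂ → ℝ} (hk : QuadHom k) :
    Op.run ans (resetFrom n m Q mem.length) (emb m (mem ++ s) ψ) k = k (emb m mem ψ) := by
  rw [resetFrom, emb, run_reset_mem ans _ _ _ hk, emb]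
  congr 2
  funext i
  simp only [List.mem_filter, List.mem_finRange, true_and, decide_eq_true_eq, pad]
  by_cases h : mem.length ≤ i
  · rw [if_pos h, List.getD_eq_default _ _ h]
  · rw [if_neg h, List.getD_append _ _ _ _ (by omega)]

/-! #### Delivering strings from the memory -/

/-- XOR memory wires into the wires `ws`: the wire `o` receives the memory wire `src o`. -/
def deliverOps (n m : ℕ) (Q : Type) (src : Fin n → ℕ) (ws : List (Fin n)) : List (Op (n + m) Q) :=
  ws.flatMap fun o => if h : src o < m then
    [.cnot (memWire n (src o) h) (Fin.castAdd m o) (memWire_ne_castAdd h o)] else []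

theorem deliverOps_length (src : Fin n → ℕ) (ws : List (Fin n)) :
    (deliverOps n m Q src ws).length ≤ ws.length := by
  induction ws with
  | nil => simp [deliverOps]
  | cons o ws ih =>
    rw [deliverOps] at ih
    rw [deliverOps, List.flatMap_cons, List.length_append, List.length_cons, add_comm]
    refine Nat.add_le_add ih ?_
    split_ifs <;> simp

theorem deliverOps_isPerm (src : Fin n → ℕ) (ws : List (Fin n)) :
    ∀ o ∈ deliverOps n m Q src ws, o.IsPerm := by
  intro o ho
  obtain ⟨i, -, hi⟩ := List.mem_flatMap.1 ho
  split_ifs at hi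
  · rw [List.mem_singleton.1 hi]; trivial
  · simp at hi

/-- Repetitions in `ws` have to be excluded: XOR-ing the same bit twice into a wire would cancel. -/
theorem act_deliverOps (mem : List Bool) (hmem : mem.length ≤ m) (src : Fin n → ℕ)
    (ws : List (Fin n)) (hws : ws.Nodup) (ψ : St n ℂ) :
    act (deliverOps n m Q src ws) (emb m mem ψ) =
      emb m mem fun w => ψ fun j => xor (w j) (decide (j ∈ ws) && mem.getD (src j) false) := by
  induction ws generalizing ψ with
  | nil => simp [deliverOps]; rfl
  | cons o ws ih =>
    have hd : deliverOps n m Q src (o :: ws) = deliverOps n m Q src [o] ++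
        deliverOps n m Q src ws := by simp [deliverOps]
    have h1 : act (deliverOps n m Q src [o]) (emb m mem ψ) =
        emb m mem fun w => ψ (Function.update w o (xor (w o) (mem.getD (src o) false))) := by
      by_cases h : src o < m
      · have : deliverOps n m Q src [o] =
          [.cnot (memWire n (src o) h) (Fin.castAdd m o) (memWire_ne_castAdd h o)] := by
          simp [deliverOps, h]
        rw [this]
        refine st_ext fun u a => ?_
        simp only [act, permAll, Op.perm, emb, update_append_left, embBits_append, Fin.append_left,
          Fin.append_right]
        by_cases ha : a = pad m mem
        · subst ha; rfl
        · simp [ha]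
      · have : deliverOps n m Q src [o] = [] := by simp [deliverOps, h]
        rw [this, List.getD_eq_default _ _ (by omega)]
        simp only [Bool.xor_false, Function.update_eq_self]
        rfl
    rw [hd, act_append, h1, ih (List.nodup_cons.1 hws).2]
    congr 1
    funext w
    congr 1
    have ho := (List.nodup_cons.1 hws).1
    funext j
    by_cases hj : j = o
    · subst hj; simp [ho]
    · simp [hj]

/-- XOR the memory wires `src 0`, `src 1`, … into the wires `out`. -/
def outOps (n m : ℕ) (Q : Type) (src : ℕ → ℕ) (out : List (Fin n)) : List (Op (n + m) Q) :=
  -- If a wire occurs twice in `out`, `xorMask` uses its first position; `idxOf` on the deduplicated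
  -- list does the same.
  deliverOps n m Q (fun o => src (out.idxOf o)) out.dedup

theorem outOps_length (src : ℕ → ℕ) (out : List (Fin n)) :
    (outOps n m Q src out).length ≤ out.length :=
  (deliverOps_length _ _).trans (List.dedup_sublist out).length_le

theorem outOps_isPerm (src : ℕ → ℕ) (out : List (Fin n)) :
    ∀ o ∈ outOps n m Q src out, o.IsPerm := deliverOps_isPerm _ _

theorem act_outOps (mem : List Bool) (hmem : mem.length ≤ m) (src : ℕ → ℕ) (out : List (Fin n))
    (s : List Bool) (hs : ∀ i < out.length, mem.getD (src i) false = s.getD i false)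
    (ψ : St n ℂ) :
    act (outOps n m Q src out) (emb m mem ψ) = emb m mem (xorInto out s ψ) := by
  rw [outOps, act_deliverOps mem hmem _ _ (List.nodup_dedup out)]
  congr 1
  funext w
  refine congrArg ψ (funext fun j => ?_)
  simp only [xorMask, List.mem_dedup]
  by_cases hj : j ∈ out
  · rw [hs _ (List.idxOf_lt_length_of_mem hj)]
  · simp [hj]

end MemoryOps

/-! ### Registers given by injective maps -/

theorem xorMask_ofFn {n r : ℕ} (t : Fin r → Fin n) (ht : Function.Injective t) (s : List Bool) :
    xorMask (List.ofFn t) s = Function.extend t (fun i => s.getD i false) fun _ => false := by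
  funext j
  by_cases hj : ∃ i, t i = j
  · obtain ⟨i, rfl⟩ := hj
    have hi : (i : ℕ) < (List.ofFn t).length := by simp
    have h1 : (List.ofFn t)[(i : ℕ)] = t i := by simp
    have h2 : (List.ofFn t).idxOf (t i) = i := by
      rw [← h1]
      exact (List.nodup_ofFn.2 ht).idxOf_getElem _ hi
    rw [ht.extend_apply, xorMask, h2]
    simp
  · rw [Function.extend_apply' _ _ _ hj, xorMask]
    have : j ∉ List.ofFn t := fun h => hj (by simpa [List.mem_ofFn] using h)
    simp [this]

/-! ### Oracle queries on memory wires -/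

section Queries

variable {n m : ℕ} {Q : Type}

/-- The memory wires from `t` to `t + r - 1`. -/
def memRange (n : ℕ) {m : ℕ} (t r : ℕ) (h : t + r ≤ m) : List (Fin (n + m)) :=
  List.ofFn fun i : Fin r => memWire n (t + i) (by omega)

theorem memRange_length (t r : ℕ) (h : t + r ≤ m) : (memRange n t r h).length = r := by
  simp [memRange]

theorem memRange_injective (t r : ℕ) (h : t + r ≤ m) :
    Function.Injective fun i : Fin r => memWire n (t + i) (show t + i < m by omega) := by
  intro i j hij
  have := congrArg Fin.val hij
  simp only [Fin.natAdd_mk] at this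
  exact Fin.ext (by omega)

theorem xor_append_right (u : Bits n) (a : Bits m) (d : Bits (n + m))
    (hd : ∀ i, d (Fin.castAdd m i) = false) :
    (fun j => xor (Fin.append u a j) (d j)) =
      Fin.append u fun i => xor (a i) (d (Fin.natAdd n i)) := by
  funext j
  refine Fin.addCases (fun j => ?_) (fun j => ?_) j
  · simp [hd]
  · simp

theorem xor_eq_iff (a b d : Bits m) :
    (fun i => xor (a i) (d i)) = b ↔ a = fun i => xor (b i) (d i) := by
  constructor
  · rintro rfl
    funext i
    simp
  · rintro rfl
    funext i
    simp

theorem pad_append (mem s : List Bool) (i : Fin m) :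
    pad m (mem ++ s) i =
      if (i : ℕ) < mem.length then pad m mem i else s.getD (i - mem.length) false := by
  simp only [pad]
  split_ifs with h
  · rw [List.getD_append _ _ _ _ h]
  · rw [List.getD_append_right _ _ _ _ (by omega)]

theorem xor_extend_memRange (mem s : List Bool) (r : ℕ) (h : mem.length + r ≤ m)
    (hs : s.length ≤ r) (i : Fin m) :
    xor (pad m mem i) (Function.extend
      (fun i : Fin r => memWire n (mem.length + i) (show mem.length + i < m by omega))
      (fun i => s.getD i false) (fun _ => false) (Fin.natAdd n i)) = pad m (mem ++ s) i := by
  rw [pad_append]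
  by_cases hi : ∃ j : Fin r, memWire n (mem.length + j) (show mem.length + j < m by omega) =
      Fin.natAdd n i
  · have h2 := hi
    obtain ⟨j, hj⟩ := hi
    rw [← hj, (memRange_injective mem.length r h).extend_apply]
    have := congrArg Fin.val hj
    simp only [Fin.natAdd_mk, Fin.val_natAdd] at this
    have hij : (i : ℕ) = mem.length + j := by omega
    rw [if_neg (by omega), pad, List.getD_eq_default _ _ (by omega), Bool.false_xor, hij,
      Nat.add_sub_cancel_left]
  · rw [Function.extend_apply' _ _ _ hi, Bool.xor_false]
    by_cases h1 : (i : ℕ) < mem.length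
    · rw [if_pos h1]
    · rw [if_neg h1, pad, List.getD_eq_default _ _ (by omega), List.getD_eq_default]
      by_contra h3
      exact hi ⟨⟨i - mem.length, by omega⟩, Fin.ext (by simp; omega)⟩

/-- The wires after `mem` hold zeros, so XOR-ing an answer there appends it, cut to the `r` wires
available. -/
theorem xorInto_memRange (mem s : List Bool) (r : ℕ) (h : mem.length + r ≤ m) (ψ : St n ℂ) :
    xorInto (memRange n mem.length r h) s (emb m mem ψ) = emb m (mem ++ s.take r) ψ := by
  refine st_ext fun u a => ?_
  have hmask : xorMask (memRange n mem.length r h) s = Function.extend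
      (fun i : Fin r => memWire n (mem.length + i) (show mem.length + i < m by omega))
      (fun i => (s.take r).getD i false) fun _ => false := by
    rw [memRange, xorMask_ofFn _ (memRange_injective mem.length r h)]
    congr 1
    funext i
    simp only [List.getD_eq_getElem?_getD, List.getElem?_take]
    rw [if_pos i.2]
  rw [xorInto, hmask, xor_append_right, emb, emb, embBits_append, embBits_append]
  · simp only [xor_eq_iff]
    simp only [xor_extend_memRange mem (s.take r) r h (by simp)]
  · intro i
    rw [Function.extend_apply']
    rintro ⟨j, hj⟩
    exact memWire_ne_castAdd _ i hj

theorem measure_memRange (mem : List Bool) (t r : ℕ) (h : t + r ≤ m) (ψ : St n ℂ)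
    {k : List Bool → St (n + m) ℂ → ℝ} (hk : ∀ s, k s 0 = 0) :
    measure (memRange n t r h) (emb m mem ψ) k =
      k (List.ofFn fun i : Fin r => mem.getD (t + i) false) (emb m mem ψ) := by
  have hmap : ∀ (u : Bits n) (a : Bits m), (memRange n t r h).map (Fin.append u a) =
      List.ofFn fun i : Fin r => a ⟨t + i, by omega⟩ := by
    intro u a
    rw [memRange, List.map_ofFn]
    congr 1
    funext i
    simp only [Function.comp, Fin.append_right]
  rw [measure_of_support _ _ (Fin.append (fun _ => false) (pad m mem)) _ hk, hmap]
  · rfl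
  · refine forall_bits_append.2 fun u a hw => ?_
    rw [emb, embBits_append, if_neg]
    rintro rfl
    exact hw (by rw [hmap, hmap])

/-- The query whose argument is at the memory positions `P`, with target from position `t` on. -/
def memQuery (n : ℕ) {m l : ℕ} (P : Fin l → ℕ) (t : ℕ) (hP : Function.Injective P)
    (hPt : ∀ i, P i < t) (h : t + l ≤ m) : PRFQuery l (n + m) where
  toFun := Sum.elim (fun i => memWire n (P i) (by have := hPt i; omega))
    fun i => memWire n (t + i) (by omega)
  inj' := by
    rintro (i | i) (j | j) hij
    all_goals
      have h1 := congrArg Fin.val hij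
      simp only [Sum.elim_inl, Sum.elim_inr, Fin.natAdd_mk] at h1
    · exact congrArg _ (hP (by omega))
    · have := hPt i; omega
    · have := hPt j; omega
    · exact congrArg _ (Fin.ext (by omega))

/-- The argument lies before the target, so it is the same before and after the XOR. This resolves
the apparent circularity in the preimage condition, where `g` is evaluated at bits of the unknown
string `a` itself. -/
theorem prfAns_memQuery {l : ℕ} (g : Bits l → Bits l) (mem : List Bool) (P : Fin l → ℕ)
    (hP : Function.Injective P) (hPt : ∀ i, P i < mem.length) (h : mem.length + l ≤ m)
    (ψ : St n ℂ) (k : St (n + m) ℂ → ℝ) :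
    prfAns g (memQuery n P mem.length hP hPt h) (emb m mem ψ) k =
      k (emb m (mem ++ List.ofFn (g fun i => mem.getD (P i) false)) ψ) := by
  refine congrArg k (st_ext fun u a => ?_)
  have hq : (fun i => memQuery n P mem.length hP hPt h (Sum.inr i)) =
      fun i : Fin l => memWire n (mem.length + i) (show mem.length + i < m by omega) := rfl
  have hc : ∀ (s : Bits l) (i : Fin n), Function.extend
      (fun i : Fin l => memWire n (mem.length + i) (show mem.length + i < m by omega)) s
      (fun _ => false) (Fin.castAdd m i) = false := by
    intro s i
    rw [Function.extend_apply']
    rintro ⟨j, hj⟩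
    exact memWire_ne_castAdd _ i hj
  rw [hq, xor_append_right _ _ _ (hc _), emb, emb, embBits_append, embBits_append]
  have hp : ∀ i, memQuery n P mem.length hP hPt h (Sum.inl i) =
      Fin.natAdd n ⟨P i, by have := hPt i; omega⟩ := fun _ => rfl
  simp only [hp, Fin.append_right]
  have key : ∀ x : Bits l, (fun i : Fin m => xor (pad m mem i) (Function.extend
      (fun i : Fin l => memWire n (mem.length + i) (show mem.length + i < m by omega))
      (g x) (fun _ => false) (Fin.natAdd n i))) =
      pad m (mem ++ List.ofFn (g x)) := by
    intro x
    funext i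
    rw [← xor_extend_memRange (n := n) mem (List.ofFn (g x)) l h (by simp)]
    congr 3
    funext j
    simp
  have hlow : ∀ (s : List Bool) (i : Fin l), pad m (mem ++ s) ⟨P i, by have := hPt i; omega⟩ =
      mem.getD (P i) false := by
    intro s i
    rw [pad_append, if_pos (hPt i)]
    rfl
  have hiff : (a = fun i => xor (pad m mem i) (Function.extend
      (fun i : Fin l => memWire n (mem.length + i) (show mem.length + i < m by omega))
      (g fun i => a ⟨P i, by have := hPt i; omega⟩) (fun _ => false) (Fin.natAdd n i))) ↔
      a = pad m (mem ++ List.ofFn (g fun i => mem.getD (P i) false)) := by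
    constructor
    · intro ha
      rw [key] at ha
      have : (fun i => a ⟨P i, by have := hPt i; omega⟩) = fun i => mem.getD (P i) false := by
        funext i
        conv_lhs => rw [ha]
        exact hlow _ i
      rw [ha, this]
    · rintro rfl
      simp only [hlow]
      rw [key]
  simp only [xor_eq_iff, hiff]

end Queries

/-! ### Preparing public keys -/

section Prepare

variable {n m l : ℕ} {Q : Type}

/-- The action `|x⟩|z⟩ ↦ |x⟩|z ⊕ g(x)⟩` on states. -/
def oracleAct (g : Bits l → Bits l) (q : PRFQuery l n) (ψ : St n ℂ) : St n ℂ :=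
  fun w => ψ fun j => xor (w j)
    (Function.extend (fun i => q (Sum.inr i)) (g fun i => w (q (Sum.inl i))) (fun _ => false) j)

/-- There is one Kraus operator for each discarded string; injectivity of `t` lets the successive
single-wire sums combine into one sum over strings. -/
theorem run_resets (ans : Q → St n ℂ → (St n ℂ → ℝ) → ℝ) {r : ℕ} (t : Fin r → Fin n)
    (ht : Function.Injective t) (ψ : St n ℂ) (k : St n ℂ → ℝ) :
    Op.run ans ((List.ofFn t).map Op.reset) ψ k = ∑ s : Bits r,
      k fun w => if ∀ i, w (t i) = false then ψ (Function.extend t s w) else 0 := by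
  induction r generalizing ψ with
  | zero =>
    have : ∀ w : Bits n, ∀ s, Function.extend t s w = w := fun w s =>
      funext fun j => Function.extend_apply' _ _ _ (fun ⟨a, _⟩ => a.elim0)
    simp [Op.run, this]
  | succ r ih =>
    have ht' : Function.Injective fun i : Fin r => t i.succ := fun i j h =>
      Fin.succ_injective _ (ht h)
    rw [List.ofFn_succ, List.map_cons, Op.run, sum_bits_succ]
    simp only [Op.step]
    refine Finset.sum_congr rfl fun b _ => ?_
    rw [ih _ ht']
    refine Finset.sum_congr rfl fun s _ => congrArg k (funext fun w => ?_)
    have h0 : Function.extend (fun i : Fin r => t i.succ) s w (t 0) = w (t 0) :=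
      Function.extend_apply' _ _ _ (by rintro ⟨a, ha⟩; exact Fin.succ_ne_zero a (ht ha))
    have h1 : Function.update (Function.extend (fun i : Fin r => t i.succ) s w) (t 0) b =
        Function.extend t (Fin.cons b s : Bits (r + 1)) w := by
      funext j
      by_cases hj : ∃ i, t i = j
      · obtain ⟨i, rfl⟩ := hj
        rw [ht.extend_apply]
        refine Fin.cases ?_ (fun i => ?_) i
        · simp
        · rw [Function.update_of_ne (fun h => Fin.succ_ne_zero i (ht h)), Fin.cons_succ]
          exact ht'.extend_apply _ _ i
      · rw [Function.extend_apply' _ _ _ hj, Function.update_of_ne (fun h => hj ⟨0, h.symm⟩)]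
        exact Function.extend_apply' _ _ _ fun ⟨a, ha⟩ => hj ⟨a.succ, ha⟩
    simp only [h0, h1, Fin.forall_fin_succ (P := fun i => w (t i) = false)]
    by_cases h2 : w (t 0) = false <;> by_cases h3 : ∀ i : Fin r, w (t i.succ) = false <;>
      simp [h2, h3]

/-- On a wire holding 0 only the first term of the Hadamard gate survives, and it copies the
amplitude to both values with factor `1/√2`. -/
theorem run_hadamards (ans : Q → St n ℂ → (St n ℂ → ℝ) → ℝ) (ws : List (Fin n)) (hws : ws.Nodup)
    (φ : St n ℂ) (hφ : ∀ w, ∀ i ∈ ws, w i = true → φ w = 0) (k : St n ℂ → ℝ) :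
    Op.run ans (ws.map Op.h) φ k = k fun w =>
      (((Real.sqrt 2 : ℝ) : ℂ)⁻¹) ^ ws.length • φ fun j => if j ∈ ws then false else w j := by
  induction ws generalizing φ with
  | nil => simp [Op.run]
  | cons i ws ih =>
    obtain ⟨hi, hws'⟩ := List.nodup_cons.1 hws
    rw [List.map_cons, Op.run, Op.step]
    have h1 : (fun w => ((Real.sqrt 2 : ℝ) : ℂ)⁻¹ • (φ (Function.update w i false) +
        (if w i then (-1 : ℂ) else 1) • φ (Function.update w i true))) =
        fun w => ((Real.sqrt 2 : ℝ) : ℂ)⁻¹ • φ (Function.update w i false) := by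
      funext w
      rw [hφ (Function.update w i true) i (by simp) (by simp)]
      simp
    rw [h1, ih hws']
    · refine congrArg k (funext fun w => ?_)
      have : Function.update (fun j => if j ∈ ws then false else w j) i false =
          fun j => if j ∈ i :: ws then false else w j := by
        funext j
        by_cases hj : j = i
        · subst hj; simp
        · simp [hj]
      rw [this, List.length_cons, pow_succ, mul_smul]
    · intro w j hj hwj
      have hne : j ≠ i := fun h => hi (h ▸ hj)
      rw [hφ _ j (List.mem_cons_of_mem _ hj) (by simp [hne, hwj])]
      simp

/-- Prepare the state `2^{-l/2} ∑_x |x, 0⟩` on the wires `tgt`. -/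
def prepOps (Q : Type) (tgt : Fin l ⊕ Fin l ↪ Fin n) : List (Op n Q) :=
  (List.ofFn fun i => tgt (Sum.inl i)).map Op.reset ++
    ((List.ofFn fun i => tgt (Sum.inr i)).map Op.reset ++
      (List.ofFn fun i => tgt (Sum.inl i)).map Op.h)

theorem extend_extend (tgt : Fin l ⊕ Fin l ↪ Fin n) (x y : Bits l) (w : Bits n) :
    Function.extend (fun i => tgt (Sum.inl i)) x (Function.extend (fun i => tgt (Sum.inr i)) y w) =
      Function.extend tgt (Sum.elim x y) w := by
  have hl : Function.Injective fun i => tgt (Sum.inl i) :=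
    tgt.injective.comp Sum.inl_injective
  have hr : Function.Injective fun i => tgt (Sum.inr i) :=
    tgt.injective.comp Sum.inr_injective
  funext j
  by_cases hj : ∃ i, tgt i = j
  · obtain ⟨i | i, rfl⟩ := hj
    · rw [tgt.injective.extend_apply]
      exact hl.extend_apply _ _ i
    · rw [tgt.injective.extend_apply, Function.extend_apply']
      · exact hr.extend_apply _ _ i
      · rintro ⟨a, ha⟩
        simpa using tgt.injective ha
  · rw [Function.extend_apply' _ _ _ hj, Function.extend_apply', Function.extend_apply']
    · exact fun ⟨a, ha⟩ => hj ⟨_, ha⟩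
    · exact fun ⟨a, ha⟩ => hj ⟨_, ha⟩

/-- The discarded content `o = (x, y)` matches the outcomes of the two groups of resets. In each
term the wires then carry the uniform superposition of `|x', 0⟩`, which the oracle turns into the
state of the graph. -/
theorem run_prepOps (ans : Q → St n ℂ → (St n ℂ → ℝ) → ℝ) (g : Bits l → Bits l)
    (tgt : Fin l ⊕ Fin l ↪ Fin n) (ψ : St n ℂ) (k : St n ℂ → ℝ) :
    Op.run ans (prepOps Q tgt) ψ (fun φ => k (oracleAct g tgt φ)) =
      prepare (graphState g) tgt ψ k := by
  have hl : Function.Injective fun i => tgt (Sum.inl i) :=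
    tgt.injective.comp Sum.inl_injective
  have hr : Function.Injective fun i => tgt (Sum.inr i) :=
    tgt.injective.comp Sum.inr_injective
  rw [prepOps, run_append, run_resets ans _ hl, prepare, sum_key]
  refine Finset.sum_congr rfl fun x _ => ?_
  rw [run_append, run_resets ans _ hr]
  refine Finset.sum_congr rfl fun y _ => ?_
  have hstate : (fun w : Bits n => if ∀ i, w (tgt (Sum.inr i)) = false then
      (if ∀ i, Function.extend (fun i => tgt (Sum.inr i)) y w (tgt (Sum.inl i)) = false then
        ψ (Function.extend (fun i => tgt (Sum.inl i)) x
          (Function.extend (fun i => tgt (Sum.inr i)) y w)) else 0) else 0) =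
      fun w => if ∀ i, w (tgt i) = false then
        ψ (Function.extend tgt (Sum.elim x y) w) else 0 := by
    funext w
    have : ∀ i, Function.extend (fun i => tgt (Sum.inr i)) y w (tgt (Sum.inl i)) =
        w (tgt (Sum.inl i)) := fun i =>
      Function.extend_apply' _ _ _ (by rintro ⟨a, ha⟩; simpa using tgt.injective ha)
    simp only [this, extend_extend, Sum.forall]
    by_cases h1 : ∀ i, w (tgt (Sum.inr i)) = false <;>
      by_cases h2 : ∀ i, w (tgt (Sum.inl i)) = false <;> simp [h1, h2]
  rw [hstate, run_hadamards ans _ (List.nodup_ofFn.2 hl)]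
  · refine congrArg k (funext fun w => ?_)
    simp only [oracleAct, List.length_ofFn, List.mem_ofFn]
    have hin : ∀ i, (∃ j, tgt (Sum.inl j) = tgt (Sum.inl i)) := fun i => ⟨i, rfl⟩
    have hnin : ∀ i, ¬ ∃ j, tgt (Sum.inl j) = tgt (Sum.inr i) := by
      rintro i ⟨j, hj⟩
      simpa using tgt.injective hj
    have hext : ∀ i, Function.extend (fun i => tgt (Sum.inr i)) (g fun i => w (tgt (Sum.inl i)))
        (fun _ => false) (tgt (Sum.inr i)) = g (fun i => w (tgt (Sum.inl i))) i :=
      fun i => hr.extend_apply _ _ i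
    have hcond : (∀ i, (if ∃ j, tgt (Sum.inl j) = tgt i then false else
        xor (w (tgt i)) (Function.extend (fun i => tgt (Sum.inr i))
          (g fun i => w (tgt (Sum.inl i))) (fun _ => false) (tgt i))) = false) ↔
        g (fstHalf fun i => w (tgt i)) = sndHalf fun i => w (tgt i) := by
      simp only [Sum.forall, hin, hnin, if_true, if_false, hext, implies_true, true_and,
        funext_iff, sndHalf]
      refine forall_congr' fun i => ?_
      change _ ↔ g (fun i => w (tgt (Sum.inl i))) i = _
      cases w (tgt (Sum.inr i)) <;> cases g (fun i => w (tgt (Sum.inl i))) i <;> simp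
    have harg : Function.extend tgt (Sum.elim x y) (fun j => if ∃ i, tgt (Sum.inl i) = j then false
        else xor (w j) (Function.extend (fun i => tgt (Sum.inr i))
          (g fun i => w (tgt (Sum.inl i))) (fun _ => false) j)) =
        Function.extend tgt (Sum.elim x y) w := by
      funext j
      by_cases hj : ∃ i, tgt i = j
      · obtain ⟨i, rfl⟩ := hj
        rw [tgt.injective.extend_apply, tgt.injective.extend_apply]
      · rw [Function.extend_apply' _ _ _ hj, Function.extend_apply' _ _ _ hj,
          if_neg (fun ⟨i, hi⟩ => hj ⟨_, hi⟩),
          Function.extend_apply' _ _ _ (fun ⟨i, hi⟩ => hj ⟨_, hi⟩),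
          Bool.xor_false]
    have hsqrt : (((Real.sqrt 2 : ℝ) : ℂ)⁻¹) ^ l = ((Real.sqrt (2 ^ l) : ℝ) : ℂ)⁻¹ := by
      rw [inv_pow, ← Complex.ofReal_pow, ← Real.sqrt_sq (pow_nonneg (Real.sqrt_nonneg 2) l),
        ← pow_mul, mul_comm l, pow_mul, Real.sq_sqrt (by norm_num)]
    rw [graphState_apply]
    simp only [hcond, harg, hsqrt]
    split_ifs <;> simp
  · intro w i hi hwi
    obtain ⟨j, rfl⟩ := (List.mem_ofFn' _ _).1 hi
    refine if_neg fun h => ?_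
    have := h (Sum.inl j)
    rw [this] at hwi
    simp at hwi

theorem oracleAct_emb (g : Bits l → Bits l) (tgt : Fin l ⊕ Fin l ↪ Fin n) (mem : List Bool)
    (ψ : St n ℂ) :
    oracleAct g (tgt.trans (Fin.castAddEmb m)) (emb m mem ψ) = emb m mem (oracleAct g tgt ψ) := by
  refine st_ext fun u a => ?_
  have hr : Function.Injective fun i => tgt (Sum.inr i) :=
    tgt.injective.comp Sum.inr_injective
  have hr' : Function.Injective fun i => Fin.castAdd m (tgt (Sum.inr i)) :=
    (Fin.castAdd_injective n m).comp hr
  have h1 : ∀ s : Bits l, (fun j => xor (Fin.append u a j)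
      (Function.extend (fun i => Fin.castAdd m (tgt (Sum.inr i))) s (fun _ => false) j)) =
      Fin.append (fun j => xor (u j)
        (Function.extend (fun i => tgt (Sum.inr i)) s (fun _ => false) j)) a := by
    intro s
    funext j
    refine Fin.addCases (fun j => ?_) (fun j => ?_) j
    · simp only [Fin.append_left]
      congr 1
      by_cases hj : ∃ i, tgt (Sum.inr i) = j
      · obtain ⟨i, rfl⟩ := hj
        rw [hr.extend_apply s (fun _ => false) i]
        exact hr'.extend_apply _ _ i
      · rw [Function.extend_apply' _ _ _ hj, Function.extend_apply']
        exact fun ⟨i, hi⟩ => hj ⟨i, Fin.castAdd_injective n m hi⟩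
    · simp only [Fin.append_right]
      rw [Function.extend_apply', Bool.xor_false]
      rintro ⟨i, hi⟩
      have := congrArg Fin.val hi
      simp at this
      omega
  simp only [oracleAct, Function.Embedding.trans_apply, Fin.castAddEmb_apply, h1, Fin.append_left,
    emb, embBits_append]

/-! ### Evaluating a circuit in superposition -/

theorem act_sum {ι : Type} (s : Finset ι) (L : List (Op n Q)) (ψ : ι → St n ℂ) :
    act L (∑ i ∈ s, ψ i) = ∑ i ∈ s, act L (ψ i) := by
  funext w
  simp only [act, Finset.sum_apply]

theorem emb_sum {ι : Type} (s : Finset ι) (mem : List Bool) (ψ : ι → St n ℂ) :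
    emb m mem (∑ i ∈ s, ψ i) = ∑ i ∈ s, emb m mem (ψ i) := by
  funext w
  simp only [emb, embBits, Finset.sum_apply]
  split_ifs <;> simp

/-- Compute the values of the gates of `C` on the input `pre`, `x`, where `x` is on the wires
`reg`. -/
def evalOps (m : ℕ) (Q : Type) (C : BoolCircuit) (pre : List Bool) (reg : List (Fin n)) :
    List (Op (n + m) Q) :=
  constOps n m Q 0 pre ++ (copyOps n m Q pre.length reg ++
    gatesOps n m Q (pre.length + reg.length) C.gates)

theorem evalOps_isPerm (C : BoolCircuit) (pre : List Bool) (reg : List (Fin n)) :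
    ∀ o ∈ evalOps m Q C pre reg, o.IsPerm := by
  intro o ho
  rcases List.mem_append.1 ho with ho | ho
  · exact constOps_isPerm _ _ o ho
  rcases List.mem_append.1 ho with ho | ho
  · exact copyOps_isPerm _ _ o ho
  · exact gatesOps_isPerm _ _ o ho

theorem evalOps_length (C : BoolCircuit) (pre : List Bool) (reg : List (Fin n)) :
    (evalOps m Q C pre reg).length ≤ pre.length + reg.length + 2 * C.gates.length := by
  have h1 := constOps_length (n := n) (m := m) (Q := Q) 0 pre
  have h2 := copyOps_length (n := n) (m := m) (Q := Q) pre.length reg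
  have h3 := gatesOps_length (n := n) (m := m) (Q := Q) (pre.length + reg.length) C.gates
  simp only [evalOps, List.length_append]
  omega

theorem act_evalOps (C : BoolCircuit) (pre : List Bool) (reg : List (Fin n)) (s : List Bool)
    (hs : s.length = reg.length) (hm : pre.length + reg.length + C.gates.length ≤ m)
    (ψ : St n ℂ) (hψ : ∀ w, reg.map w ≠ s → ψ w = 0) :
    act (evalOps m Q C pre reg) (emb m [] ψ) =
      emb m (BoolCircuit.runGates C.gates (pre ++ s)) ψ := by
  have h1 := act_constOps (Q := Q) [] pre (by simp; omega) ψ (m := m)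
  have h2 := act_copyOps (Q := Q) pre reg s (by omega) ψ hψ (m := m)
  have h3 := act_gatesOps (Q := Q) (pre ++ s) C.gates (by simp; omega) ψ (m := m)
  rw [List.length_nil, List.nil_append] at h1
  rw [List.length_append, hs] at h3
  rw [evalOps, act_append, act_append, h1, h2, h3]

/-- XOR the value of the circuit into the second half of `tgt`, in superposition. -/
def coherentOps (m : ℕ) (Q : Type) (C : BoolCircuit) (pre : List Bool)
    (tgt : Fin l ⊕ Fin l ↪ Fin n) : List (Op (n + m) Q) :=
  evalOps m Q C pre (List.ofFn fun i => tgt (Sum.inl i)) ++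
    (outOps n m Q (fun i => C.outs.getD i m) (List.ofFn fun i => tgt (Sum.inr i)) ++
      (evalOps m Q C pre (List.ofFn fun i => tgt (Sum.inl i))).reverse)

theorem coherentOps_isPerm (C : BoolCircuit) (pre : List Bool) (tgt : Fin l ⊕ Fin l ↪ Fin n) :
    ∀ o ∈ coherentOps m Q C pre tgt, o.IsPerm := by
  intro o ho
  rcases List.mem_append.1 ho with ho | ho
  · exact evalOps_isPerm _ _ _ o ho
  rcases List.mem_append.1 ho with ho | ho
  · exact outOps_isPerm _ _ o ho
  · exact evalOps_isPerm _ _ _ o (List.mem_reverse.1 ho)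

theorem coherentOps_length (C : BoolCircuit) (pre : List Bool) (tgt : Fin l ⊕ Fin l ↪ Fin n) :
    (coherentOps m Q C pre tgt).length ≤ 2 * pre.length + 3 * l + 4 * C.gates.length := by
  have h1 := evalOps_length (m := m) (Q := Q) C pre (List.ofFn fun i => tgt (Sum.inl i))
  have h2 := outOps_length (m := m) (Q := Q) (fun i => C.outs.getD i m)
    (List.ofFn fun i => tgt (Sum.inr i))
  simp only [List.length_ofFn] at h1 h2
  simp only [coherentOps, List.length_append, List.length_reverse]
  omega

/-- The default `m` for a missing output refers to a wire that does not exist, so such a position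
reads 0, just as beyond the end of the output of `C`. -/
theorem getD_eval (C : BoolCircuit) (v : List Bool) (i : ℕ)
    (hm : v.length + C.gates.length ≤ m) :
    (BoolCircuit.runGates C.gates v).getD (C.outs.getD i m) false = (C.eval v).getD i false := by
  by_cases hi : i < C.outs.length
  · simp [BoolCircuit.eval, List.getD_eq_getElem?_getD, hi]
  · have h1 : C.outs.getD i m = m := List.getD_eq_default _ _ (by omega)
    rw [h1, List.getD_eq_default _ _ (by rw [runGates_length]; omega), List.getD_eq_default]
    simp [BoolCircuit.eval]; omega

/-- Compute, copy out, uncompute. By linearity it is enough to treat the component `ψx x` in which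
the first half of `tgt` has the definite content `x`; there all scratch values are classical. -/
theorem act_coherentOps (C : BoolCircuit) (pre : List Bool) (g : Bits l → Bits l)
    (hC : ∀ x : Bits l, C.eval (pre ++ List.ofFn x) = List.ofFn (g x))
    (hm : pre.length + l + C.gates.length ≤ m) (tgt : Fin l ⊕ Fin l ↪ Fin n) (ψ : St n ℂ) :
    act (coherentOps m Q C pre tgt) (emb m [] ψ) = emb m [] (oracleAct g tgt ψ) := by
  have hr : Function.Injective fun i => tgt (Sum.inr i) :=
    tgt.injective.comp Sum.inr_injective
  set ψx : Bits l → St n ℂ := fun x w => if (fun i => w (tgt (Sum.inl i))) = x then ψ w else 0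
    with hψx
  have hreg : ∀ w : Bits n, (List.ofFn fun i => tgt (Sum.inl i)).map w =
      List.ofFn fun i => w (tgt (Sum.inl i)) := fun w => by rw [List.map_ofFn]; rfl
  have hsum : ψ = ∑ x, ψx x := by
    funext w
    simp [hψx, Finset.sum_apply]
  have hmask : ∀ x : Bits l, xorMask (List.ofFn fun i => tgt (Sum.inr i)) (List.ofFn (g x)) =
      Function.extend (fun i => tgt (Sum.inr i)) (g x) fun _ => false := by
    intro x
    rw [xorMask_ofFn _ hr]
    congr 1
    funext i
    simp
  -- The XOR into the second half leaves the first half alone, so the component is still supported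
  -- on `x` when the scratch values are uncomputed.
  have hstable : ∀ (x : Bits l) (w : Bits n),
      (fun i => xor (w (tgt (Sum.inl i))) (xorMask (List.ofFn fun i => tgt (Sum.inr i))
        (List.ofFn (g x)) (tgt (Sum.inl i)))) = fun i => w (tgt (Sum.inl i)) := by
    intro x w
    funext i
    rw [hmask, Function.extend_apply', Bool.xor_false]
    rintro ⟨j, hj⟩
    simpa using tgt.injective hj
  have hres : oracleAct g tgt ψ =
      ∑ x, xorInto (List.ofFn fun i => tgt (Sum.inr i)) (List.ofFn (g x)) (ψx x) := by
    funext w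
    rw [Finset.sum_apply, Finset.sum_eq_single fun i => w (tgt (Sum.inl i))]
    · simp only [xorInto, hψx]
      rw [if_pos (hstable _ w), hmask]
      rfl
    · intro x _ hx
      simp only [xorInto, hψx]
      rw [if_neg]
      rw [hstable x w]
      exact hx.symm
    · simp
  have hsupp : ∀ x w, (List.ofFn fun i => tgt (Sum.inl i)).map w ≠ List.ofFn x → ψx x w = 0 := by
    intro x w hw
    rw [hreg] at hw
    exact if_neg fun h => hw (by rw [h])
  rw [hres, emb_sum]
  conv_lhs => rw [hsum, emb_sum, act_sum]
  refine Finset.sum_congr rfl fun x _ => ?_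
  have hD : ∀ φ : St n ℂ,
      (∀ w, (List.ofFn fun i => tgt (Sum.inl i)).map w ≠ List.ofFn x → φ w = 0) →
      act (evalOps m Q C pre (List.ofFn fun i => tgt (Sum.inl i))) (emb m [] φ) =
        emb m (BoolCircuit.runGates C.gates (pre ++ List.ofFn x)) φ := fun φ hφ =>
    act_evalOps C pre _ (List.ofFn x) (by simp) (by simpa using hm) φ hφ
  rw [coherentOps, act_append, act_append, hD _ (hsupp x),
    act_outOps _ (by rw [runGates_length]; simpa using hm) _ _ (List.ofFn (g x)) (fun i _ => by
      rw [getD_eval C _ i (by simpa using hm), hC]), ← hD, act_reverse]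
  intro w hw
  refine hsupp x (fun j => xor (w j) (xorMask (List.ofFn fun i => tgt (Sum.inr i))
    (List.ofFn (g x)) j)) fun h => hw ?_
  rw [hreg] at h ⊢
  rw [← h, ← hstable x w]

end Prepare

/-! ### Building circuits -/

theorem runGates_append (G E : List (ℕ × ℕ)) (v : List Bool) :
    BoolCircuit.runGates (G ++ E) v = BoolCircuit.runGates E (BoolCircuit.runGates G v) := by
  induction G generalizing v with
  | nil => rfl
  | cons g G ih => exact ih _

theorem runGates_prefix (G : List (ℕ × ℕ)) (v : List Bool) :
    ∃ s, BoolCircuit.runGates G v = v ++ s := by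
  induction G generalizing v with
  | nil => exact ⟨[], (List.append_nil v).symm⟩
  | cons g G ih =>
    obtain ⟨s, hs⟩ := ih (v ++ [!(v.getD g.1 false && v.getD g.2 false)])
    exact ⟨_, hs.trans (List.append_assoc _ _ _)⟩

/-- Some gate of `G`, run on the memory `mem ω`, has the value `φ ω`. -/
def Has {Ω : Type} (mem : Ω → List Bool) (len : ℕ) (G : List (ℕ × ℕ)) (φ : Ω → Bool) : Prop :=
  ∃ i < len + G.length, ∀ ω, (BoolCircuit.runGates G (mem ω)).getD i false = φ ω

/-- The bit `φ ω` can be computed from the memory `mem ω`, of length `len`, with `c` gates. -/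
def Computable {Ω : Type} (mem : Ω → List Bool) (len c : ℕ) (φ : Ω → Bool) : Prop :=
  -- The quantifier over the gates `G` already present makes computations composable: further gates
  -- can be placed after any circuit, and values present before remain available. The index `ω` runs
  -- over all possible memories, so one circuit serves them all.
  (∀ ω, (mem ω).length = len) ∧ ∀ G : List (ℕ × ℕ), ∃ E : List (ℕ × ℕ), E.length ≤ c ∧
    Has mem len (G ++ E) φ

section Computable

variable {Ω : Type} {mem : Ω → List Bool} {len c c₁ c₂ c₃ : ℕ} {φ χ θ : Ω → Bool}

theorem Has.append {G : List (ℕ × ℕ)} (hlen : ∀ ω, (mem ω).length = len) (h : Has mem len G φ)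
    (E : List (ℕ × ℕ)) : Has mem len (G ++ E) φ := by
  obtain ⟨i, hi, h⟩ := h
  refine ⟨i, by rw [List.length_append]; omega, fun ω => ?_⟩
  rw [runGates_append]
  obtain ⟨s, hs⟩ := runGates_prefix E (BoolCircuit.runGates G (mem ω))
  rw [hs, List.getD_append _ _ _ _ (by rw [runGates_length, hlen]; exact hi), h]

theorem Has.nand {G : List (ℕ × ℕ)} (hlen : ∀ ω, (mem ω).length = len) (h₁ : Has mem len G φ)
    (h₂ : Has mem len G χ) : ∃ g, Has mem len (G ++ [g]) fun ω => !(φ ω && χ ω) := by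
  obtain ⟨i, hi, h₁⟩ := h₁
  obtain ⟨j, hj, h₂⟩ := h₂
  refine ⟨(i, j), len + G.length, by simp, fun ω => ?_⟩
  have hl : (BoolCircuit.runGates G (mem ω)).length = len + G.length := by
    rw [runGates_length, hlen]
  rw [runGates_append]
  simp only [BoolCircuit.runGates]
  rw [List.getD_append_right _ _ _ _ hl.le, hl, Nat.sub_self, h₁, h₂]
  rfl

theorem Computable.mono (h : Computable mem len c₁ φ) (hc : c₁ ≤ c₂) : Computable mem len c₂ φ :=
  ⟨h.1, fun G => let ⟨E, hE, hG⟩ := h.2 G; ⟨E, hE.trans hc, hG⟩⟩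

theorem Computable.congr (h : Computable mem len c φ) (hφ : ∀ ω, φ ω = χ ω) :
    Computable mem len c χ := (funext hφ : φ = χ) ▸ h

theorem Computable.var (hlen : ∀ ω, (mem ω).length = len) {i : ℕ} (hi : i < len) :
    Computable mem len 0 fun ω => (mem ω).getD i false :=
  ⟨hlen, fun G => ⟨[], le_rfl, by
    rw [List.append_nil]
    have h0 : Has mem len [] fun ω => (mem ω).getD i false := ⟨i, hi, fun ω => rfl⟩
    exact h0.append hlen G⟩⟩

theorem Computable.nand (h₁ : Computable mem len c₁ φ) (h₂ : Computable mem len c₂ χ) :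
    Computable mem len (c₁ + c₂ + 1) fun ω => !(φ ω && χ ω) := by
  refine ⟨h₁.1, fun G => ?_⟩
  obtain ⟨E₁, hE₁, hG₁⟩ := h₁.2 G
  obtain ⟨E₂, hE₂, hG₂⟩ := h₂.2 (G ++ E₁)
  obtain ⟨g, hg⟩ := (hG₁.append h₁.1 E₂).nand h₁.1 hG₂
  exact ⟨E₁ ++ E₂ ++ [g], by simp; omega, by simpa using hg⟩

theorem Computable.not (h : Computable mem len c φ) :
    Computable mem len (c + 1) fun ω => !(φ ω) := by
  refine ⟨h.1, fun G => ?_⟩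
  obtain ⟨E, hE, hG⟩ := h.2 G
  obtain ⟨g, hg⟩ := hG.nand h.1 hG
  exact ⟨E ++ [g], by simp; omega, by simpa using hg⟩

theorem Computable.const (hlen : ∀ ω, (mem ω).length = len) (b : Bool) :
    Computable mem len 2 fun _ => b := by
  have ht : Computable mem len 1 fun _ => true := by
    -- Both inputs of this gate are its own position, which is still out of range and reads 0; hence
    -- its NAND is 1.
    refine ⟨hlen, fun G => ⟨[(len + G.length, len + G.length)], le_rfl, len + G.length,
      by simp, fun ω => ?_⟩⟩
    have hl : (BoolCircuit.runGates G (mem ω)).length = len + G.length := by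
      rw [runGates_length, hlen]
    rw [runGates_append]
    simp only [BoolCircuit.runGates]
    rw [List.getD_append_right _ _ _ _ hl.le, hl, Nat.sub_self,
      List.getD_eq_default _ _ hl.le]
    rfl
  cases b with
  | true => exact ht.mono (by omega)
  | false => exact ht.not

theorem Computable.and (h₁ : Computable mem len c₁ φ) (h₂ : Computable mem len c₂ χ) :
    Computable mem len (c₁ + c₂ + 2) fun ω => φ ω && χ ω :=
  (h₁.nand h₂).not.congr fun ω => by simp

theorem Computable.or (h₁ : Computable mem len c₁ φ) (h₂ : Computable mem len c₂ χ) :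
    Computable mem len (c₁ + c₂ + 3) fun ω => φ ω || χ ω :=
  ((h₁.not.nand h₂.not).mono (by omega)).congr fun ω => by simp

/-- The condition is built twice, once for each alternative, which explains the term `2 * c₁`. -/
theorem Computable.ite (h₁ : Computable mem len c₁ φ) (h₂ : Computable mem len c₂ χ)
    (h₃ : Computable mem len c₃ θ) :
    Computable mem len (2 * c₁ + c₂ + c₃ + 8) fun ω => if φ ω = true then χ ω else θ ω :=
  (((h₁.and h₂).or (h₁.not.and h₃)).mono (by omega)).congr fun ω => by
    cases φ ω <;> simp

theorem Computable.beq (h₁ : Computable mem len c₁ φ) (h₂ : Computable mem len c₂ χ) :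
    Computable mem len (2 * c₁ + 2 * c₂ + 9) fun ω => φ ω == χ ω :=
  ((h₁.ite h₂ h₂.not).mono (by omega)).congr fun ω => by
    cases φ ω <;> simp

theorem Computable.forall_lt (hlen : ∀ ω, (mem ω).length = len) (r : ℕ) {φ : ℕ → Ω → Bool}
    (h : ∀ i < r, Computable mem len c (φ i)) :
    Computable mem len (r * (c + 2) + 2) fun ω => decide (∀ i < r, φ i ω = true) := by
  induction r with
  | zero => exact ((Computable.const hlen true).mono (by omega)).congr fun ω => by simp
  | succ r ih =>
    refine (((ih fun i hi => h i (by omega)).and (h r (by omega))).mono (by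
      rw [Nat.succ_mul]; omega)).congr fun ω => ?_
    rw [Bool.eq_iff_iff]
    simp only [Bool.and_eq_true, decide_eq_true_eq]
    constructor
    · rintro ⟨h1, h2⟩ i hi
      rcases Nat.lt_succ_iff_lt_or_eq.1 hi with hi | rfl
      · exact h1 i hi
      · exact h2
    · exact fun h1 => ⟨fun i hi => h1 i (by omega), h1 r (by omega)⟩

/-- The circuit gates `gs`, with the input wires found at the positions `idx`, and the values of
the gates at the positions from `base` on. -/
def translate (idx : ℕ → ℕ) (r base : ℕ) (i : ℕ) : ℕ := if i < r then idx i else base + (i - r)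

/-- The invariant `h` covers also positions not yet computed, where both lists read 0. By `hV` the
ends of the two lists correspond under `translate`, so every appended value lands at the translated
position. -/
theorem runGates_translate (idx : ℕ → ℕ) (r base : ℕ) (hidx : ∀ i < r, idx i < base)
    (gs : List (ℕ × ℕ)) (V v : List Bool) (hV : V.length + r = v.length + base)
    (hr : r ≤ v.length)
    (h : ∀ i, V.getD (translate idx r base i) false = v.getD i false) (i : ℕ) :
    (BoolCircuit.runGates (gs.map fun g => (translate idx r base g.1, translate idx r base g.2))
      V).getD (translate idx r base i) false = (BoolCircuit.runGates gs v).getD i false := by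
  induction gs generalizing V v with
  | nil => exact h i
  | cons g gs ih =>
    simp only [List.map_cons, BoolCircuit.runGates]
    rw [h, h]
    refine ih _ _ (by simp; omega) (by simp; omega) fun j => ?_
    have hj : translate idx r base j < V.length ↔ j < v.length := by
      unfold translate
      split_ifs with hjr
      · have := hidx j hjr; omega
      · omega
    by_cases hjv : j < v.length
    · rw [List.getD_append _ _ _ _ hjv, List.getD_append _ _ _ _ (hj.2 hjv), h]
    · have hsub : translate idx r base j - V.length = j - v.length := by
        unfold translate
        rw [if_neg (by omega)]
        omega
      rw [List.getD_append_right _ _ _ _ (not_lt.1 fun h' => hjv (hj.1 h')),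
        List.getD_append_right _ _ _ _ (not_lt.1 hjv), hsub]

/-- All bits of the string `s ω` can be computed with `c` gates each. -/
def ComputableStr {Ω : Type} (mem : Ω → List Bool) (len c : ℕ) (s : Ω → List Bool) : Prop :=
  ∀ j, Computable mem len c fun ω => (s ω).getD j false

theorem ComputableStr.exists_gates {s : Ω → List Bool} (h : ComputableStr mem len c s)
    (r : ℕ) (G : List (ℕ × ℕ)) : ∃ E : List (ℕ × ℕ), E.length ≤ r * c ∧
      ∀ j < r, Has mem len (G ++ E) fun ω => (s ω).getD j false := by
  induction r with
  | zero => exact ⟨[], by simp, fun j hj => absurd hj (by omega)⟩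
  | succ r ih =>
    obtain ⟨E, hE, hG⟩ := ih
    obtain ⟨E', hE', hG'⟩ := (h r).2 (G ++ E)
    refine ⟨E ++ E', by rw [List.length_append, Nat.succ_mul]; omega, fun j hj => ?_⟩
    rw [← List.append_assoc]
    rcases Nat.lt_succ_iff_lt_or_eq.1 hj with hj | rfl
    · exact (hG j hj).append (h 0).1 E'
    · exact hG'

/-- Compute the `r` inputs of `C`, then append the gates of `C` with translated wire numbers. An
output that refers to a missing value is the constant 0. -/
theorem ComputableStr.eval {s : Ω → List Bool} (h : ComputableStr mem len c s) {r : ℕ}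
    (hr : ∀ ω, (s ω).length = r) (C : BoolCircuit) :
    ComputableStr mem len (r * c + C.size + 2) fun ω => C.eval (s ω) := by
  intro j
  have hlen := (h 0).1
  by_cases hj : j < C.outs.length ∧ C.outs.getD j 0 < r + C.gates.length
  · refine ⟨hlen, fun G => ?_⟩
    obtain ⟨E, hE, hG⟩ := h.exists_gates r G
    choose! idx hidx hval using hG
    set base := len + (G ++ E).length
    refine ⟨E ++ C.gates.map fun g => (translate idx r base g.1, translate idx r base g.2),
      ?_, translate idx r base (C.outs.getD j 0), ?_, fun ω => ?_⟩
    · rw [List.length_append, List.length_map, BoolCircuit.size]; omega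
    · rw [← List.append_assoc, List.length_append, List.length_map]
      unfold translate
      split_ifs with h1
      · have := hidx _ h1; omega
      · omega
    · have hl : (BoolCircuit.runGates (G ++ E) (mem ω)).length = base := by
        rw [runGates_length, hlen]
      rw [← List.append_assoc, runGates_append, runGates_translate idx r base hidx C.gates _ (s ω)
        (by rw [hl, hr]; omega) (hr ω).ge]
      · simp [BoolCircuit.eval, List.getD_eq_getElem?_getD, hj.1]
      · intro i
        unfold translate
        split_ifs with hi
        · exact hval i hi ω
        · rw [List.getD_eq_default _ _ (by omega), List.getD_eq_default]
          rw [hr]; omega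
  · refine ((Computable.const hlen false).mono (by omega)).congr fun ω => ?_
    symm
    by_cases h1 : j < C.outs.length
    · have h2 : r + C.gates.length ≤ C.outs.getD j 0 := by
        by_contra h2
        exact hj ⟨h1, by omega⟩
      simp only [BoolCircuit.eval]
      have h3 : (List.map (fun i => (BoolCircuit.runGates C.gates (s ω)).getD i false)
          C.outs).getD j false =
          (BoolCircuit.runGates C.gates (s ω)).getD (C.outs.getD j 0) false := by
        simp [List.getD_eq_getElem?_getD, h1]
      rw [h3]
      exact List.getD_eq_default _ _ (by rw [runGates_length, hr]; exact h2)
    · exact List.getD_eq_default _ _ (by simp [BoolCircuit.eval]; omega)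

theorem ComputableStr.mono {s : Ω → List Bool} (h : ComputableStr mem len c₁ s) (hc : c₁ ≤ c₂) :
    ComputableStr mem len c₂ s := fun j => (h j).mono hc

theorem ComputableStr.const (hlen : ∀ ω, (mem ω).length = len) (s : List Bool) :
    ComputableStr mem len 2 fun _ => s := fun _ => Computable.const hlen _

theorem ComputableStr.append {s t : Ω → List Bool} (hs : ComputableStr mem len c s)
    (ht : ComputableStr mem len c t) {a : ℕ} (ha : ∀ ω, (s ω).length = a) :
    ComputableStr mem len c fun ω => s ω ++ t ω := by
  intro j
  by_cases hj : j < a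
  · exact (hs j).congr fun ω => (List.getD_append _ _ _ _ (by rw [ha]; exact hj)).symm
  · refine (ht (j - a)).congr fun ω => ?_
    rw [List.getD_append_right _ _ _ _ (by rw [ha]; omega), ha]

theorem ComputableStr.drop {s : Ω → List Bool} (hs : ComputableStr mem len c s) (a : ℕ) :
    ComputableStr mem len c fun ω => (s ω).drop a := fun j =>
  (hs (a + j)).congr fun ω => by simp [List.getD_eq_getElem?_getD]

theorem ComputableStr.take {s : Ω → List Bool} (hs : ComputableStr mem len c s) (hc : 2 ≤ c)
    (a : ℕ) : ComputableStr mem len c fun ω => (s ω).take a := by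
  intro j
  by_cases hj : j < a
  · exact (hs j).congr fun ω => by simp [List.getD_eq_getElem?_getD, hj]
  · refine ((Computable.const (hs 0).1 false).mono hc).congr fun ω => ?_
    rw [List.getD_eq_default]
    simp; omega

theorem ComputableStr.ite (hφ : Computable mem len c₁ φ) {s t : Ω → List Bool}
    (hs : ComputableStr mem len c₂ s) (ht : ComputableStr mem len c₃ t) :
    ComputableStr mem len (2 * c₁ + c₂ + c₃ + 8) fun ω => if φ ω = true then s ω else t ω :=
  fun j => (hφ.ite (hs j) (ht j)).congr fun ω => by by_cases h : φ ω = true <;> simp [h]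

/-- A slice of the memory. -/
theorem ComputableStr.slice (hlen : ∀ ω, (mem ω).length = len) {s : Ω → List Bool} (off a : ℕ)
    (hoff : off + a ≤ len) (hs : ∀ ω, s ω = ((mem ω).drop off).take a) :
    ComputableStr mem len 2 s := by
  intro j
  by_cases hj : j < a
  · refine ((Computable.var hlen (show off + j < len by omega)).mono (by omega)).congr fun ω => ?_
    rw [hs]
    simp [List.getD_eq_getElem?_getD, hj]
  · refine (Computable.const hlen false).congr fun ω => ?_
    rw [hs, List.getD_eq_default]
    simp; omega

theorem ComputableStr.exists_circuit {s : Ω → List Bool} (h : ComputableStr mem len c s) (r : ℕ) :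
    ∃ C : BoolCircuit, C.gates.length ≤ r * c ∧
      ∀ ω, ∀ i < r, (C.eval (mem ω)).getD i false = (s ω).getD i false := by
  obtain ⟨E, hE, hG⟩ := h.exists_gates r []
  rw [List.nil_append] at hG
  choose! idx _ hval using hG
  refine ⟨⟨E, (List.range r).map idx⟩, hE, fun ω i hi => ?_⟩
  refine Eq.trans ?_ (hval i hi ω)
  simp [BoolCircuit.eval, List.getD_eq_getElem?_getD, hi]

end Computable

/-! ### Strings and their codes -/

/-- Decoding stops at the first incomplete cell or cell with flag 0. This makes the length
accessible to circuits, as a conjunction of conditions on single flags. -/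
theorem lt_length_decodeStr (v : List Bool) (i : ℕ) :
    i < (decodeStr v).length ↔ ∀ j < i + 1, 2 * j + 1 < v.length ∧ v.getD (2 * j) false = true := by
  induction v using decodeStr.induct generalizing i with
  | case1 b t ih =>
    rw [decodeStr, List.length_cons]
    cases i with
    | zero => simp
    | succ i =>
      rw [Nat.succ_lt_succ_iff, ih]
      constructor
      · intro h j hj
        cases j with
        | zero => simp
        | succ j =>
          have := h j (by omega)
          refine ⟨by simp; omega, ?_⟩
          rw [show 2 * (j + 1) = 2 * j + 1 + 1 by ring]
          simpa using this.2
      · intro h j hj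
        have := h (j + 1) (by omega)
        rw [show 2 * (j + 1) = 2 * j + 1 + 1 by ring] at this
        refine ⟨by simpa using this.1, by simpa using this.2⟩
  | case2 v hv =>
    have : decodeStr v = [] := by
      rw [decodeStr]
      exact hv
    rw [this]
    simp only [List.length_nil, Nat.not_lt_zero, false_iff, not_forall]
    refine ⟨0, by omega, fun ⟨h1, h2⟩ => ?_⟩
    match v, h1, h2 with
    | true :: b :: t, _, _ => exact hv b t rfl

theorem getD_decodeStr (v : List Bool) (i : ℕ) (h : i < (decodeStr v).length) :
    (decodeStr v).getD i false = v.getD (2 * i + 1) false := by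
  induction v using decodeStr.induct generalizing i with
  | case1 b t ih =>
    rw [decodeStr] at h ⊢
    cases i with
    | zero => simp
    | succ i =>
      rw [show 2 * (i + 1) + 1 = (2 * i + 1) + 1 + 1 by ring]
      simpa using ih i (by simpa using h)
  | case2 v hv =>
    have : decodeStr v = [] := by
      rw [decodeStr]
      exact hv
    rw [this] at h
    simp at h

theorem length_decodeStr_le (v : List Bool) : 2 * (decodeStr v).length ≤ v.length := by
  by_contra h
  have h0 : 0 < (decodeStr v).length := by omega
  have := ((lt_length_decodeStr v ((decodeStr v).length - 1)).1 (by omega)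
    ((decodeStr v).length - 1) (by omega)).1
  omega

theorem drop_decodeStr (v : List Bool) (l : ℕ) (h : l ≤ (decodeStr v).length) :
    (decodeStr v).drop l = decodeStr (v.drop (2 * l)) := by
  induction l generalizing v with
  | zero => simp
  | succ l ih =>
    match v with
    | true :: b :: t =>
      rw [decodeStr] at h ⊢
      rw [show 2 * (l + 1) = 2 * l + 1 + 1 by ring]
      simpa using ih t (by simpa using h)
    | [] => simp [decodeStr] at h
    | false :: t => simp [decodeStr] at h
    | [true] => simp [decodeStr] at h

/-- A last half cell never carries a bit; registers can thus be cut to the even length that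
encryption and decryption circuits expect. -/
theorem decodeStr_take (v : List Bool) : decodeStr (v.take (2 * (v.length / 2))) = decodeStr v := by
  induction v using decodeStr.induct with
  | case1 b t ih =>
    rw [show 2 * ((true :: b :: t).length / 2) = 2 * (t.length / 2) + 1 + 1 by simp; omega]
    simp only [List.take_succ_cons, decodeStr, ih]
  | case2 v hv =>
    match v with
    | true :: b :: t => exact absurd rfl (hv b t)
    | [] => rfl
    | [false] => rfl
    | false :: a :: t =>
      rw [show 2 * ((false :: a :: t).length / 2) = 2 * (t.length / 2) + 1 + 1 by simp; omega]
      simp [decodeStr]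
    | [true] => rfl

theorem encodeStr_append (s t : List Bool) : encodeStr (s ++ t) = encodeStr s ++ encodeStr t := by
  simp [encodeStr]

theorem encodeStr_cons (b : Bool) (t : List Bool) :
    encodeStr (b :: t) = true :: b :: encodeStr t := rfl

theorem length_encodeStr (s : List Bool) : (encodeStr s).length = 2 * s.length := by
  induction s with
  | nil => rfl
  | cons b s ih => rw [encodeStr_cons]; simp [ih]; ring

theorem getD_encodeStr_even (s : List Bool) (i : ℕ) :
    (encodeStr s).getD (2 * i) false = decide (i < s.length) := by
  induction s generalizing i with
  | nil => simp [encodeStr]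
  | cons b s ih =>
    rw [encodeStr_cons]
    cases i with
    | zero => simp
    | succ i =>
      rw [show 2 * (i + 1) = 2 * i + 1 + 1 by ring]
      simpa using ih i

theorem getD_encodeStr_odd (s : List Bool) (i : ℕ) :
    (encodeStr s).getD (2 * i + 1) false = s.getD i false := by
  induction s generalizing i with
  | nil => simp [encodeStr]
  | cons b s ih =>
    rw [encodeStr_cons]
    cases i with
    | zero => simp
    | succ i =>
      rw [show 2 * (i + 1) + 1 = (2 * i + 1) + 1 + 1 by ring]
      simpa using ih i

theorem getD_append_zeros (s : List Bool) (j i : ℕ) :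
    (s ++ List.replicate j false).getD i false = s.getD i false := by
  rcases lt_or_ge i s.length with h | h
  · rw [List.getD_append _ _ _ _ h]
  · rw [List.getD_append_right _ _ _ _ h, List.getD_eq_default s _ h]
    by_cases h2 : i - s.length < j
    · rw [List.getD_replicate _ h2]
    · rw [List.getD_eq_default _ _ (by simpa using h2)]

theorem BoolCircuit.Outputs.getD {C : BoolCircuit} {v s : List Bool} (h : C.Outputs v s) (i : ℕ) :
    (C.eval v).getD i false = s.getD i false := by
  obtain ⟨j, hj⟩ := h
  rw [hj, getD_append_zeros]

theorem BoolCircuit.Outputs.length_le {C : BoolCircuit} {v s : List Bool} (h : C.Outputs v s) :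
    s.length ≤ C.size := by
  obtain ⟨j, hj⟩ := h
  have := congrArg List.length hj
  simp only [BoolCircuit.eval, List.length_map, List.length_append] at this
  rw [BoolCircuit.size]
  omega

/-- Two strings are equal if they have the same length and the same bits. -/
theorem eq_iff_getD (s t : List Bool) (B : ℕ) (hs : s.length ≤ B) (ht : t.length ≤ B) :
    s = t ↔ ∀ i < B, decide (i < s.length) = decide (i < t.length) ∧
      s.getD i false = t.getD i false := by
  constructor
  · rintro rfl i _
    exact ⟨rfl, rfl⟩
  · intro h
    have hl : s.length = t.length := by
      by_contra hl
      rcases Nat.lt_or_gt_of_ne hl with h1 | h1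
      · have := (h s.length (by omega)).1
        simp at this; omega
      · have := (h t.length (by omega)).1
        simp at this; omega
    refine List.ext_getElem hl fun i h1 h2 => ?_
    have := (h i (by omega)).2
    rwa [List.getD_eq_getElem _ _ h1, List.getD_eq_getElem _ _ h2] at this

theorem length_eq_iff (a b B : ℕ) (ha : a ≤ B) (hb : b ≤ B) :
    a = b ↔ ∀ i < B, decide (i < a) = decide (i < b) := by
  constructor
  · rintro rfl i _; rfl
  · intro h
    by_contra hl
    rcases Nat.lt_or_gt_of_ne hl with h1 | h1
    · have := h a (by omega)
      simp at this; omega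
    · have := h b (by omega)
      simp at this; omega

/-! ### Sizes -/

section Size

variable {n m : ℕ} {Q : Type} (qsize : Q → ℕ)

theorem sizeOps_append (L₁ L₂ : List (Op n Q)) :
    sizeOps qsize (L₁ ++ L₂) = sizeOps qsize L₁ + sizeOps qsize L₂ := by
  simp [sizeOps]

theorem length_le_sizeOps (L : List (Op n Q)) : L.length ≤ sizeOps qsize L := by
  induction L with
  | nil => simp [sizeOps]
  | cons o L ih =>
    have : sizeOps qsize (o :: L) = Op.size qsize o + sizeOps qsize L := by simp [sizeOps]
    have h1 : 1 ≤ Op.size qsize o := by cases o <;> simp [Op.size]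
    rw [this, List.length_cons]
    omega

theorem qsize_le_sizeOps {L : List (Op n Q)} {q : Q} (h : Op.query q ∈ L) :
    qsize q ≤ sizeOps qsize L := by
  have h1 : Op.size qsize (Op.query q : Op n Q) ≤ sizeOps qsize L :=
    List.single_le_sum (by simp) _ (List.mem_map_of_mem h)
  simp only [Op.size] at h1
  omega

theorem sizeOps_eq_length {L : List (Op n Q)} (h : ∀ q, Op.query q ∉ L) :
    sizeOps qsize L = L.length := by
  induction L with
  | nil => simp [sizeOps]
  | cons o L ih =>
    have : sizeOps qsize (o :: L) = Op.size qsize o + sizeOps qsize L := by simp [sizeOps]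
    have h1 : Op.size qsize o = 1 := by
      cases o with
      | query q => exact absurd List.mem_cons_self (h q)
      | _ => rfl
    rw [this, h1, ih fun q hq => h q (List.mem_cons_of_mem _ hq), List.length_cons, add_comm]

theorem sizeOps_of_isPerm {L : List (Op n Q)} (h : ∀ o ∈ L, o.IsPerm) :
    sizeOps qsize L = L.length :=
  sizeOps_eq_length qsize fun _ hq => h _ hq

theorem sizeOps_constOps (t : ℕ) (s : List Bool) :
    sizeOps qsize (constOps n m Q t s) ≤ s.length := by
  rw [sizeOps_of_isPerm qsize (constOps_isPerm t s)]
  exact constOps_length t s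

theorem sizeOps_pushReg (t : ℕ) (reg : List (Fin n)) :
    sizeOps qsize (pushReg n m Q t reg) ≤ 2 * reg.length := by
  rw [pushReg, sizeOps_append, sizeOps_of_isPerm qsize (copyOps_isPerm t reg),
    sizeOps_eq_length qsize (by simp)]
  have := copyOps_length (n := n) (m := m) (Q := Q) t reg
  simp only [List.length_map]
  omega

theorem sizeOps_coinOps (t r : ℕ) : sizeOps qsize (coinOps n m Q t r) ≤ 2 * r := by
  have : ∀ q, Op.query q ∉ coinOps n m Q t r := by
    intro q
    induction r generalizing t with
    | zero => simp [coinOps]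
    | succ r ih =>
      rw [coinOps, List.mem_append, not_or]
      exact ⟨by split_ifs <;> simp, ih _⟩
  rw [sizeOps_eq_length qsize this]
  exact coinOps_length t r

theorem sizeOps_resetFrom (t : ℕ) : sizeOps qsize (resetFrom n m Q t) ≤ m := by
  rw [sizeOps_eq_length qsize (by simp [resetFrom])]
  exact resetFrom_length t

theorem sizeOps_prepOps {l : ℕ} (tgt : Fin l ⊕ Fin l ↪ Fin n) :
    sizeOps qsize (prepOps Q tgt) = 3 * l := by
  rw [sizeOps_eq_length qsize (by simp [prepOps])]
  simp [prepOps]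
  ring

/-! ### Computing an answer and clearing the memory -/

/-- Evaluate the circuit on the memory, which ends at position `t`, XOR the result into `out`, and
reset the memory from position `t₀` on. -/
def computeOps (n m : ℕ) (Q : Type) (t₀ t : ℕ) (C : BoolCircuit) (out : List (Fin n)) :
    List (Op (n + m) Q) :=
  gatesOps n m Q t C.gates ++
    (outOps n m Q (fun i => C.outs.getD i m) out ++ resetFrom n m Q t₀)

theorem sizeOps_computeOps (t₀ t : ℕ) (C : BoolCircuit) (out : List (Fin n)) :
    sizeOps qsize (computeOps n m Q t₀ t C out) ≤ 2 * C.gates.length + out.length + m := by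
  rw [computeOps, sizeOps_append, sizeOps_append, sizeOps_of_isPerm qsize (gatesOps_isPerm _ _),
    sizeOps_of_isPerm qsize (outOps_isPerm _ _)]
  have h1 := gatesOps_length (n := n) (m := m) (Q := Q) t C.gates
  have h2 := outOps_length (m := m) (Q := Q) (fun i => C.outs.getD i m) out
  have h3 := sizeOps_resetFrom (n := n) (m := m) qsize t₀
  omega

/-- All values from `t₀` on are definite in the given branch, so they can simply be reset;
uncomputation is not needed here. -/
theorem run_computeOps (ans : Q → St (n + m) ℂ → (St (n + m) ℂ → ℝ) → ℝ) (C : BoolCircuit)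
    (base extra : List Bool) (t₀ t : ℕ) (ht₀ : base.length = t₀) (ht : (base ++ extra).length = t)
    (hm : t + C.gates.length ≤ m) (out : List (Fin n)) (s : List Bool)
    (hs : ∀ i < out.length, (C.eval (base ++ extra)).getD i false = s.getD i false)
    (ψ : St n ℂ) {k : St (n + m) ℂ → ℝ} (hk : QuadHom k) :
    Op.run ans (computeOps n m Q t₀ t C out) (emb m (base ++ extra) ψ) k =
      k (emb m base (xorInto out s ψ)) := by
  subst ht₀
  subst ht
  rw [computeOps, run_append, run_perm ans _ (gatesOps_isPerm _ _), act_gatesOps _ _ hm, run_append,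
    run_perm ans _ (outOps_isPerm _ _),
    act_outOps _ (by rw [runGates_length]; exact hm) _ _ s (fun i hi => by
      rw [getD_eval C _ i hm, hs i hi])]
  obtain ⟨s', hs'⟩ := runGates_prefix C.gates (base ++ extra)
  rw [hs', List.append_assoc, run_resetFrom ans _ _ _ hk]

end Size

/-! ### Simulating a list of operations -/

/-- The list `D` is chosen before the index `i`, so one circuit works for all oracles, keys and
forbidden ciphertexts that `i` stands for. Every translated query restores the memory `mem i`, and
hence the pieces can be concatenated. -/
theorem exists_simulation {n m : ℕ} {Q Q' I : Type} (qsize : Q' → ℕ) (mem : I → List Bool)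
    (ansR : I → Q' → St (n + m) ℂ → (St (n + m) ℂ → ℝ) → ℝ)
    (ansG : I → Q → St n ℂ → (St n ℂ → ℝ) → ℝ) (hR : ∀ i q, IsChannel (ansR i q))
    (B : ℕ) (hB : 1 ≤ B) (ops : List (Op n Q))
    (hq : ∀ q, Op.query q ∈ ops → ∃ D : List (Op (n + m) Q'), sizeOps qsize D ≤ B ∧
      ∀ i ψ k, QuadHom k → Op.run (ansR i) D (emb m (mem i) ψ) k =
        ansG i q ψ fun φ => k (emb m (mem i) φ)) :
    ∃ D : List (Op (n + m) Q'), sizeOps qsize D ≤ ops.length * B ∧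
      ∀ i ψ k, QuadHom k → Op.run (ansR i) D (emb m (mem i) ψ) k =
        Op.run (ansG i) ops ψ fun φ => k (emb m (mem i) φ) := by
  induction ops with
  | nil => exact ⟨[], by simp [sizeOps], fun i ψ k _ => rfl⟩
  | cons o ops ih =>
    obtain ⟨D, hD, hsim⟩ := ih fun q h => hq q (List.mem_cons_of_mem _ h)
    have ho : ∃ D₁ : List (Op (n + m) Q'), sizeOps qsize D₁ ≤ B ∧
        ∀ i ψ k, QuadHom k → Op.run (ansR i) D₁ (emb m (mem i) ψ) k =
          Op.step (ansG i) o ψ fun φ => k (emb m (mem i) φ) := by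
      by_cases hoq : ∃ q, o = .query q
      · obtain ⟨q, rfl⟩ := hoq
        exact hq q List.mem_cons_self
      · refine ⟨liftOp m (fun _ : Q => []) o, ?_, fun i ψ k _ =>
          run_liftOp _ _ _ _ o (fun x _ hx => absurd ⟨x, hx⟩ hoq) ψ⟩
        have h1 : sizeOps qsize (liftOp m (fun _ : Q => []) o) ≤ 1 := by
          cases o <;> simp [liftOp, sizeOps, Op.size]
        exact h1.trans hB
    obtain ⟨D₁, hD₁, hsim₁⟩ := ho
    refine ⟨D₁ ++ D, ?_, fun i ψ k hk => ?_⟩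
    · rw [sizeOps_append, List.length_cons, Nat.succ_mul]
      omega
    · rw [run_append, hsim₁ i ψ _ ((isChannel_run (hR i) D).hom hk), Op.run]
      simp only [hsim i _ k hk]

/-! ### Bits of decoded strings -/

section Decode

variable {Ω : Type} {mem : Ω → List Bool} {len c s : ℕ} {v : Ω → List Bool}

theorem computable_lt_decode (hv : ComputableStr mem len 2 v) (hs : ∀ ω, (v ω).length = s)
    (i : ℕ) : Computable mem len ((i + 1) * 4 + 2)
      fun ω => decide (i < (decodeStr (v ω)).length) := by
  refine (Computable.forall_lt (hv 0).1 (i + 1) (c := 2)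
    (φ := fun j ω => decide (2 * j + 1 < s ∧ (v ω).getD (2 * j) false = true)) fun j _ => ?_).congr
    fun ω => ?_
  · by_cases h : 2 * j + 1 < s
    · exact (hv (2 * j)).congr fun ω => by simp [h]
    · exact (Computable.const (hv 0).1 false).congr fun ω => by simp [h]
  · simp only [lt_length_decodeStr, hs, decide_eq_true_eq]

theorem computable_le_decode (hv : ComputableStr mem len 2 v) (hs : ∀ ω, (v ω).length = s)
    (l : ℕ) : Computable mem len (l * ((l * 4 + 2) + 2) + 2) fun ω =>
      decide (l ≤ (decodeStr (v ω)).length) := by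
  refine (Computable.forall_lt (hv 0).1 l
    (φ := fun j ω => decide (j < (decodeStr (v ω)).length)) fun j hj =>
      (computable_lt_decode hv hs j).mono (c₂ := l * 4 + 2) (by omega)).congr fun ω => ?_
  simp only [decide_eq_true_eq, decide_eq_decide]
  constructor
  · intro h
    by_contra hl
    exact absurd (h (decodeStr (v ω)).length (by omega)) (lt_irrefl _)
  · intro h i hi
    omega

/-- The bits of a string in a register. -/
def cellBits (l : ℕ) (v : List Bool) : Bits l := fun i => v.getD (2 * i + 1) false

theorem computable_cellBits_eq (hv : ComputableStr mem len 2 v) {l : ℕ} (x : Bits l) :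
    Computable mem len (l * 19 + 2) fun ω => decide (cellBits l (v ω) = x) := by
  refine (Computable.forall_lt (hv 0).1 l (c := 17)
    (φ := fun j ω => (v ω).getD (2 * j + 1) false == (List.ofFn x).getD j false) fun j hj =>
      (hv _).beq (Computable.const (hv 0).1 _)).congr fun ω => ?_
  simp only [beq_iff_eq, decide_eq_decide, funext_iff, cellBits]
  constructor
  · intro h i
    simpa using h i i.2
  · intro h i hi
    simpa [hi] using h ⟨i, hi⟩

theorem computableStr_cellBits (hv : ComputableStr mem len 2 v) (l : ℕ) :
    ComputableStr mem len 2 fun ω => List.ofFn (cellBits l (v ω)) := by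
  intro j
  by_cases hj : j < l
  · exact (hv (2 * j + 1)).congr fun ω => by
      simp [List.getD_eq_getElem?_getD, hj, cellBits]
  · refine (Computable.const (hv 0).1 false).congr fun ω => ?_
    rw [List.getD_eq_default]
    simpa using hj

theorem keyDec_decodeStr (S : SKE) {l : ℕ} (h : Bits l → Bits l) (w : List Bool)
    (hl : l ≤ (decodeStr w).length) :
    keyDec S h (decodeStr w) = S.dec l (h (cellBits l w)) (decodeStr (w.drop (2 * l))) := by
  rw [keyDec, if_neg (by omega), drop_decodeStr w l hl]
  congr 2
  funext i
  exact getD_decodeStr w i (by omega)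

/-- `u` is the register of the second component of the ciphertext, cut to an even length. -/
theorem decodeStr_drop_take (w : List Bool) (s l : ℕ) (hs : w.length = s) :
    decodeStr ((w.drop (2 * l)).take (2 * ((s - 2 * l) / 2))) = decodeStr (w.drop (2 * l)) := by
  have := decodeStr_take (w.drop (2 * l))
  rwa [List.length_drop, hs] at this

end Decode

/-! ### Circuits for encryption and decryption -/

/-- `C` encrypts plaintexts of at most `L` bits with `R` coins. -/
def IsEncCircuit (S : SKE) (l L R : ℕ) (C : BoolCircuit) : Prop :=
  (∀ i ≤ L, S.coins l i ≤ R) ∧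
    ∀ (k : Bits l) (v r : List Bool), v.length = 2 * L → r.length = R →
      C.Outputs (List.ofFn k ++ v ++ r)
        (encodeStr (S.enc l k (decodeStr v) (r.take (S.coins l (decodeStr v).length))))

/-- `C` decrypts ciphertexts of at most `L` bits. -/
def IsDecCircuit (S : SKE) (l L : ℕ) (C : BoolCircuit) : Prop :=
  ∀ (k : Bits l) (v : List Bool), v.length = 2 * L →
    C.Outputs (List.ofFn k ++ v) (encodeAns (S.dec l k (decodeStr v)))

/-- Circuits for encryption and decryption of strings of at most `T` bits, of size at most `K`. -/
structure HasCircuits (S : SKE) (l T K : ℕ) : Prop where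
  two_le : 2 ≤ K
  l_le : l ≤ K
  T_le : T ≤ K
  enc : ∀ L ≤ T, ∃ (R : ℕ) (C : BoolCircuit), R ≤ K ∧ C.size ≤ K ∧ IsEncCircuit S l L R C
  dec : ∀ L ≤ T, ∃ C : BoolCircuit, C.size ≤ K ∧ IsDecCircuit S l L C

/-- The code of the ciphertext `(x, Enc(y, m; r))`, with `m` in the register `v`. -/
def ctCode {l : ℕ} (C : BoolCircuit) (x : Bits l) (s : ℕ) (y v r : List Bool) : List Bool :=
  [true] ++ (encodeStr (List.ofFn x) ++ C.eval (y ++ v.take (2 * (s / 2)) ++ r))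

/-- Cutting `v` to even length does not change the plaintext, and the zeros that may follow the
output of `C` are invisible bit by bit. -/
theorem ctCode_getD (S : SKE) {l s R : ℕ} {C : BoolCircuit} (hC : IsEncCircuit S l (s / 2) R C)
    (x y : Bits l) (v r : List Bool) (hv : v.length = s) (hr : r.length = R) (i : ℕ) :
    (ctCode C x s (List.ofFn y) v r).getD i false = (encodeAns (some (List.ofFn x ++
      S.enc l y (decodeStr v) (r.take (S.coins l (decodeStr v).length))))).getD i false := by
  have hd : decodeStr (v.take (2 * (s / 2))) = decodeStr v := by rw [← hv]; exact decodeStr_take v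
  have ho := hC.2 y (v.take (2 * (s / 2))) r (by rw [List.length_take]; omega) hr
  rw [hd] at ho
  obtain ⟨j, hj⟩ := ho
  rw [ctCode, hj, encodeAns, encodeStr_append, ← List.append_assoc, ← List.append_assoc,
    getD_append_zeros]
  rfl

section

variable {Ω : Type} {mem : Ω → List Bool} {len c : ℕ}

theorem computableStr_ctCode {l s R : ℕ} (C : BoolCircuit) (x : Bits l) {y v r : Ω → List Bool}
    (hy : ComputableStr mem len 2 y) (hv : ComputableStr mem len 2 v)
    (hr : ComputableStr mem len 2 r) (hyl : ∀ ω, (y ω).length = l) (hvl : ∀ ω, (v ω).length = s)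
    (hrl : ∀ ω, (r ω).length = R) {K : ℕ} (hK : 2 ≤ K) (hlK : l ≤ K) (hsK : s ≤ K) (hRK : R ≤ K)
    (hCK : C.size ≤ K) : ComputableStr mem len (8 * K) fun ω => ctCode C x s (y ω) (v ω) (r ω) := by
  have h2 : 2 ≤ 8 * K := by omega
  have htl : ∀ ω, ((v ω).take (2 * (s / 2))).length = 2 * (s / 2) := fun ω => by
    rw [List.length_take, hvl]; omega
  refine ((ComputableStr.const (hy 0).1 _).mono h2).append
    (((ComputableStr.const (hy 0).1 _).mono h2).append
      ((((hy.append (hv.take le_rfl _) hyl).append hr (a := l + 2 * (s / 2)) fun ω => ?_).eval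
        (r := l + 2 * (s / 2) + R) (fun ω => ?_) C).mono ?_) fun _ => rfl) fun _ => rfl
  · rw [List.length_append, hyl, htl]
  · rw [List.length_append, List.length_append, hyl, htl, hrl]
  · omega

theorem ComputableStr.of_append (hlen : ∀ ω, (mem ω).length = len) {pre s post : Ω → List Bool}
    {off a : ℕ} (h : ∀ ω, mem ω = pre ω ++ (s ω ++ post ω)) (hpre : ∀ ω, (pre ω).length = off)
    (hs : ∀ ω, (s ω).length = a) : ComputableStr mem len 2 s := by
  -- The bound `off + a ≤ len` can be read off only from an actual memory.
  by_cases hΩ : Nonempty Ω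
  · obtain ⟨ω₀⟩ := hΩ
    refine ComputableStr.slice hlen off a ?_ fun ω => ?_
    · rw [← hlen ω₀, h, List.length_append, List.length_append, hpre, hs]
      omega
    · rw [h, ← hpre ω, List.drop_left, ← hs ω, List.take_left]
  · exact fun j => (Computable.const hlen false).congr fun ω => absurd ⟨ω⟩ hΩ

end

/-! ### The memory of the reduction to the pseudorandom function -/

/-- What the reduction to the pseudorandom function remembers: the key `y`, whether the challenge
has been delivered, and the challenge plaintexts and coins. `g` is the oracle. -/
structure RedState (l s₀ s₁ R : ℕ) where
  g : Bits l → Bits l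
  y : Bits l
  flag : Bool
  v₀ : List Bool
  v₁ : List Bool
  r : List Bool
  len₀ : v₀.length = s₀
  len₁ : v₁.length = s₁
  lenr : r.length = R

namespace RedState

variable {l s₀ s₁ R : ℕ}

/-- The flag, plaintexts and coins come last, so while they are zero this is the memory `x ++ y`
followed by zeros. -/
def mem (x : Bits l) (i : RedState l s₀ s₁ R) : List Bool :=
  List.ofFn x ++ (List.ofFn i.y ++ ([i.flag] ++ (i.v₀ ++ (i.v₁ ++ i.r))))

theorem mem_length (x : Bits l) (i : RedState l s₀ s₁ R) :
    (i.mem x).length = 2 * l + 1 + s₀ + s₁ + R := by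
  simp [mem, i.len₀, i.len₁, i.lenr]
  ring

def chosen (b : Bool) (i : RedState l s₀ s₁ R) : List Bool := if b then i.v₁ else i.v₀

theorem chosen_length (b : Bool) (i : RedState l s₀ s₁ R) :
    (i.chosen b).length = if b then s₁ else s₀ := by
  cases b
  · exact i.len₀
  · exact i.len₁

/-- The challenge ciphertext. -/
def ct (S : SKE) (x : Bits l) (b : Bool) (i : RedState l s₀ s₁ R) : List Bool :=
  List.ofFn x ++ S.enc l i.y (decodeStr (i.chosen b))
    (i.r.take (S.coins l (decodeStr (i.chosen b)).length))

def sameLen (i : RedState l s₀ s₁ R) : Bool :=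
  decide ((decodeStr i.v₀).length = (decodeStr i.v₁).length)

/-- The challenge ciphertext is recomputed from plaintext, key and coins instead of being stored.
With the flag at 0 nothing is forbidden, so the same decryption circuit serves both stages. -/
def forb (S : SKE) (x : Bits l) (b : Bool) (i : RedState l s₀ s₁ R) : Option (List Bool) :=
  if (i.flag && i.sameLen) = true then some (i.ct S x b) else none

section

variable {Ω : Type} {mm : Ω → List Bool} {len K : ℕ}

theorem computableStr_y
    (hlen : ∀ ω, (mm ω).length = len) (x : Bits l) (ι : Ω → RedState l s₀ s₁ R)
    (extra : Ω → List Bool) (hmm : ∀ ω, mm ω = (ι ω).mem x ++ extra ω) :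
    ComputableStr mm len 2 fun ω => List.ofFn (ι ω).y :=
  ComputableStr.of_append hlen (off := l) (a := l) (pre := fun _ => List.ofFn x)
    (post := fun ω => [(ι ω).flag] ++ ((ι ω).v₀ ++ ((ι ω).v₁ ++ (ι ω).r)) ++ extra ω)
    (fun ω => by rw [hmm, mem]; simp) (by simp) (by simp)

theorem computable_flag
    (hlen : ∀ ω, (mm ω).length = len) (x : Bits l) (ι : Ω → RedState l s₀ s₁ R)
    (extra : Ω → List Bool) (hmm : ∀ ω, mm ω = (ι ω).mem x ++ extra ω) :
    Computable mm len 2 fun ω => (ι ω).flag :=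
  (ComputableStr.of_append hlen (off := l + l) (a := 1) (s := fun ω => [(ι ω).flag])
    (pre := fun ω => List.ofFn x ++ List.ofFn (ι ω).y)
    (post := fun ω => ((ι ω).v₀ ++ ((ι ω).v₁ ++ (ι ω).r)) ++ extra ω)
    (fun ω => by rw [hmm, mem]; simp) (by simp) (by simp) 0).congr fun ω => rfl

theorem computableStr_v₀
    (hlen : ∀ ω, (mm ω).length = len) (x : Bits l) (ι : Ω → RedState l s₀ s₁ R)
    (extra : Ω → List Bool) (hmm : ∀ ω, mm ω = (ι ω).mem x ++ extra ω) :
    ComputableStr mm len 2 fun ω => (ι ω).v₀ :=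
  ComputableStr.of_append hlen (off := l + (l + 1)) (a := s₀)
    (pre := fun ω => List.ofFn x ++ (List.ofFn (ι ω).y ++ [(ι ω).flag]))
    (post := fun ω => ((ι ω).v₁ ++ (ι ω).r) ++ extra ω)
    (fun ω => by rw [hmm, mem]; simp) (by simp) fun ω => (ι ω).len₀

theorem computableStr_v₁
    (hlen : ∀ ω, (mm ω).length = len) (x : Bits l) (ι : Ω → RedState l s₀ s₁ R)
    (extra : Ω → List Bool) (hmm : ∀ ω, mm ω = (ι ω).mem x ++ extra ω) :
    ComputableStr mm len 2 fun ω => (ι ω).v₁ :=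
  ComputableStr.of_append hlen (off := l + (l + (1 + s₀))) (a := s₁)
    (pre := fun ω => List.ofFn x ++ (List.ofFn (ι ω).y ++ ([(ι ω).flag] ++ (ι ω).v₀)))
    (post := fun ω => (ι ω).r ++ extra ω)
    (fun ω => by rw [hmm, mem]; simp) (fun ω => by simp [(ι ω).len₀, add_comm]) fun ω => (ι ω).len₁

theorem computableStr_r
    (hlen : ∀ ω, (mm ω).length = len) (x : Bits l) (ι : Ω → RedState l s₀ s₁ R)
    (extra : Ω → List Bool) (hmm : ∀ ω, mm ω = (ι ω).mem x ++ extra ω) :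
    ComputableStr mm len 2 fun ω => (ι ω).r :=
  ComputableStr.of_append hlen (off := l + (l + (1 + (s₀ + s₁)))) (a := R)
    (pre := fun ω => List.ofFn x ++ (List.ofFn (ι ω).y ++ ([(ι ω).flag] ++
      ((ι ω).v₀ ++ (ι ω).v₁))))
    (post := fun ω => extra ω)
    (fun ω => by rw [hmm, mem]; simp)
    (fun ω => by simp [(ι ω).len₀, (ι ω).len₁]; ring) fun ω => (ι ω).lenr

theorem computableStr_chosen
    (hlen : ∀ ω, (mm ω).length = len) (x : Bits l) (ι : Ω → RedState l s₀ s₁ R)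
    (extra : Ω → List Bool) (hmm : ∀ ω, mm ω = (ι ω).mem x ++ extra ω) (b : Bool) :
    ComputableStr mm len 2 fun ω => (ι ω).chosen b := by
  cases b
  · exact computableStr_v₀ hlen x ι extra hmm
  · exact computableStr_v₁ hlen x ι extra hmm

theorem computable_sameLen
    (hlen : ∀ ω, (mm ω).length = len) (x : Bits l) (ι : Ω → RedState l s₀ s₁ R)
    (extra : Ω → List Bool) (hmm : ∀ ω, mm ω = (ι ω).mem x ++ extra ω) (hK : 2 ≤ K)
    (hs₀ : s₀ ≤ K) (hs₁ : s₁ ≤ K) : Computable mm len (100 * K ^ 2) fun ω => (ι ω).sameLen := by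
  have h0 := computableStr_v₀ hlen x ι extra hmm
  have h1 := computableStr_v₁ hlen x ι extra hmm
  refine ((Computable.forall_lt hlen K (c := 44 * K)
    (φ := fun i ω => decide (i < (decodeStr (ι ω).v₀).length) ==
      decide (i < (decodeStr (ι ω).v₁).length)) fun i hi =>
      (((computable_lt_decode h0 (fun ω => (ι ω).len₀) i).beq
        (computable_lt_decode h1 (fun ω => (ι ω).len₁) i)).mono ?_)).mono ?_).congr fun ω => ?_
  · omega
  · nlinarith
  · have hl0 := length_decodeStr_le (ι ω).v₀
    have hl1 := length_decodeStr_le (ι ω).v₁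
    rw [(ι ω).len₀] at hl0
    rw [(ι ω).len₁] at hl1
    simp only [beq_iff_eq, sameLen, decide_eq_decide]
    rw [length_eq_iff _ _ K (by omega) (by omega)]
    simp

theorem computableStr_challenge
    (hlen : ∀ ω, (mm ω).length = len) (x : Bits l) (ι : Ω → RedState l s₀ s₁ R)
    (extra : Ω → List Bool) (hmm : ∀ ω, mm ω = (ι ω).mem x ++ extra ω) (hK : 2 ≤ K) (hlK : l ≤ K)
    (hs₀ : s₀ ≤ K) (hs₁ : s₁ ≤ K) (hRK : R ≤ K) (b : Bool) (C : BoolCircuit) (hCK : C.size ≤ K) :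
    ComputableStr mm len (8 * K) fun ω =>
      ctCode C x (if b then s₁ else s₀) (List.ofFn (ι ω).y) ((ι ω).chosen b) (ι ω).r :=
  computableStr_ctCode C x (computableStr_y hlen x ι extra hmm)
    (computableStr_chosen hlen x ι extra hmm b) (computableStr_r hlen x ι extra hmm)
    (fun ω => by simp) (fun ω => (ι ω).chosen_length b) (fun ω => (ι ω).lenr) hK hlK
    (by split_ifs <;> assumption) hRK hCK

/-- The test whether the ciphertext in a register is the challenge ciphertext. -/
theorem computable_forb
    (hlen : ∀ ω, (mm ω).length = len) (x : Bits l) (ι : Ω → RedState l s₀ s₁ R)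
    (extra : Ω → List Bool) (hmm : ∀ ω, mm ω = (ι ω).mem x ++ extra ω) (hK : 2 ≤ K) (hlK : l ≤ K)
    (hs₀ : s₀ ≤ K) (hs₁ : s₁ ≤ K) (hRK : R ≤ K) (S : SKE) (b : Bool) (C : BoolCircuit)
    (hCK : C.size ≤ K)
    (hC : IsEncCircuit S l ((if b then s₁ else s₀) / 2) R C) {v : Ω → List Bool} {s : ℕ}
    (hv : ComputableStr mm len 2 v) (hvl : ∀ ω, (v ω).length = s) (hsK : s ≤ K) :
    Computable mm len (900 * K ^ 2) fun ω =>
      decide (some (decodeStr (v ω)) = (ι ω).forb S x b) := by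
  have hch := computableStr_challenge hlen x ι extra hmm hK hlK hs₀ hs₁ hRK b C hCK
  -- The shift by one skips the leading flag with which `encodeAns` marks a string.
  have hbits : ∀ i ω, (ctCode C x (if b then s₁ else s₀) (List.ofFn (ι ω).y) ((ι ω).chosen b)
      (ι ω).r).getD (1 + i) false = (encodeStr ((ι ω).ct S x b)).getD i false := by
    intro i ω
    rw [ctCode_getD S hC x _ _ _ ((ι ω).chosen_length b) (ι ω).lenr, encodeAns, add_comm]
    rfl
  have hlt : ∀ i < 3 * K, Computable mm len (15 * K)
      fun ω => decide (i < (decodeStr (v ω)).length) := fun i hi =>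
    (computable_lt_decode hv hvl i).mono (by omega)
  have hget : ∀ i < 3 * K, Computable mm len (40 * K)
      fun ω => (decodeStr (v ω)).getD i false := fun i hi =>
    (((hlt i hi).ite (hv (2 * i + 1)) (Computable.const hlen false)).mono (by omega)).congr
      fun ω => by
        by_cases h : i < (decodeStr (v ω)).length
        · rw [if_pos (by simpa using h), getD_decodeStr _ _ h]
        · rw [if_neg (by simpa using h), List.getD_eq_default _ _ (by omega)]
  have heq : Computable mm len (3 * K * (180 * K + 2) + 2) fun ω =>
      decide (decodeStr (v ω) = (ι ω).ct S x b) := by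
    refine (Computable.forall_lt hlen (3 * K) (φ := fun i ω =>
      (decide (i < (decodeStr (v ω)).length) == (ctCode C x (if b then s₁ else s₀)
        (List.ofFn (ι ω).y) ((ι ω).chosen b) (ι ω).r).getD (1 + 2 * i) false) &&
      ((decodeStr (v ω)).getD i false == (ctCode C x (if b then s₁ else s₀)
        (List.ofFn (ι ω).y) ((ι ω).chosen b) (ι ω).r).getD (1 + (2 * i + 1)) false))
      fun i hi => (((hlt i hi).beq (hch _)).and ((hget i hi).beq (hch _))).mono
        (by omega)).congr fun ω => ?_
    have hl0 := length_decodeStr_le (v ω)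
    rw [hvl] at hl0
    have hl1 : ((ι ω).ct S x b).length ≤ 3 * K := by
      have h1 := (hC.2 (ι ω).y (((ι ω).chosen b).take (2 * ((if b then s₁ else s₀) / 2))) (ι ω).r
        (by rw [List.length_take, chosen_length]; omega) (ι ω).lenr).length_le
      have h2 : decodeStr (((ι ω).chosen b).take (2 * ((if b then s₁ else s₀) / 2))) =
          decodeStr ((ι ω).chosen b) := by
        rw [← (ι ω).chosen_length b]; exact decodeStr_take _
      rw [h2, length_encodeStr] at h1
      rw [ct, List.length_append, List.length_ofFn]
      omega
    rw [decide_eq_decide, eq_iff_getD _ _ (3 * K) (by omega) hl1]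
    simp only [hbits, getD_encodeStr_even, getD_encodeStr_odd, Bool.and_eq_true, beq_iff_eq]
  refine ((((computable_flag hlen x ι extra hmm).and
    (computable_sameLen hlen x ι extra hmm hK hs₀ hs₁)).and heq).mono ?_).congr fun ω => ?_
  · nlinarith
  · rw [forb]
    by_cases h : ((ι ω).flag && (ι ω).sameLen) = true
    · rw [if_pos h, h, Bool.true_and]
      simp
    · rw [if_neg h, Bool.eq_false_of_not_eq_true h]
      simp

end

end RedState

/-! ### Averages over coins -/

theorem avg_const {α : Type} [Fintype α] [Nonempty α] (c : ℝ) : avg (fun _ : α => c) = c := by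
  rw [avg, Finset.sum_const, Finset.card_univ, nsmul_eq_mul,
    mul_div_cancel_left₀ _ (Nat.cast_ne_zero.2 Fintype.card_ne_zero)]

/-- Only the first `c` coins are used. -/
theorem avg_take {c R : ℕ} (h : c ≤ R) (F : List Bool → ℝ) :
    avg (fun r : Bits R => F ((List.ofFn r).take c)) = avg fun r : Bits c => F (List.ofFn r) := by
  induction c generalizing R F with
  | zero =>
    simp only [List.take_zero, List.ofFn_zero, avg_const]
  | succ c ih =>
    obtain ⟨R, rfl⟩ : ∃ R', R = R' + 1 := ⟨R - 1, by omega⟩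
    rw [avg_bits_succ, avg_bits_succ]
    congr 1
    refine Finset.sum_congr rfl fun b _ => ?_
    simp only [List.ofFn_cons, List.take_succ_cons]
    exact ih (by omega) fun s => F (b :: s)

/-! ### Preparing a public key next to a memory -/

/-- Here `D₂` is any implementation of the superposition query to `g`: the oracle itself, or a
reversible circuit. The preparation before it makes no queries, hence the query type `Empty`. -/
theorem exists_prepare {n m l : ℕ} {Q : Type} (qsize : Q → ℕ) (tgt : Fin l ⊕ Fin l ↪ Fin n)
    (D₂ : List (Op (n + m) Q)) : ∃ D : List (Op (n + m) Q),
      sizeOps qsize D ≤ 3 * l + sizeOps qsize D₂ ∧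
      ∀ (ans : Q → St (n + m) ℂ → (St (n + m) ℂ → ℝ) → ℝ), (∀ q, IsChannel (ans q)) →
      ∀ (g : Bits l → Bits l) (mem : List Bool),
      (∀ ψ k, Op.run ans D₂ (emb m mem ψ) k = k (emb m mem (oracleAct g tgt ψ))) →
      ∀ ψ k, QuadHom k → Op.run ans D (emb m mem ψ) k =
        prepare (graphState g) tgt ψ fun φ => k (emb m mem φ) := by
  obtain ⟨D, hD, hsim⟩ := exists_simulation (n := n) (m := m) (Q := Empty)
    (I := {ans : Q → St (n + m) ℂ → (St (n + m) ℂ → ℝ) → ℝ // ∀ q, IsChannel (ans q)} × List Bool)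
    qsize (fun i => i.2) (fun i => i.1.1) (fun _ q => q.elim) (fun i => i.1.2) 1 le_rfl
    (prepOps Empty tgt) (fun q => q.elim)
  refine ⟨D ++ D₂, ?_, fun ans hans g mem h₂ ψ k hk => ?_⟩
  · have h1 := length_le_sizeOps (fun _ : Empty => 0) (prepOps Empty tgt)
    rw [sizeOps_prepOps] at h1
    rw [sizeOps_append]
    omega
  · rw [run_append, hsim ⟨⟨ans, hans⟩, mem⟩ ψ _ ((isChannel_run hans D₂).hom hk)]
    simp only [h₂]
    exact run_prepOps _ g tgt ψ fun φ => k (emb m mem φ)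

/-! ### Answering the queries with an oracle for the function -/

section PRF

variable {n m l s₀ s₁ R T K : ℕ}

theorem exists_qpk_prf (tgt : Fin l ⊕ Fin l ↪ Fin n) :
    ∃ D : List (Op (n + m) (PRFQuery l (n + m))), sizeOps (fun _ => 2 * l) D ≤ 5 * l + 1 ∧
      ∀ (g : Bits l → Bits l) (mem : List Bool) ψ k, QuadHom k →
        Op.run (prfAns g) D (emb m mem ψ) k =
          prepare (graphState g) tgt ψ fun φ => k (emb m mem φ) := by
  obtain ⟨D, hD, hsim⟩ := exists_prepare (fun _ : PRFQuery l (n + m) => 2 * l) tgt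
    [Op.query (tgt.trans (Fin.castAddEmb m))]
  refine ⟨D, ?_, fun g mem ψ k hk => hsim _ (isChannel_prfAns g) g mem (fun ψ k => ?_) ψ k hk⟩
  · simp [sizeOps, Op.size] at hD ⊢
    omega
  · rw [← oracleAct_emb]
    rfl

/-- The reduction knows the key `y`, so it encrypts by itself: record the plaintext, toss `R'`
coins, evaluate the circuit, clear the scratch space. Surplus coins are averaged away by `avg_take`.
-/
theorem exists_enc_prf (S : SKE) (hc : HasCircuits S l T K) (x : Bits l)
    (hs₀ : s₀ ≤ K) (hs₁ : s₁ ≤ K) (hR : R ≤ K) (hm : 2000 * K ^ 3 ≤ m)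
    (inp out : List (Fin n)) (hinp : inp.length ≤ T) (hout : out.length ≤ T) :
    ∃ D : List (Op (n + m) (PRFQuery l (n + m))), sizeOps (fun _ => 2 * l) D ≤ 4000 * K ^ 3 + m ∧
      ∀ (i : RedState l s₀ s₁ R) ψ k, QuadHom k → Op.run (prfAns i.g) D (emb m (i.mem x) ψ) k =
        measure inp ψ fun v φ => S.encAvg i.y (decodeStr v) fun c =>
          k (emb m (i.mem x) (xorInto out (encodeAns (some (List.ofFn x ++ c))) φ)) := by
  obtain ⟨h2, hlK, hTK, henc, -⟩ := hc
  obtain ⟨R', C, hR', hCK, hC⟩ := henc (inp.length / 2) (by omega)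
  set Lb := 2 * l + 1 + s₀ + s₁ + R with hLb
  let Ω : Type := {ω : RedState l s₀ s₁ R × List Bool × List Bool //
    ω.2.1.length = inp.length ∧ ω.2.2.length = R'}
  have hlen : ∀ ω : Ω, (ω.1.1.mem x ++ (ω.1.2.1 ++ ω.1.2.2)).length = Lb + inp.length + R' := by
    intro ω
    simp only [List.length_append, RedState.mem_length, ω.2.1, ω.2.2]
    omega
  have hcomp := computableStr_ctCode C x
    (RedState.computableStr_y hlen x (fun ω : Ω => ω.1.1) (fun ω => ω.1.2.1 ++ ω.1.2.2)
      fun ω => rfl)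
    (ComputableStr.of_append hlen (off := Lb) (a := inp.length) (pre := fun ω => ω.1.1.mem x)
      (s := fun ω => ω.1.2.1) (post := fun ω => ω.1.2.2) (fun ω => rfl)
      (fun ω => RedState.mem_length x ω.1.1) fun ω => ω.2.1)
    (ComputableStr.of_append hlen (off := Lb + inp.length) (a := R')
      (pre := fun ω => ω.1.1.mem x ++ ω.1.2.1)
      (s := fun ω => ω.1.2.2) (post := fun ω => []) (fun ω => by simp)
      (fun ω => by rw [List.length_append, RedState.mem_length, ω.2.1]) fun ω => ω.2.2)
    (fun ω => by simp) (fun ω => ω.2.1) (fun ω => ω.2.2) h2 hlK (by omega) hR' hCK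
  obtain ⟨C', hg, hC'⟩ := hcomp.exists_circuit out.length
  have hK3 : 4 * K ≤ K ^ 3 := by nlinarith [Nat.mul_le_mul h2 h2]
  have hg' : C'.gates.length ≤ 8 * K ^ 3 := by
    refine hg.trans ((Nat.mul_le_mul_right _ (hout.trans hTK)).trans ?_)
    nlinarith
  refine ⟨pushReg n m _ Lb inp ++ (coinOps n m _ (Lb + inp.length) R' ++
    computeOps n m _ Lb (Lb + inp.length + R') C' out), ?_, fun i ψ k hk => ?_⟩
  · rw [sizeOps_append, sizeOps_append]
    have e1 := sizeOps_pushReg (n := n) (m := m) (fun _ : PRFQuery l (n + m) => 2 * l) Lb inp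
    have e2 := sizeOps_coinOps (n := n) (m := m) (fun _ : PRFQuery l (n + m) => 2 * l)
      (Lb + inp.length) R'
    have e3 := sizeOps_computeOps (n := n) (m := m) (fun _ : PRFQuery l (n + m) => 2 * l)
      Lb (Lb + inp.length + R') C' out
    omega
  · have hans := isChannel_prfAns (n := n + m) i.g
    have hL : (i.mem x).length = Lb := i.mem_length x
    have e1 := run_pushReg (prfAns i.g) (i.mem x) inp (by rw [hL]; omega) ψ
      ((isChannel_run hans (coinOps n m _ (Lb + inp.length) R' ++
        computeOps n m _ Lb (Lb + inp.length + R') C' out)).hom hk)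
    rw [hL] at e1
    rw [run_append, e1]
    refine measure_congr _ _ fun v φ hv _ => ?_
    have hL2 : (i.mem x ++ v).length = Lb + inp.length := by rw [List.length_append, hL, hv]
    have e2 := run_coinOps hans (i.mem x ++ v) R' (by rw [hL2]; omega) φ
      ((isChannel_run hans (computeOps n m _ Lb (Lb + inp.length + R') C' out)).hom hk)
    rw [hL2] at e2
    rw [run_append, e2]
    have hcoin : S.coins l (decodeStr v).length ≤ R' := by
      refine hC.1 _ ?_
      have := length_decodeStr_le v
      omega
    rw [SKE.encAvg, ← avg_take hcoin fun r => k (emb m (i.mem x) (xorInto out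
      (encodeAns (some (List.ofFn x ++ S.enc l i.y (decodeStr v) r))) φ))]
    refine congrArg avg (funext fun r => ?_)
    rw [List.append_assoc]
    refine run_computeOps _ C' (i.mem x) (v ++ List.ofFn r) Lb _ hL (by simp [hL, hv]; ring)
      (by omega) out _ (fun j hj => ?_) φ hk
    have e3 := hC' ⟨(i, v, List.ofFn r), hv, by simp⟩ j hj
    rw [e3]
    exact ctCode_getD S hC x i.y v (List.ofFn r) hv (by simp) j

end PRF

section PRF

variable {n m l s₀ s₁ R T K : ℕ}

/-- The value of `Function.update g x y` at the first component of a ciphertext, and decryption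
under it. -/
theorem decAnswer_getD (S : SKE) (g : Bits l → Bits l) (x y : Bits l) (s : ℕ) (v : List Bool)
    (hv : v.length = s) (C : BoolCircuit) (hC : IsDecCircuit S l ((s - 2 * l) / 2) C)
    (forb : Option (List Bool)) (i : ℕ) :
    (if (decide (l ≤ (decodeStr v).length) && !decide (some (decodeStr v) = forb)) = true then
      C.eval ((if decide (cellBits l v = x) = true then List.ofFn y else
        List.ofFn (g (cellBits l v))) ++ (v.drop (2 * l)).take (2 * ((s - 2 * l) / 2)))
      else []).getD i false =
    (encodeAns (decExcept forb none (keyDec S (Function.update g x y))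
      (decodeStr v))).getD i false := by
  rw [decExcept]
  by_cases hf : some (decodeStr v) = forb
  · simp [hf, encodeAns]
  rw [if_neg hf]
  by_cases hl : l ≤ (decodeStr v).length
  · have h1 : (if decide (cellBits l v = x) = true then List.ofFn y else
        List.ofFn (g (cellBits l v))) = List.ofFn (Function.update g x y (cellBits l v)) := by
      by_cases hx : cellBits l v = x
      · simp [hx]
      · simp [hx]
    rw [if_pos (by simp [hl, hf]), h1, keyDec_decodeStr S _ v hl,
      ← decodeStr_drop_take v s l hv]
    refine (hC _ _ ?_).getD i
    rw [List.length_take, List.length_drop, hv]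
    omega
  · rw [if_neg (by simp [hl]), keyDec, if_pos (by omega)]
    rfl

/-- One query gives `g` at the first component of the ciphertext, replaced by `y` if that component
is `x`. The query is made even for strings that are too short or forbidden; the circuit then ignores
its answer. -/
theorem exists_dec_prf (S : SKE) (hc : HasCircuits S l T K) (x : Bits l) (b : Bool)
    (hs₀ : s₀ ≤ K) (hs₁ : s₁ ≤ K) (hR : R ≤ K) (C₀ : BoolCircuit) (hC₀K : C₀.size ≤ K)
    (hC₀ : IsEncCircuit S l ((if b then s₁ else s₀) / 2) R C₀) (hm : 2000 * K ^ 3 ≤ m)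
    (inp out : List (Fin n)) (hinp : inp.length ≤ T) (hout : out.length ≤ T) :
    ∃ D : List (Op (n + m) (PRFQuery l (n + m))), sizeOps (fun _ => 2 * l) D ≤ 4000 * K ^ 3 + m ∧
      ∀ (i : RedState l s₀ s₁ R) ψ k, QuadHom k → Op.run (prfAns i.g) D (emb m (i.mem x) ψ) k =
        measure inp ψ fun v φ => k (emb m (i.mem x) (xorInto out (encodeAns
          (decExcept (i.forb S x b) none (keyDec S (Function.update i.g x i.y))
            (decodeStr v))) φ)) := by
  obtain ⟨h2, hlK, hTK, -, hdec⟩ := hc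
  obtain ⟨C, hCK, hC⟩ := hdec ((inp.length - 2 * l) / 2) (by omega)
  set s := inp.length with hs
  set Lb := 2 * l + 1 + s₀ + s₁ + R with hLb
  let Ω : Type := {ω : RedState l s₀ s₁ R × List Bool // ω.2.length = s}
  let mm : Ω → List Bool := fun ω => ω.1.1.mem x ++ (ω.1.2 ++ (List.replicate (2 * l) false ++
    List.ofFn (ω.1.1.g (cellBits l ω.1.2))))
  have hlen : ∀ ω : Ω, (mm ω).length = Lb + s + 2 * l + l := by
    intro ω
    simp only [mm, List.length_append, RedState.mem_length, ω.2, List.length_replicate,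
      List.length_ofFn]
    omega
  have hv : ComputableStr mm (Lb + s + 2 * l + l) 2 fun ω => ω.1.2 :=
    ComputableStr.of_append hlen (off := Lb) (a := s) (fun ω => rfl)
      (fun ω => RedState.mem_length x ω.1.1) fun ω => ω.2
  have hz : ComputableStr mm (Lb + s + 2 * l + l) 2
      fun ω => List.ofFn (ω.1.1.g (cellBits l ω.1.2)) :=
    ComputableStr.of_append hlen (off := Lb + s + 2 * l) (a := l)
      (pre := fun ω => ω.1.1.mem x ++ (ω.1.2 ++ List.replicate (2 * l) false))
      (post := fun ω => []) (fun ω => by simp [mm])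
      (fun ω => by simp [RedState.mem_length, ω.2]; omega) fun ω => by simp
  have hy := RedState.computableStr_y hlen x (fun ω : Ω => ω.1.1) _ fun ω => rfl
  have hkey := ComputableStr.ite (computable_cellBits_eq hv x) hy hz
  have hdecs := (((hkey.append (((hv.drop (2 * l)).take le_rfl
    (2 * ((s - 2 * l) / 2))).mono (by omega)) (a := l)
      (fun ω => by split_ifs <;> simp)).eval (r := l + 2 * ((s - 2 * l) / 2)) (fun ω => by
        simp only [List.length_append, List.length_take, List.length_drop, ω.2]
        split_ifs <;> simp <;> omega) C))
  have hforb := RedState.computable_forb hlen x (fun ω : Ω => ω.1.1) _ (fun ω => rfl) h2 hlK hs₀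
    hs₁ hR S b C₀ hC₀K hC₀ hv (fun ω => ω.2) (by omega)
  have hok := (computable_le_decode hv (fun ω => ω.2) l).and hforb.not
  have hcomp := (ComputableStr.ite hok hdecs (ComputableStr.const hlen [])).mono
    (c₂ := 1950 * K ^ 2) (by
      have h3 : l * (2 * (l * 19 + 2) + 2 + 2 + 8) ≤ K * (38 * K + 16) :=
        Nat.mul_le_mul hlK (by omega)
      have h4 : 2 * ((s - 2 * l) / 2) * (2 * (l * 19 + 2) + 2 + 2 + 8) ≤ K * (38 * K + 16) :=
        Nat.mul_le_mul (by omega) (by omega)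
      have h5 : l * (l * 4 + 2 + 2) ≤ K * (4 * K + 4) := Nat.mul_le_mul hlK (by omega)
      rw [add_mul]
      nlinarith)
  obtain ⟨C', hg, hC'⟩ := hcomp.exists_circuit out.length
  have hK3 : 4 * K ≤ K ^ 3 := by nlinarith [Nat.mul_le_mul h2 h2]
  have hg' : C'.gates.length ≤ 1950 * K ^ 3 := by
    refine hg.trans ((Nat.mul_le_mul_right _ (hout.trans hTK)).trans (le_of_eq ?_))
    ring
  -- The argument is read in place: bit `i` of the first component is the second half of cell `i` of
  -- the recorded register.
  have hP : Function.Injective fun i : Fin l => Lb + (2 * (i : ℕ) + 1) := fun i j h => by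
    simp only at h
    exact Fin.ext (by omega)
  -- A gap of `2 * l` zero wires puts the target after all argument positions, even if the register
  -- has fewer than `l` cells.
  have hPt : ∀ i : Fin l, Lb + (2 * (i : ℕ) + 1) < Lb + s + 2 * l := fun i => by omega
  have hmq : Lb + s + 2 * l + l ≤ m := by omega
  refine ⟨pushReg n m _ Lb inp ++ (Op.query (memQuery n _ _ hP hPt hmq) ::
    computeOps n m _ Lb (Lb + s + 2 * l + l) C' out), ?_, fun i ψ k hk => ?_⟩
  · have e0 : ∀ (q : PRFQuery l (n + m)) (L : List (Op (n + m) (PRFQuery l (n + m)))),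
        sizeOps (fun _ => 2 * l) (Op.query q :: L) = 1 + 2 * l + sizeOps (fun _ => 2 * l) L :=
      fun q L => by simp [sizeOps, Op.size]
    rw [sizeOps_append, e0]
    have e1 := sizeOps_pushReg (n := n) (m := m) (fun _ : PRFQuery l (n + m) => 2 * l) Lb inp
    have e3 := sizeOps_computeOps (n := n) (m := m) (fun _ : PRFQuery l (n + m) => 2 * l)
      Lb (Lb + s + 2 * l + l) C' out
    omega
  · have hans := isChannel_prfAns (n := n + m) i.g
    have hL : (i.mem x).length = Lb := i.mem_length x
    have e1 := run_pushReg (prfAns i.g) (i.mem x) inp (by rw [hL]; omega) ψ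
      ((isChannel_run hans (Op.query (memQuery n _ _ hP hPt hmq) ::
        computeOps n m _ Lb (Lb + s + 2 * l + l) C' out)).hom hk)
    rw [hL] at e1
    rw [run_append, e1]
    refine measure_congr _ _ fun v φ hvs _ => ?_
    rw [← hs] at hvs
    have hL2 : (i.mem x ++ v ++ List.replicate (2 * l) false).length = Lb + s + 2 * l := by
      simp [hL, hvs]
      omega
    have e2 := prfAns_memQuery i.g (i.mem x ++ v ++ List.replicate (2 * l) false) _ hP
      (by rw [hL2]; exact hPt) (by rw [hL2]; exact hmq) φ
      (fun φ => Op.run (prfAns i.g) (computeOps n m _ Lb (Lb + s + 2 * l + l) C' out) φ k)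
    simp only [hL2] at e2
    rw [← emb_append_replicate _ (2 * l), Op.run, Op.step, e2]
    have hcell : (fun j : Fin l => (i.mem x ++ v ++ List.replicate (2 * l) false).getD
        (Lb + (2 * (j : ℕ) + 1)) false) = cellBits l v := by
      funext j
      rw [List.append_assoc, List.getD_append_right _ _ _ _ (by rw [hL]; omega), hL,
        Nat.add_sub_cancel_left, getD_append_zeros]
      rfl
    rw [hcell, List.append_assoc, List.append_assoc]
    refine run_computeOps _ C' (i.mem x) _ Lb _ hL (hlen ⟨(i, v), hvs⟩)
      (by omega) out _ (fun j hj => ?_) φ hk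
    exact (hC' ⟨(i, v), hvs⟩ j hj).trans (decAnswer_getD S i.g x i.y s v hvs C hC _ j)

end PRF

section PRF

variable {n m l s₀ s₁ R T K : ℕ}

/-- Simulating a stage of the game with the measured key `(x, y)`, given an oracle for `g`. -/
theorem exists_stage_prf (S : SKE) (hc : HasCircuits S l T K) (x : Bits l) (b : Bool)
    (hs₀ : s₀ ≤ K) (hs₁ : s₁ ≤ K) (hR : R ≤ K) (C₀ : BoolCircuit) (hC₀K : C₀.size ≤ K)
    (hC₀ : IsEncCircuit S l ((if b then s₁ else s₀) / 2) R C₀) (hm : 2000 * K ^ 3 ≤ m)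
    (ops : List (Op n (EOQuery (Fin l ⊕ Fin l) n))) (hops : sizeOps EOQuery.size ops ≤ T) :
    ∃ D : List (Op (n + m) (PRFQuery l (n + m))),
      sizeOps (fun _ => 2 * l) D ≤ K * (4000 * K ^ 3 + m) ∧
      ∀ (i : RedState l s₀ s₁ R) ψ k, QuadHom k → Op.run (prfAns i.g) D (emb m (i.mem x) ψ) k =
        Op.run (measuredAns S x i.y i.g (Function.update i.g x i.y) (i.forb S x b)) ops ψ
          fun φ => k (emb m (i.mem x) φ) := by
  have hK3 : 4 * K ≤ K ^ 3 := by nlinarith [Nat.mul_le_mul hc.two_le hc.two_le, hc.two_le]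
  have hl := hc.l_le
  have h2 := hc.two_le
  obtain ⟨D, hD, hsim⟩ := exists_simulation (n := n) (m := m) (fun _ => 2 * l)
    (RedState.mem (s₀ := s₀) (s₁ := s₁) (R := R) x) (fun i => prfAns i.g)
    (fun i => measuredAns S x i.y i.g (Function.update i.g x i.y) (i.forb S x b))
    (fun i => isChannel_prfAns i.g) (4000 * K ^ 3 + m) (by omega) ops fun q hq => by
      have hsz := (qsize_le_sizeOps EOQuery.size hq).trans hops
      cases q with
      | qpk tgt =>
        obtain ⟨D, hD, h⟩ := exists_qpk_prf (m := m) tgt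
        exact ⟨D, by omega, fun i ψ k hk => h i.g _ ψ k hk⟩
      | enc inp out =>
        simp only [EOQuery.size] at hsz
        exact exists_enc_prf S hc x hs₀ hs₁ hR hm inp out (by omega) (by omega)
      | dec inp out =>
        simp only [EOQuery.size] at hsz
        exact exists_dec_prf S hc x b hs₀ hs₁ hR C₀ hC₀K hC₀ hm inp out (by omega) (by omega)
  refine ⟨D, hD.trans (Nat.mul_le_mul_right _ ?_), hsim⟩
  exact ((length_le_sizeOps _ _).trans hops).trans hc.T_le

/-- Reading the challenge plaintexts and delivering the challenge ciphertext. -/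
theorem exists_challenge_prf (S : SKE) (hc : HasCircuits S l T K) (x : Bits l) (b : Bool)
    (msg₀ msg₁ chal : List (Fin n)) (h₀ : msg₀.length ≤ T) (h₁ : msg₁.length ≤ T)
    (hchal : chal.length ≤ T) (hR : R ≤ K) (C₀ : BoolCircuit) (hC₀K : C₀.size ≤ K)
    (hC₀ : IsEncCircuit S l ((if b then msg₁.length else msg₀.length) / 2) R C₀)
    (hm : 2000 * K ^ 3 ≤ m) :
    ∃ D : List (Op (n + m) (PRFQuery l (n + m))),
      sizeOps (fun _ => 2 * l) D ≤ 4000 * K ^ 3 + m ∧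
      ∀ (g : Bits l → Bits l) (y : Bits l) ψ (k : St (n + m) ℂ → ℝ)
        (F : Option (List Bool) → St n ℂ → ℝ), QuadHom k →
        (∀ (i : RedState l msg₀.length msg₁.length R) φ, i.g = g → i.y = y →
          k (emb m (i.mem x) φ) = F (i.forb S x b) φ) →
        Op.run (prfAns g) D (emb m (List.ofFn x ++ List.ofFn y) ψ) k =
          measure msg₀ ψ fun v₀ ψ₀ => measure msg₁ ψ₀ fun v₁ ψ₁ =>
            if (decodeStr v₀).length = (decodeStr v₁).length then
              S.encAvg y (decodeStr (if b then v₁ else v₀)) fun c =>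
                F (some (List.ofFn x ++ c)) (xorInto chal (encodeAns (some (List.ofFn x ++ c))) ψ₁)
            else F none (xorInto chal (encodeAns none) ψ₁) := by
  obtain ⟨h2, hlK, hTK, -, -⟩ := hc
  have hK3 : 4 * K ≤ K ^ 3 := by nlinarith [Nat.mul_le_mul h2 h2]
  set s₀ := msg₀.length with hs₀
  set s₁ := msg₁.length with hs₁
  set Lb := 2 * l + 1 + s₀ + s₁ + R with hLb
  have hlen := RedState.mem_length (s₀ := s₀) (s₁ := s₁) (R := R) x
  have hmm : ∀ i : RedState l s₀ s₁ R, i.mem x = i.mem x ++ [] := fun i => by simp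
  have hcomp := (ComputableStr.ite
    (RedState.computable_sameLen hlen x id (fun _ => []) hmm h2 (by omega) (by omega))
    (RedState.computableStr_challenge hlen x id (fun _ => []) hmm h2 hlK (by omega) (by omega) hR b
      C₀ hC₀K) (ComputableStr.const hlen [])).mono (c₂ := 210 * K ^ 2) (by nlinarith)
  obtain ⟨C', hg, hC'⟩ := hcomp.exists_circuit chal.length
  have hg' : C'.gates.length ≤ 210 * K ^ 3 := by
    refine hg.trans ((Nat.mul_le_mul_right _ (hchal.trans hTK)).trans (le_of_eq ?_))
    ring
  let D₄ := computeOps n m (PRFQuery l (n + m)) Lb Lb C' chal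
  let D₃ := coinOps n m (PRFQuery l (n + m)) (2 * l + 1 + s₀ + s₁) R ++ D₄
  let D₂ := pushReg n m (PRFQuery l (n + m)) (2 * l + 1 + s₀) msg₁ ++ D₃
  let D₁ := pushReg n m (PRFQuery l (n + m)) (2 * l + 1) msg₀ ++ D₂
  -- Position `2 * l`, right after `x` and `y`, is the flag that switches on the forbidden
  -- ciphertext.
  refine ⟨constOps n m _ (2 * l) [true] ++ D₁, ?_, fun g y ψ k F hk hF => ?_⟩
  · simp only [D₁, D₂, D₃, D₄, sizeOps_append]
    have e0 := sizeOps_constOps (n := n) (m := m) (fun _ : PRFQuery l (n + m) => 2 * l)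
      (2 * l) [true]
    have e1 := sizeOps_pushReg (n := n) (m := m) (fun _ : PRFQuery l (n + m) => 2 * l)
      (2 * l + 1) msg₀
    have e2 := sizeOps_pushReg (n := n) (m := m) (fun _ : PRFQuery l (n + m) => 2 * l)
      (2 * l + 1 + s₀) msg₁
    have e3 := sizeOps_coinOps (n := n) (m := m) (fun _ : PRFQuery l (n + m) => 2 * l)
      (2 * l + 1 + s₀ + s₁) R
    have e4 := sizeOps_computeOps (n := n) (m := m) (fun _ : PRFQuery l (n + m) => 2 * l)
      Lb Lb C' chal
    simp only [List.length_singleton] at e0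
    omega
  have hans := isChannel_prfAns (n := n + m) g
  have hL0 : (List.ofFn x ++ List.ofFn y).length = 2 * l := by simp; ring
  have e0 := act_constOps (n := n) (m := m) (Q := PRFQuery l (n + m))
    (List.ofFn x ++ List.ofFn y) [true] (by simp only [hL0, List.length_singleton]; omega) ψ
  rw [hL0] at e0
  rw [run_append, run_perm _ _ (constOps_isPerm _ _), e0]
  have hL1 : (List.ofFn x ++ List.ofFn y ++ [true]).length = 2 * l + 1 := by
    rw [List.length_append, hL0]; rfl
  have e1 := run_pushReg (prfAns g) (List.ofFn x ++ List.ofFn y ++ [true]) msg₀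
    (by rw [hL1]; omega) ψ ((isChannel_run hans D₂).hom hk)
  rw [hL1] at e1
  simp only [D₁]
  rw [run_append, e1]
  refine measure_congr _ _ fun v₀ ψ₀ hv₀ _ => ?_
  have hL2 : (List.ofFn x ++ List.ofFn y ++ [true] ++ v₀).length = 2 * l + 1 + s₀ := by
    rw [List.length_append, hL1, hv₀]
  have e2 := run_pushReg (prfAns g) (List.ofFn x ++ List.ofFn y ++ [true] ++ v₀) msg₁
    (by rw [hL2]; omega) ψ₀ ((isChannel_run hans D₃).hom hk)
  rw [hL2] at e2
  simp only [D₂]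
  rw [run_append, e2]
  refine measure_congr _ _ fun v₁ ψ₁ hv₁ _ => ?_
  have hL3 : (List.ofFn x ++ List.ofFn y ++ [true] ++ v₀ ++ v₁).length =
      2 * l + 1 + s₀ + s₁ := by
    rw [List.length_append, hL2, hv₁]
  have e3 := run_coinOps hans (List.ofFn x ++ List.ofFn y ++ [true] ++ v₀ ++ v₁) R
    (by rw [hL3]; omega) ψ₁ ((isChannel_run hans D₄).hom hk)
  rw [hL3] at e3
  simp only [D₃]
  rw [run_append, e3]
  let ι : Bits R → RedState l s₀ s₁ R := fun r =>
    ⟨g, y, true, v₀, v₁, List.ofFn r, hv₀, hv₁, by simp⟩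
  have hι : ∀ r, List.ofFn x ++ List.ofFn y ++ [true] ++ v₀ ++ v₁ ++ List.ofFn r =
      (ι r).mem x := fun r => by simp [RedState.mem, ι]
  have hch : ∀ r, (ι r).chosen b = if b then v₁ else v₀ := fun r => rfl
  have hcoin : S.coins l (decodeStr (if b then v₁ else v₀)).length ≤ R := by
    refine hC₀.1 _ ?_
    have h1 := length_decodeStr_le v₁
    have h0 := length_decodeStr_le v₀
    cases b
    · simp only [Bool.false_eq_true, if_false]; omega
    · simp only [if_true]; omega
  have hfin : ∀ r s, (∀ j, (if (ι r).sameLen = true then ctCode C₀ x (if b then s₁ else s₀)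
      (List.ofFn y) ((ι r).chosen b) (List.ofFn r) else []).getD j false = s.getD j false) →
      Op.run (prfAns g) D₄ (emb m (List.ofFn x ++ List.ofFn y ++ [true] ++ v₀ ++ v₁ ++ List.ofFn r)
        ψ₁) k = F ((ι r).forb S x b) (xorInto chal s ψ₁) := by
    intro r s hs
    rw [hι, ← hF (ι r) _ rfl rfl]
    have e4 := run_computeOps (prfAns g) C' ((ι r).mem x) [] Lb Lb (hlen _) (by simp [hlen]; rfl)
      (by omega) chal s (fun j hj => ?_) ψ₁ hk
    · rwa [List.append_nil] at e4
    · rw [List.append_nil, hC' (ι r) j hj]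
      exact hs j
  by_cases hsl : (decodeStr v₀).length = (decodeStr v₁).length
  · rw [if_pos hsl, SKE.encAvg, ← avg_take hcoin fun r => F (some (List.ofFn x ++
      S.enc l y (decodeStr (if b then v₁ else v₀)) r))
      (xorInto chal (encodeAns (some (List.ofFn x ++
      S.enc l y (decodeStr (if b then v₁ else v₀)) r))) ψ₁)]
    refine congrArg avg (funext fun r => ?_)
    have hsame : (ι r).sameLen = true := by simpa [RedState.sameLen, ι] using hsl
    rw [hfin r (encodeAns (some ((ι r).ct S x b))) fun j => ?_]
    · rw [RedState.forb, if_pos (by rw [hsame]; rfl)]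
      rfl
    · rw [if_pos hsame]
      exact ctCode_getD S hC₀ x y _ _ ((ι r).chosen_length b) (by simp) j
  -- The coins are tossed also for plaintexts of different lengths; the answer does not depend on
  -- them.
  · rw [if_neg hsl, ← avg_const (α := Bits R) (F none _)]
    refine congrArg avg (funext fun r => ?_)
    have hsame : (ι r).sameLen = false := by simpa [RedState.sameLen, ι] using hsl
    rw [hfin r (encodeAns none) fun j => ?_]
    · rw [RedState.forb, if_neg (by rw [hsame]; simp)]
    · rw [if_neg (by rw [hsame]; simp)]
      rfl

end PRF

/-! ### The distinguishers against the pseudorandom function -/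

section PRF

variable {l K : ℕ}

theorem outProb_flip {n : ℕ} {Q : Type} (ans : Q → St n ℂ → (St n ℂ → ℝ) → ℝ) (out : Fin n)
    (b : Bool) (ψ : St n ℂ) :
    Op.run ans (if b then [] else [Op.x out]) ψ (outProb out true) = outProb out b ψ := by
  cases b
  · simp only [Bool.false_eq_true, if_false, Op.run, Op.step, outProb]
    rw [← Equiv.sum_comp (flip_involutive out).toPerm]
    refine Finset.sum_congr rfl fun w _ => ?_
    simp only [Function.Involutive.coe_toPerm, Function.update_self, Function.update_idem,
      Bool.not_not, Function.update_eq_self]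
    cases w out <;> simp
  · rfl

/-- Running the game with the measured key `(x, y)`, given an oracle for `g` and `(x, y)` in
memory. -/
theorem exists_game_prf (S : SKE) (A : TwoStageAdversary (EOQuery (Fin l ⊕ Fin l)))
    (hc : HasCircuits S l (A.size fun _ => EOQuery.size) K) (x : Bits l) (b : Bool) :
    ∃ D : List (Op (A.n + 2000 * K ^ 3) (PRFQuery l (A.n + 2000 * K ^ 3))),
      sizeOps (fun _ => 2 * l) D ≤ 16000 * K ^ 4 ∧
      ∀ (g : Bits l → Bits l) (y : Bits l),
        Op.run (prfAns g) D (emb (2000 * K ^ 3) (List.ofFn x ++ List.ofFn y) (initSt 1))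
          (outProb (Fin.castAdd _ A.out) true) =
        measuredGuess S A x y g (Function.update g x y) b := by
  have h2 := hc.two_le
  set T := A.size fun _ => EOQuery.size with hT
  rw [TwoStageAdversary.size] at hT
  obtain ⟨R, C₀, hR, hC₀K, hC₀⟩ :=
    hc.enc ((if b then A.msg₁.length else A.msg₀.length) / 2) (by split_ifs <;> omega)
  have hTK := hc.T_le
  obtain ⟨D₁, hD₁, hsim₁⟩ := exists_stage_prf S hc x b (m := 2000 * K ^ 3)
    (s₀ := A.msg₀.length) (s₁ := A.msg₁.length) (by omega) (by omega) hR C₀ hC₀K hC₀ le_rfl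
    A.stage₁ (by omega)
  obtain ⟨D₂, hD₂, hsim₂⟩ := exists_stage_prf S hc x b (m := 2000 * K ^ 3)
    (s₀ := A.msg₀.length) (s₁ := A.msg₁.length) (by omega) (by omega) hR C₀ hC₀K hC₀ le_rfl
    A.stage₂ (by omega)
  obtain ⟨Dc, hDc, hchal⟩ := exists_challenge_prf S hc x b (m := 2000 * K ^ 3) A.msg₀ A.msg₁
    A.chal (by omega) (by omega) (by omega) hR C₀ hC₀K hC₀ le_rfl
  -- The final negation for `b = false` makes the output 1 exactly when the guess equals `b`.
  refine ⟨D₁ ++ (Dc ++ (D₂ ++ if b then [] else [Op.x (Fin.castAdd _ A.out)])), ?_,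
    fun g y => ?_⟩
  · have e : sizeOps (fun _ => 2 * l) (if b then [] else [Op.x (Fin.castAdd _ A.out)] :
        List (Op (A.n + 2000 * K ^ 3) (PRFQuery l (A.n + 2000 * K ^ 3)))) ≤ 1 := by
      cases b <;> simp [sizeOps, Op.size]
    simp only [sizeOps_append]
    have h3 : 1 ≤ K ^ 3 := Nat.one_le_pow _ _ (by omega)
    have h4 : K ^ 4 = K * K ^ 3 := by ring
    nlinarith
  · have hans := isChannel_prfAns (n := A.n + 2000 * K ^ 3) g
    let i₀ : RedState l A.msg₀.length A.msg₁.length R :=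
      ⟨g, y, false, List.replicate _ false, List.replicate _ false, List.replicate _ false,
        List.length_replicate, List.length_replicate, List.length_replicate⟩
    have hi₀ : ∀ ψ : St A.n ℂ, emb (2000 * K ^ 3) (i₀.mem x) ψ =
        emb (2000 * K ^ 3) (List.ofFn x ++ List.ofFn y) ψ := by
      intro ψ
      rw [← emb_append_replicate (List.ofFn x ++ List.ofFn y)
        (1 + (A.msg₀.length + (A.msg₁.length + R)))]
      congr 1
      simp only [RedState.mem, i₀, List.append_assoc, List.replicate_add]
      rfl
    have hk : QuadHom (outProb (Fin.castAdd (2000 * K ^ 3) A.out) b) :=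
      (isEffect_outProb _ _).hom
    have hk₂ := (isChannel_run hans D₂).hom hk
    have hflip := outProb_flip (prfAns g) (Fin.castAdd (2000 * K ^ 3) A.out) b
    rw [← hi₀, run_append]
    simp only [run_append, hflip]
    have e1 := hsim₁ i₀ (initSt 1) _ ((isChannel_run hans Dc).hom hk₂)
    refine e1.trans ?_
    have hforb : i₀.forb S x b = none := by simp [RedState.forb, i₀]
    rw [hforb, measuredGuess]
    refine congrArg _ (funext fun φ => ?_)
    rw [hi₀]
    refine hchal g y φ _ (fun forb φ => Op.run (measuredAns S x y g (Function.update g x y) forb)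
      A.stage₂ φ (outProb A.out b)) hk₂ fun i φ hg hy => ?_
    have e2 := hsim₂ i φ _ hk
    rw [hg, hy] at e2
    rw [e2]
    simp only [outProb_emb]

theorem sizeOps_query_cons {n : ℕ} {Q : Type} (qsize : Q → ℕ) (q : Q) (L : List (Op n Q)) :
    sizeOps qsize (Op.query q :: L) = 1 + qsize q + sizeOps qsize L := by
  simp [sizeOps, Op.size]

/-- The distinguisher that runs the game with the measured key `(x, g(x))`. -/
theorem exists_prfAdversary_query (S : SKE) (A : TwoStageAdversary (EOQuery (Fin l ⊕ Fin l)))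
    (hc : HasCircuits S l (A.size fun _ => EOQuery.size) K) (x : Bits l) (b : Bool) :
    ∃ B : PRFAdversary l, B.size ≤ 20000 * K ^ 4 ∧
      ∀ g, B.prob g = measuredGuess S A x (g x) g g b := by
  obtain ⟨D, hD, hrun⟩ := exists_game_prf S A hc x b
  have h2 := hc.two_le
  have hl := hc.l_le
  have hK3 : 4 * K ≤ K ^ 3 := by nlinarith [Nat.mul_le_mul h2 h2]
  have hK4 : 2 * K ^ 3 ≤ K ^ 4 := by nlinarith
  have hlen : (List.ofFn x).length = l := by simp
  have hP : Function.Injective fun i : Fin l => (i : ℕ) := Fin.val_injective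
  have hm : l + l ≤ 2000 * K ^ 3 := by omega
  refine ⟨⟨A.n + 2000 * K ^ 3, constOps _ _ _ 0 (List.ofFn x) ++
    (Op.query (memQuery A.n _ l hP (fun i => i.2) hm) :: D), Fin.castAdd _ A.out⟩, ?_, fun g => ?_⟩
  · have hn : A.n ≤ K := by
      have := hc.T_le
      simp only [TwoStageAdversary.size] at this
      omega
    have e := sizeOps_constOps (n := A.n) (m := 2000 * K ^ 3)
      (fun _ : PRFQuery l (A.n + 2000 * K ^ 3) => 2 * l) 0 (List.ofFn x)
    rw [hlen] at e
    simp only [PRFAdversary.size, sizeOps_append, sizeOps_query_cons]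
    omega
  · rw [PRFAdversary.prob, run_append, run_perm _ _ (constOps_isPerm _ _), ← emb_initSt]
    have e0 := act_constOps (n := A.n) (m := 2000 * K ^ 3)
      (Q := PRFQuery l (A.n + 2000 * K ^ 3)) [] (List.ofFn x) (by simp; omega) (initSt 1)
    rw [List.length_nil, List.nil_append] at e0
    rw [e0, Op.run, Op.step]
    have e1 := prfAns_memQuery g (List.ofFn x) _ hP (fun i => by simp) (by simpa using hm)
      (initSt 1 : St A.n ℂ)
      (fun φ => Op.run (prfAns g) D φ (outProb (Fin.castAdd _ A.out) true))
    simp only [hlen] at e1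
    rw [e1]
    have hx : (fun i : Fin l => (List.ofFn x).getD i false) = x := by funext i; simp
    -- With `y = g x` the reprogrammed function is `g` itself.
    rw [hx, hrun, Function.update_eq_self]

/-- The distinguisher that runs the game with the measured key `(x, y)`. -/
theorem exists_prfAdversary_const (S : SKE) (A : TwoStageAdversary (EOQuery (Fin l ⊕ Fin l)))
    (hc : HasCircuits S l (A.size fun _ => EOQuery.size) K) (x y : Bits l) (b : Bool) :
    ∃ B : PRFAdversary l, B.size ≤ 20000 * K ^ 4 ∧
      ∀ g, B.prob g = measuredGuess S A x y g (Function.update g x y) b := by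
  obtain ⟨D, hD, hrun⟩ := exists_game_prf S A hc x b
  have h2 := hc.two_le
  have hl := hc.l_le
  have hK3 : 4 * K ≤ K ^ 3 := by nlinarith [Nat.mul_le_mul h2 h2]
  have hK4 : 2 * K ^ 3 ≤ K ^ 4 := by nlinarith
  have hlen : (List.ofFn x ++ List.ofFn y).length = l + l := by simp
  refine ⟨⟨A.n + 2000 * K ^ 3, constOps _ _ _ 0 (List.ofFn x ++ List.ofFn y) ++ D,
    Fin.castAdd _ A.out⟩, ?_, fun g => ?_⟩
  · have hn : A.n ≤ K := by
      have := hc.T_le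
      simp only [TwoStageAdversary.size] at this
      omega
    have e := sizeOps_constOps (n := A.n) (m := 2000 * K ^ 3)
      (fun _ : PRFQuery l (A.n + 2000 * K ^ 3) => 2 * l) 0 (List.ofFn x ++ List.ofFn y)
    rw [hlen] at e
    simp only [PRFAdversary.size, sizeOps_append]
    omega
  · rw [PRFAdversary.prob, run_append, run_perm _ _ (constOps_isPerm _ _), ← emb_initSt]
    have e0 := act_constOps (n := A.n) (m := 2000 * K ^ 3)
      (Q := PRFQuery l (A.n + 2000 * K ^ 3)) [] (List.ofFn x ++ List.ofFn y)
      (by rw [hlen]; simp; omega) (initSt 1)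
    rw [List.length_nil, List.nil_append] at e0
    rw [e0, hrun]

end PRF

/-! ### The reduction to the symmetric-key scheme -/

section SKE

variable {n m l T K : ℕ}

theorem exists_emb_take (mem s : List Bool) (r : ℕ) : ∃ t : List Bool, t.length = r ∧
    (∀ j < r, t.getD j false = s.getD j false) ∧
    ∀ ψ : St n ℂ, emb m (mem ++ s.take r) ψ = emb m (mem ++ t) ψ := by
  refine ⟨s.take r ++ List.replicate (r - (s.take r).length) false, ?_, fun j hj => ?_,
    fun ψ => ?_⟩
  · simp only [List.length_append, List.length_take, List.length_replicate]
    omega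
  · rw [getD_append_zeros]
    simp [List.getD_eq_getElem?_getD, hj]
  · rw [← List.append_assoc, emb_append_replicate]

/-- The code of an answer with `x` put in front of it. -/
def consCode (x : Bits l) (t : List Bool) : List Bool :=
  if t.getD 0 false = true then [true] ++ (encodeStr (List.ofFn x) ++ t.drop 1) else []

/-- Putting `x` in front only moves the answer to the right, so the first `r` bits of the result
depend on the first `r` bits of the answer; truncation of the oracle's answer does no harm. -/
theorem consCode_getD (x : Bits l) (a : Option (List Bool)) (t : List Bool) (r : ℕ)
    (ht : ∀ j < r, t.getD j false = (encodeAns a).getD j false) (j : ℕ) (hj : j < r) :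
    (consCode x t).getD j false = (encodeAns (a.map (List.ofFn x ++ ·))).getD j false := by
  have h0 := ht 0 (by omega)
  cases a with
  | none =>
    rw [consCode, if_neg (by rw [h0]; simp [encodeAns])]
    rfl
  | some c =>
    rw [consCode, if_pos (by rw [h0]; simp [encodeAns]), Option.map_some, encodeAns,
      encodeStr_append, ← List.append_assoc,
      show true :: (encodeStr (List.ofFn x) ++ encodeStr c) =
        [true] ++ encodeStr (List.ofFn x) ++ encodeStr c from rfl]
    by_cases h : j < ([true] ++ encodeStr (List.ofFn x)).length
    · rw [List.getD_append _ _ _ _ h, List.getD_append _ _ _ _ h]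
    · rw [List.getD_append_right _ _ _ _ (by omega), List.getD_append_right _ _ _ _ (by omega)]
      simp only [List.length_append, List.length_singleton] at h ⊢
      set i := j - (1 + (encodeStr (List.ofFn x)).length) with hi
      have := ht (1 + i) (by omega)
      rw [encodeAns, add_comm, List.getD_cons_succ] at this
      rw [← this]
      simp [List.getD_eq_getElem?_getD, add_comm]

/-- Delivering an answer that is in the memory, with `x` put in front of it. -/
theorem exists_deliver {Q : Type} (qsize : Q → ℕ) (x : Bits l) (out : List (Fin n))
    (hr : 0 + out.length ≤ m) (hm : out.length + out.length * 16 ≤ m) :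
    ∃ D : List (Op (n + m) Q), sizeOps qsize D ≤ 33 * out.length + m ∧
      ∀ ans a ψ k, QuadHom k →
        Op.run ans D (xorInto (memRange n 0 out.length hr) (encodeAns a) (emb m [] ψ)) k =
          k (emb m [] (xorInto out (encodeAns (a.map (List.ofFn x ++ ·))) ψ)) := by
  let Ω : Type := {t : List Bool // t.length = out.length}
  have hlen : ∀ t : Ω, t.1.length = out.length := fun t => t.2
  have ht : ComputableStr (fun t : Ω => t.1) out.length 2 fun t => t.1 :=
    ComputableStr.slice hlen 0 out.length (by omega) fun t => by
      rw [List.drop_zero, List.take_of_length_le (hlen t).le]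
  have hcomp : ComputableStr (fun t : Ω => t.1) out.length 16 fun t => consCode x t.1 :=
    ComputableStr.ite (ht 0) ((ComputableStr.const hlen _).append
      ((ComputableStr.const hlen _).append (ht.drop 1) fun _ => rfl) fun _ => rfl)
      (ComputableStr.const hlen [])
  obtain ⟨C, hg, hC⟩ := hcomp.exists_circuit out.length
  refine ⟨computeOps n m Q 0 out.length C out, ?_, fun ans a ψ k hk => ?_⟩
  · have := sizeOps_computeOps (n := n) (m := m) qsize 0 out.length C out
    omega
  · obtain ⟨t, htl, htj, hemb⟩ := exists_emb_take (n := n) (m := m) [] (encodeAns a) out.length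
    have e := xorInto_memRange (n := n) [] (encodeAns a) out.length hr ψ
    rw [hemb] at e
    rw [show memRange n 0 out.length hr = memRange n ([] : List Bool).length out.length hr from rfl,
      e]
    exact run_computeOps ans C [] t 0 _ rfl htl (by omega) out _ (fun j hj =>
      (hC ⟨t, htl⟩ j hj).trans (consCode_getD x a t _ htj j hj)) ψ hk

/-- The secret key plays the role of `y`: the encryption oracle supplies the second component, and
the first is the hardwired `x`. -/
theorem exists_enc_ske (S : SKE) (hl : l ≤ K) (x : Bits l) (hm : 20 * K ≤ m)
    (inp out : List (Fin n)) (hinp : inp.length ≤ K) (hout : out.length ≤ K) :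
    ∃ D : List (Op (n + m) (SKEQuery (n + m))), sizeOps SKEQuery.size D ≤ 36 * K + m + 1 ∧
      ∀ (sk : Bits l) forb ψ k, QuadHom k → Op.run (S.ans sk forb) D (emb m [] ψ) k =
        measure inp ψ fun v φ => S.encAvg sk (decodeStr v) fun c =>
          k (emb m [] (xorInto out (encodeAns (some (List.ofFn x ++ c))) φ)) := by
  have hr : 0 + out.length ≤ m := by omega
  obtain ⟨D, hD, hrun⟩ := exists_deliver SKEQuery.size x out hr (by omega)
  refine ⟨Op.query (.enc (inp.map (Fin.castAdd m)) (memRange n 0 out.length hr)) :: D, ?_,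
    fun sk forb ψ k hk => ?_⟩
  · rw [sizeOps_query_cons, SKEQuery.size, List.length_map, memRange_length]
    omega
  · rw [Op.run, Op.step, SKE.ans, measure_emb]
    refine congrArg _ (funext fun v => funext fun φ => congrArg _ (funext fun c => ?_))
    exact hrun _ (some c) φ k hk

theorem decodeStr_eq_append (v : List Bool) (l : ℕ) (hl : l ≤ (decodeStr v).length) :
    decodeStr v = List.ofFn (cellBits l v) ++ decodeStr (v.drop (2 * l)) := by
  rw [← drop_decodeStr v l hl]
  conv_lhs => rw [← List.take_append_drop l (decodeStr v)]
  congr 1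
  refine List.ext_getElem (by simp [hl]) fun i h1 h2 => ?_
  simp only [List.length_ofFn] at h2
  have := getD_decodeStr v i (by omega)
  rw [List.getElem_take, List.getElem_ofFn, cellBits, ← this,
    List.getD_eq_getElem _ _ (by omega)]

/-- Decryption from an answer `t` of the decryption oracle for the key of `x`, and the function `g`
elsewhere. -/
theorem decAnswer_ske_getD (S : SKE) (g : Bits l → Bits l) (x sk : Bits l) (s : ℕ) (v t : List Bool)
    (hv : v.length = s) (C Cf : BoolCircuit) (pre : List Bool)
    (hCf : ∀ x : Bits l, Cf.eval (pre ++ List.ofFn x) = List.ofFn (g x))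
    (hC : IsDecCircuit S l ((s - 2 * l) / 2) C)
    (forb : Option (List Bool)) (r : ℕ)
    (ht : ∀ j < r, t.getD j false = (encodeAns (decExcept forb none (S.dec l sk)
      (decodeStr (v.drop (2 * l))))).getD j false) (i : ℕ) (hi : i < r) :
    (if decide (l ≤ (decodeStr v).length) = true then
      (if decide (cellBits l v = x) = true then t else
        C.eval (Cf.eval (pre ++ List.ofFn (cellBits l v)) ++
          (v.drop (2 * l)).take (2 * ((s - 2 * l) / 2))))
      else []).getD i false =
    (encodeAns (decExcept (forb.map (List.ofFn x ++ ·)) none (keyDec S (Function.update g x sk))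
      (decodeStr v))).getD i false := by
  by_cases hl : l ≤ (decodeStr v).length
  · rw [if_pos (by simpa using hl), decExcept, keyDec_decodeStr S _ v hl]
    have hd := decodeStr_eq_append v l hl
    by_cases hx : cellBits l v = x
    · rw [if_pos (by simpa using hx), ht i hi, hx, Function.update_self, decExcept]
      -- When the first component is `x`, the whole ciphertext is forbidden exactly if its second
      -- component is, so the `⊥` of the oracle is the right answer.
      have : some (decodeStr v) = forb.map (List.ofFn x ++ ·) ↔
          some (decodeStr (v.drop (2 * l))) = forb := by
        rw [hd, hx]
        cases forb <;> simp
      simp only [this]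
    -- A ciphertext with another first component is never the challenge, and is decrypted with the
    -- known function `g`.
    · rw [if_neg (by simpa using hx), Function.update_of_ne hx, if_neg, hCf,
        ← decodeStr_drop_take v s l hv]
      · refine (hC _ _ ?_).getD i
        rw [List.length_take, List.length_drop, hv]
        omega
      · rw [hd]
        cases forb with
        | none => simp
        | some c =>
          simp only [Option.map_some, Option.some.injEq]
          intro h
          exact hx (List.ofFn_injective (List.append_inj h (by simp)).1)
  · rw [if_neg (by simpa using hl), decExcept, keyDec, if_pos (not_le.1 hl), ite_self]
    rfl

/-- The decryption oracle is asked about the second component in every case, and its answer is used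
only if the first component is `x`. Otherwise the circuit computes the key with `Cf` and decrypts by
itself. -/
theorem exists_dec_ske (S : SKE) (hc : HasCircuits S l T K) (x : Bits l) (g : Bits l → Bits l)
    (Cf : BoolCircuit) (hCfK : Cf.size ≤ K) (pre : List Bool) (hpre : pre.length = l)
    (hCf : ∀ x : Bits l, Cf.eval (pre ++ List.ofFn x) = List.ofFn (g x))
    (hm : 200 * K ^ 3 ≤ m)
    (inp out : List (Fin n)) (hinp : inp.length ≤ T) (hout : out.length ≤ T) :
    ∃ D : List (Op (n + m) (SKEQuery (n + m))), sizeOps SKEQuery.size D ≤ 300 * K ^ 3 + m ∧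
      ∀ (sk : Bits l) forb ψ k, QuadHom k → Op.run (S.ans sk forb) D (emb m [] ψ) k =
        measure inp ψ fun v φ => k (emb m [] (xorInto out (encodeAns
          (decExcept (forb.map (List.ofFn x ++ ·)) none (keyDec S (Function.update g x sk))
            (decodeStr v))) φ)) := by
  obtain ⟨h2, hlK, hTK, -, hdec⟩ := hc
  obtain ⟨C, hCK, hC⟩ := hdec ((inp.length - 2 * l) / 2) (by omega)
  set s := inp.length with hs
  let Ω : Type := {ω : List Bool × List Bool // ω.1.length = s ∧ ω.2.length = out.length}
  have hlen : ∀ ω : Ω, (ω.1.1 ++ ω.1.2).length = s + out.length := fun ω => by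
    rw [List.length_append, ω.2.1, ω.2.2]
  have hv : ComputableStr (fun ω : Ω => ω.1.1 ++ ω.1.2) (s + out.length) 2 fun ω => ω.1.1 :=
    ComputableStr.of_append hlen (off := 0) (a := s) (pre := fun _ => []) (post := fun ω => ω.1.2)
      (fun ω => rfl) (fun ω => rfl) fun ω => ω.2.1
  have ht : ComputableStr (fun ω : Ω => ω.1.1 ++ ω.1.2) (s + out.length) 2 fun ω => ω.1.2 :=
    ComputableStr.of_append hlen (off := s) (a := out.length) (pre := fun ω => ω.1.1)
      (post := fun ω => []) (fun ω => by simp) (fun ω => ω.2.1) fun ω => ω.2.2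
  have hf := (((ComputableStr.const hlen pre).append (computableStr_cellBits hv l)
    fun _ => rfl).eval (r := l + l) (fun ω => by simp [hpre]) Cf).mono (c₂ := 6 * K) (by omega)
  have hdecs := (((hf.append (((hv.drop (2 * l)).take le_rfl
    (2 * ((s - 2 * l) / 2))).mono (by omega)) (a := l)
      (fun ω => by rw [hCf]; simp)).eval (r := l + 2 * ((s - 2 * l) / 2)) (fun ω => by
        simp only [List.length_append, List.length_take, List.length_drop, ω.2.1, hCf,
          List.length_ofFn]
        omega) C))
  have hcomp := (ComputableStr.ite (computable_le_decode hv (fun ω => ω.2.1) l)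
    (ComputableStr.ite (computable_cellBits_eq hv x) ht hdecs) (ComputableStr.const hlen [])).mono
    (c₂ := 100 * K ^ 2) (by
      have h3 : (l + 2 * ((s - 2 * l) / 2)) * (6 * K) ≤ (2 * K) * (6 * K) :=
        Nat.mul_le_mul_right _ (by omega)
      have h5 : l * (l * 4 + 2 + 2) ≤ K * (4 * K + 4) := Nat.mul_le_mul hlK (by omega)
      nlinarith)
  obtain ⟨C', hg, hC'⟩ := hcomp.exists_circuit out.length
  have hK3 : 4 * K ≤ K ^ 3 := by nlinarith [Nat.mul_le_mul h2 h2]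
  have hg' : C'.gates.length ≤ 100 * K ^ 3 := by
    refine hg.trans ((Nat.mul_le_mul_right _ (hout.trans hTK)).trans (le_of_eq ?_))
    ring
  have hin : 2 * l + (s - 2 * l) ≤ m := by omega
  have hr : s + out.length ≤ m := by omega
  refine ⟨pushReg n m _ 0 inp ++ (Op.query (.dec (memRange n (2 * l) (s - 2 * l) hin)
    (memRange n s out.length hr)) :: computeOps n m _ 0 (s + out.length) C' out), ?_,
    fun sk forb ψ k hk => ?_⟩
  · rw [sizeOps_append, sizeOps_query_cons, SKEQuery.size, memRange_length, memRange_length]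
    have e1 := sizeOps_pushReg (n := n) (m := m) (SKEQuery.size (n := n + m)) 0 inp
    have e3 := sizeOps_computeOps (n := n) (m := m) (SKEQuery.size (n := n + m))
      0 (s + out.length) C' out
    omega
  · have hans := isChannel_skeAns (n := n + m) S sk forb
    have e1 := run_pushReg (S.ans sk forb) [] inp (by simp; omega) ψ
      ((isChannel_run hans (Op.query (.dec (memRange n (2 * l) (s - 2 * l) hin)
        (memRange n s out.length hr)) :: computeOps n m _ 0 (s + out.length) C' out)).hom hk)
    rw [List.length_nil] at e1
    rw [run_append, e1]
    refine measure_congr _ _ fun v φ hvs _ => ?_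
    rw [← hs] at hvs
    rw [List.nil_append, Op.run, Op.step, SKE.ans, measure_memRange]
    · have hdrop : (List.ofFn fun i : Fin (s - 2 * l) => v.getD (2 * l + i) false) =
          v.drop (2 * l) := by
        refine List.ext_getElem (by simp [hvs]) fun i h1 h2 => ?_
        simp only [List.length_ofFn] at h1
        rw [List.getElem_ofFn, List.getElem_drop, List.getD_eq_getElem _ _ (by omega)]
      rw [hdrop]
      obtain ⟨t, htl, htj, hemb⟩ := exists_emb_take (n := n) (m := m) v (encodeAns
        (decExcept forb none (S.dec l sk) (decodeStr (v.drop (2 * l))))) out.length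
      have e := xorInto_memRange (n := n) v (encodeAns
        (decExcept forb none (S.dec l sk) (decodeStr (v.drop (2 * l))))) out.length
        (show v.length + out.length ≤ m by rw [hvs]; exact hr) φ
      rw [hemb] at e
      simp only [hvs] at e
      rw [e]
      exact run_computeOps _ C' [] (v ++ t) 0 _ rfl (hlen ⟨(v, t), hvs, htl⟩) (by omega) out _
        (fun j hj => (hC' ⟨(v, t), hvs, htl⟩ j hj).trans
          (decAnswer_ske_getD S g x sk s v t hvs C Cf pre hCf hC forb _ htj j hj)) φ hk
    · intro s'
      exact QuadHom.zero ((isChannel_xorInto _ _).hom ((isChannel_run hans _).hom hk))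

/-- There is no oracle for `g` here; the circuit `Cf`, with `pre` hardwired, is evaluated in
superposition and leaves the memory clean. -/
theorem exists_qpk_ske (S : SKE) (g : Bits l → Bits l)
    (Cf : BoolCircuit) (hCfK : Cf.size ≤ K) (pre : List Bool) (hpre : pre.length = l) (hlK : l ≤ K)
    (hCf : ∀ x : Bits l, Cf.eval (pre ++ List.ofFn x) = List.ofFn (g x))
    (hm : 3 * K ≤ m) (tgt : Fin l ⊕ Fin l ↪ Fin n) :
    ∃ D : List (Op (n + m) (SKEQuery (n + m))), sizeOps SKEQuery.size D ≤ 12 * K ∧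
      ∀ (sk : Bits l) forb ψ k, QuadHom k → Op.run (S.ans sk forb) D (emb m [] ψ) k =
        prepare (graphState g) tgt ψ fun φ => k (emb m [] φ) := by
  have hgl : Cf.gates.length ≤ K := by rw [BoolCircuit.size] at hCfK; omega
  obtain ⟨D, hD, hsim⟩ := exists_prepare (SKEQuery.size (n := n + m)) tgt
    (coherentOps m _ Cf pre tgt)
  refine ⟨D, ?_, fun sk forb ψ k hk => hsim _ (isChannel_skeAns S sk forb) g []
    (fun ψ k => ?_) ψ k hk⟩
  · rw [sizeOps_of_isPerm _ (coherentOps_isPerm _ _ _)] at hD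
    have := coherentOps_length (m := m) (Q := SKEQuery (n + m)) Cf pre tgt
    omega
  · rw [run_perm _ _ (coherentOps_isPerm _ _ _), act_coherentOps Cf pre g hCf (by omega)]

theorem exists_stage_ske (S : SKE) (hc : HasCircuits S l T K) (x : Bits l) (g : Bits l → Bits l)
    (Cf : BoolCircuit) (hCfK : Cf.size ≤ K) (pre : List Bool) (hpre : pre.length = l)
    (hCf : ∀ x : Bits l, Cf.eval (pre ++ List.ofFn x) = List.ofFn (g x))
    (hm : 200 * K ^ 3 ≤ m)
    (ops : List (Op n (EOQuery (Fin l ⊕ Fin l) n))) (hops : sizeOps EOQuery.size ops ≤ T) :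
    ∃ D : List (Op (n + m) (SKEQuery (n + m))),
      sizeOps SKEQuery.size D ≤ K * (300 * K ^ 3 + m) ∧
      ∀ (sk : Bits l) forb ψ k, QuadHom k → Op.run (S.ans sk forb) D (emb m [] ψ) k =
        Op.run (measuredAns S x sk g (Function.update g x sk) (forb.map (List.ofFn x ++ ·))) ops ψ
          fun φ => k (emb m [] φ) := by
  have hl := hc.l_le
  have h2 := hc.two_le
  have hT := hc.T_le
  have hK3 : 4 * K ≤ K ^ 3 := by nlinarith [Nat.mul_le_mul h2 h2]
  obtain ⟨D, hD, hsim⟩ := exists_simulation (n := n) (m := m) (SKEQuery.size (n := n + m))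
    (fun _ : Bits l × Option (List Bool) => []) (fun i => S.ans i.1 i.2)
    (fun i => measuredAns S x i.1 g (Function.update g x i.1) (i.2.map (List.ofFn x ++ ·)))
    (fun i => isChannel_skeAns S i.1 i.2) (300 * K ^ 3 + m) (by omega) ops fun q hq => by
      have hsz := (qsize_le_sizeOps EOQuery.size hq).trans hops
      cases q with
      | qpk tgt =>
        obtain ⟨D, hD, h⟩ := exists_qpk_ske (m := m) S g Cf hCfK pre hpre hl hCf (by omega) tgt
        exact ⟨D, by omega, fun i ψ k hk => h i.1 i.2 ψ k hk⟩
      | enc inp out =>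
        simp only [EOQuery.size] at hsz
        obtain ⟨D, hD, h⟩ := exists_enc_ske (m := m) S hl x (by omega) inp out (by omega) (by omega)
        exact ⟨D, by omega, fun i ψ k hk => h i.1 i.2 ψ k hk⟩
      | dec inp out =>
        simp only [EOQuery.size] at hsz
        obtain ⟨D, hD, h⟩ := exists_dec_ske (m := m) S hc x g Cf hCfK pre hpre hCf hm inp out
          (by omega) (by omega)
        exact ⟨D, by omega, fun i ψ k hk => h i.1 i.2 ψ k hk⟩
  refine ⟨D, hD.trans (Nat.mul_le_mul_right _ ?_), fun sk forb => hsim (sk, forb)⟩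
  exact ((length_le_sizeOps _ _).trans hops).trans hT

/-- The adversary against the symmetric-key scheme that runs the game with the measured key
`(x, sk)`. -/
theorem exists_skeAdversary (S : SKE) (A : TwoStageAdversary (EOQuery (Fin l ⊕ Fin l)))
    (hc : HasCircuits S l (A.size fun _ => EOQuery.size) K) (x : Bits l) (g : Bits l → Bits l)
    (Cf : BoolCircuit) (hCfK : Cf.size ≤ K) (pre : List Bool) (hpre : pre.length = l)
    (hCf : ∀ x : Bits l, Cf.eval (pre ++ List.ofFn x) = List.ofFn (g x)) :
    ∃ B : TwoStageAdversary SKEQuery, B.size (fun _ => SKEQuery.size) ≤ 20000 * K ^ 4 ∧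
      ∀ sk b, S.guessProb B sk b = measuredGuess S A x sk g (Function.update g x sk) b := by
  have h2 := hc.two_le
  have hTK := hc.T_le
  set T := A.size fun _ => EOQuery.size with hT
  rw [TwoStageAdversary.size] at hT
  have hK3 : 4 * K ≤ K ^ 3 := by nlinarith [Nat.mul_le_mul h2 h2]
  have hr : 0 + A.chal.length ≤ 200 * K ^ 3 := by omega
  obtain ⟨D₁, hD₁, hsim₁⟩ := exists_stage_ske S hc x g Cf hCfK pre hpre hCf le_rfl
    A.stage₁ (by omega)
  obtain ⟨D₂, hD₂, hsim₂⟩ := exists_stage_ske S hc x g Cf hCfK pre hpre hCf le_rfl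
    A.stage₂ (by omega)
  obtain ⟨Dc, hDc, hdel⟩ := exists_deliver (SKEQuery.size (n := A.n + 200 * K ^ 3)) x A.chal hr
    (by omega)
  refine ⟨⟨A.n + 200 * K ^ 3, D₁, A.msg₀.map (Fin.castAdd _), A.msg₁.map (Fin.castAdd _),
    memRange A.n 0 A.chal.length hr, Dc ++ D₂, Fin.castAdd _ A.out⟩, ?_, fun sk b => ?_⟩
  · simp only [TwoStageAdversary.size, List.length_map, memRange_length, sizeOps_append]
    have hK4 : 2 * K ^ 3 ≤ K ^ 4 := by nlinarith
    have h4 : K * (300 * K ^ 3 + 200 * K ^ 3) = 500 * K ^ 4 := by ring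
    omega
  · have hk : QuadHom (outProb (Fin.castAdd (200 * K ^ 3) A.out) b) := (isEffect_outProb _ _).hom
    -- The value `forb` is at once the answer to the challenge and the forbidden ciphertext; `none`
    -- covers plaintexts of different lengths.
    have hfin : ∀ (forb : Option (List Bool)) (φ : St A.n ℂ),
        Op.run (S.ans sk forb) (Dc ++ D₂) (xorInto (memRange A.n 0 A.chal.length hr)
          (encodeAns forb) (emb (200 * K ^ 3) [] φ)) (outProb (Fin.castAdd (200 * K ^ 3) A.out) b) =
        Op.run (measuredAns S x sk g (Function.update g x sk) (forb.map (List.ofFn x ++ ·)))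
          A.stage₂ (xorInto A.chal (encodeAns (forb.map (List.ofFn x ++ ·))) φ)
          (outProb A.out b) := by
      intro forb φ
      rw [run_append, hdel _ _ _ _ ((isChannel_run (isChannel_skeAns S sk forb) D₂).hom hk),
        hsim₂ sk forb _ _ hk]
      simp only [outProb_emb]
    rw [SKE.guessProb, measuredGuess, ← emb_initSt]
    have hpost : QuadHom fun ψ : St (A.n + 200 * K ^ 3) ℂ =>
        measure (A.msg₀.map (Fin.castAdd _)) ψ fun v₀ ψ₀ =>
          measure (A.msg₁.map (Fin.castAdd _)) ψ₀ fun v₁ ψ₁ =>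
            if (decodeStr v₀).length = (decodeStr v₁).length then
              S.encAvg sk (decodeStr (if b then v₁ else v₀)) fun c =>
                Op.run (S.ans sk (some c)) (Dc ++ D₂) (xorInto (memRange A.n 0 A.chal.length hr)
                  (encodeAns (some c)) ψ₁) (outProb (Fin.castAdd (200 * K ^ 3) A.out) b)
            else
              Op.run (S.ans sk none) (Dc ++ D₂) (xorInto (memRange A.n 0 A.chal.length hr)
                  (encodeAns none) ψ₁) (outProb (Fin.castAdd (200 * K ^ 3) A.out) b) := by
      have hrun : ∀ forb, QuadHom fun ψ₁ => Op.run (S.ans sk forb) (Dc ++ D₂)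
          (xorInto (memRange A.n 0 A.chal.length hr) (encodeAns forb) ψ₁)
          (outProb (Fin.castAdd (200 * K ^ 3) A.out) b) := fun forb =>
        (isChannel_xorInto _ _).hom ((isChannel_run (isChannel_skeAns S sk forb) _).hom hk)
      refine (isInstrument_measure _).hom _ fun v₀ => (isInstrument_measure _).hom _ fun v₁ => ?_
      by_cases h : (decodeStr v₀).length = (decodeStr v₁).length
      · simp only [if_pos h]
        exact (isInstrument_encAvg S sk _).hom _ fun c => hrun (some c)
      · simp only [if_neg h]
        exact hrun none
    rw [hsim₁ sk none _ _ hpost]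
    refine congrArg _ (funext fun φ => ?_)
    rw [measure_emb, measuredChallenge]
    refine congrArg _ (funext fun v₀ => funext fun ψ₀ => ?_)
    rw [measure_emb]
    refine congrArg _ (funext fun v₁ => funext fun ψ₁ => ?_)
    refine if_congr Iff.rfl (congrArg _ (funext fun c => hfin (some c) ψ₁)) (hfin none ψ₁)

end SKE

/-! ### Averages -/

section Avg

variable {α β : Type} [Fintype α] [Fintype β]

theorem avg_le_avg_add [Nonempty α] {F G : α → ℝ} {c : ℝ} (h : ∀ a, F a ≤ G a + c) :
    avg F ≤ avg G + c := by
  have h1 : avg F ≤ avg fun a => G a + c :=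
    div_le_div_of_nonneg_right (Finset.sum_le_sum fun a _ => h a) (Nat.cast_nonneg _)
  refine h1.trans (le_of_eq ?_)
  conv_rhs => rw [← avg_const (α := α) c]
  simp only [avg, Finset.sum_add_distrib, add_div]

theorem avg_le [Nonempty α] {F : α → ℝ} {c : ℝ} (h : ∀ a, F a ≤ c) : avg F ≤ c := by
  have := avg_le_avg_add (F := F) (G := fun _ => 0) (c := c) fun a => by simpa using h a
  rwa [avg_const, zero_add] at this

theorem avg_comm (F : α → β → ℝ) :
    (avg fun a => avg fun b => F a b) = avg fun b => avg fun a => F a b := by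
  simp only [avg, ← Finset.sum_div]
  rw [Finset.sum_comm, div_right_comm]

/-- A uniform function with its value at `x` replaced by a uniform one is uniform. -/
theorem avg_update {l : ℕ} (x : Bits l) (H : (Bits l → Bits l) → ℝ) :
    avg H = avg fun y : Bits l => avg fun g : Bits l → Bits l => H (Function.update g x y) := by
  -- Exchanging `y` with the value of `g` at `x` permutes the pairs, so the reprogrammed function
  -- has the distribution of `g`.
  have hinv : Function.Involutive fun p : Bits l × (Bits l → Bits l) =>
      ((p.2 x, Function.update p.2 x p.1) : Bits l × (Bits l → Bits l)) := by
    rintro ⟨y, g⟩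
    simp
  have h1 : ∑ p : Bits l × (Bits l → Bits l), H (Function.update p.2 x p.1) =
      ∑ p : Bits l × (Bits l → Bits l), H p.2 := by
    rw [← Equiv.sum_comp hinv.toPerm]
    simp
  rw [Fintype.sum_prod_type, Fintype.sum_prod_type] at h1
  conv_lhs => rw [← avg_const (α := Bits l) (avg H)]
  simp only [avg, ← Finset.sum_div, h1]

end Avg

/-! ### Polynomials and negligible functions -/

theorem eval_mono (p : Polynomial ℕ) {a b : ℕ} (h : a ≤ b) : p.eval a ≤ p.eval b := by
  rw [Polynomial.eval_eq_sum_range, Polynomial.eval_eq_sum_range]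
  exact Finset.sum_le_sum fun i _ => Nat.mul_le_mul_left _ (Nat.pow_le_pow_left h i)

theorem negligible_pow {r : ℝ} (h0 : 0 ≤ r) (h1 : r < 1) : Negligible fun l => r ^ l :=
  fun k => tendsto_pow_const_mul_const_pow_of_abs_lt_one k (by rwa [abs_of_nonneg h0])

/-- With `u = 2^(-l/2)` the error is `4u + 4u²`, a sum of two geometric sequences with ratios below
1. -/
theorem negligible_keyError : Negligible keyError := by
  have hs : (Real.sqrt 2)⁻¹ < 1 := inv_lt_one_of_one_lt₀ (by
    rw [Real.lt_sqrt (by norm_num)]; norm_num)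
  have h := ((negligible_pow (by positivity) hs).const_mul 4).add
    ((negligible_pow (r := 2⁻¹) (by positivity) (by norm_num)).const_mul 4)
  refine h.congr fun l => ?_
  have hu : (Real.sqrt (2 ^ l))⁻¹ ^ 2 = 2⁻¹ ^ l := by
    rw [inv_pow, Real.sq_sqrt (by positivity), inv_pow]
  have hr : (Real.sqrt 2)⁻¹ ^ l = (Real.sqrt (2 ^ l))⁻¹ := by
    rw [inv_pow]
    congr 1
    refine (Real.sqrt_eq_iff_mul_self_eq (by positivity) (by positivity)).2 ?_ |>.symm
    rw [← mul_pow, Real.mul_self_sqrt (by norm_num)]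
  simp only [Pi.add_apply]
  rw [keyError, mul_pow, hu, hr]
  ring

theorem Negligible.polynomial_mul {ε : ℕ → ℝ} (h : Negligible ε) (p : Polynomial ℕ) :
    Negligible fun l => ((p.eval l : ℕ) : ℝ) * ε l := by
  refine (Asymptotics.SuperpolynomialDecay.polynomial_mul h
    (p.map (Nat.castRingHom ℝ))).congr fun l => ?_
  simp only [Polynomial.eval_natCast_map, eq_natCast, Nat.cast_id]

/-! ### Security against families of adversaries -/

/-- Non-uniformity: for every `l` hardwire a parameter with the largest advantage. The bound for
this one family dominates all parameters. -/
theorem KeyedFamily.IsQuantumSecurePRF.uniform {f : KeyedFamily} (hf : f.IsQuantumSecurePRF)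
    {P : ℕ → Type} [∀ l, Finite (P l)] [∀ l, Nonempty (P l)] (B : ∀ l, P l → PRFAdversary l)
    (p : Polynomial ℕ) (hB : ∀ l a, (B l a).size ≤ p.eval l) :
    ∃ μ : ℕ → ℝ, Negligible μ ∧ ∀ l a,
      |avg (fun k : Bits l => (B l a).prob (f l k)) -
        avg (fun g : Bits l → Bits l => (B l a).prob g)| ≤ μ l := by
  choose a ha using fun l => Finite.exists_max fun a : P l =>
    |avg (fun k : Bits l => (B l a).prob (f l k)) -
      avg (fun g : Bits l → Bits l => (B l a).prob g)|
  obtain ⟨μ, hμ, h⟩ := hf.2 (fun l => B l (a l)) ⟨p, fun l => hB l _⟩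
  exact ⟨μ, hμ, fun l c => (ha l c).trans (h l)⟩

/-- As for the pseudorandom function, a parameter with the largest winning probability is hardwired.
-/
theorem SKE.IsPostQuantumINDCCA.uniform {S : SKE} (hS : S.IsPostQuantumINDCCA)
    {P : ℕ → Type} [∀ l, Finite (P l)] [∀ l, Nonempty (P l)]
    (B : ∀ l, P l → TwoStageAdversary SKEQuery)
    (p : Polynomial ℕ) (hB : ∀ l a, (B l a).size (fun _ => SKEQuery.size) ≤ p.eval l) :
    ∃ ε : ℕ → ℝ, Negligible ε ∧ ∀ l a, S.winProb l (B l a) ≤ 1 / 2 + ε l := by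
  choose a ha using fun l => Finite.exists_max fun a : P l => S.winProb l (B l a)
  obtain ⟨ε, hε, h⟩ := hS (fun l => B l (a l)) ⟨p, fun l => hB l _⟩
  exact ⟨ε, hε, fun l c => (ha l c).trans (h l)⟩

/-! ### The main argument -/

/-- All strings are bounded by `p(l)`, and polynomials over `ℕ` are monotone, so sizes polynomial in
`l + L` become polynomial in `l`. -/
theorem exists_hasCircuits (f : KeyedFamily) (S : SKE) (hf : f.Efficient) (p : Polynomial ℕ) :
    ∃ q : Polynomial ℕ, ∀ l T, T ≤ p.eval l → HasCircuits S l T (q.eval l) ∧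
      ∃ C : BoolCircuit, C.size ≤ q.eval l ∧
        ∀ k x : Bits l, C.eval (List.ofFn k ++ List.ofFn x) = List.ofFn (f l k x) := by
  obtain ⟨pf, hpf⟩ := hf
  obtain ⟨pe, hpe⟩ := S.enc_efficient
  obtain ⟨pd, hpd⟩ := S.dec_efficient
  refine ⟨2 + Polynomial.X + p + pf + pe.comp (Polynomial.X + p) + pd.comp (Polynomial.X + p),
    fun l T hT => ?_⟩
  have hq : (2 + Polynomial.X + p + pf + pe.comp (Polynomial.X + p) +
      pd.comp (Polynomial.X + p)).eval l =
      2 + l + p.eval l + pf.eval l + pe.eval (l + p.eval l) + pd.eval (l + p.eval l) := by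
    simp [Polynomial.eval_comp]
  rw [hq]
  refine ⟨⟨by omega, by omega, by omega, fun L hL => ?_, fun L hL => ?_⟩, ?_⟩
  · obtain ⟨R, C, hR, hC, h⟩ := hpe l L
    have := eval_mono pe (show l + L ≤ l + p.eval l by omega)
    exact ⟨R, C, by omega, by omega, h⟩
  · obtain ⟨C, hC, h⟩ := hpd l L
    have := eval_mono pd (show l + L ≤ l + p.eval l by omega)
    exact ⟨C, by omega, h⟩
  · obtain ⟨C, hC, h⟩ := hpf l
    exact ⟨C, by omega, h⟩

theorem winProb_construction (f : KeyedFamily) (S : SKE) {l : ℕ}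
    (A : TwoStageAdversary (EOQuery (Fin l ⊕ Fin l))) :
    (construction f S).winProb l A = avg fun b : Bool => avg fun x : Bits l =>
      avg fun dk : Bits l => measuredGuess S A x (f l dk x) (f l dk) (f l dk) b := by
  have h1 : (construction f S).winProb l A = avg fun dk : Bits l => avg fun b : Bool =>
      (construction f S).guessProb (l := l) A dk b := by
    have h2 : ∀ dk : Bits l, ((construction f S).gen l dk).toReal =
        (Fintype.card (Bits l) : ℝ)⁻¹ := by
      intro dk
      change (PMF.uniformOfFintype (Bits l) dk).toReal = _
      rw [PMF.uniformOfFintype_apply]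
      simp
    change ∑ dk : Bits l, ((construction f S).gen l dk).toReal * _ = _
    simp only [h2]
    rw [← Finset.mul_sum, avg, div_eq_inv_mul]
  refine h1.trans ((congrArg avg (funext fun dk => congrArg avg (funext fun b =>
    guessProb_construction f S A dk b))).trans ?_)
  rw [avg_comm (α := Bits l) (β := Bool)]
  exact congrArg avg (funext fun b => avg_comm _)

/-- Resample the uniform `g` at `x`. The key in the register is then the new value `y`, and removing
`y` from the public keys costs `keyError` per operation. -/
theorem measuredGuess_avg_le (S : SKE) {l : ℕ} (A : TwoStageAdversary (EOQuery (Fin l ⊕ Fin l)))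
    (x : Bits l) (b : Bool) :
    avg (fun g : Bits l → Bits l => measuredGuess S A x (g x) g g b) ≤
      (avg fun y : Bits l => avg fun g : Bits l → Bits l =>
        measuredGuess S A x y g (Function.update g x y) b) +
      (A.stage₁.length + A.stage₂.length : ℕ) * keyError l := by
  rw [avg_update x]
  refine avg_le_avg_add fun y => avg_le_avg_add fun g => ?_
  rw [Function.update_self]
  have := (abs_le.1 (measuredGuess_dist S A x y g (Function.update g x y) b)).2
  linarith

theorem construction_isINDCCAEO (f : KeyedFamily) (S : SKE)
    (hf : f.IsQuantumSecurePRF) (hS : S.IsPostQuantumINDCCA) :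
    (construction f S).IsINDCCAEO := by
  intro A' ⟨p, hp'⟩
  let A : ∀ l, TwoStageAdversary (EOQuery (Fin l ⊕ Fin l)) := A'
  have hp : ∀ l, (A l).size (fun _ => EOQuery.size) ≤ p.eval l := hp'
  obtain ⟨q, hq⟩ := exists_hasCircuits f S hf.1 p
  have hc := fun l => (hq l _ (hp l)).1
  choose Cf hCfK hCf using fun l => (hq l _ (hp l)).2
  choose B₁ hB₁ hrun₁ using fun l (a : Bits l × Bool) =>
    exists_prfAdversary_query S (A l) (hc l) a.1 a.2
  choose B₂ hB₂ hrun₂ using fun l (a : Bits l × Bits l × Bool) =>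
    exists_prfAdversary_const S (A l) (hc l) a.1 a.2.1 a.2.2
  choose B₃ hB₃ hrun₃ using fun l (a : Bits l × Bits l) =>
    exists_skeAdversary S (A l) (hc l) a.1 (f l a.2) (Cf l) (hCfK l) (List.ofFn a.2) (by simp)
      (hCf l a.2)
  have hbound : ∀ l, 20000 * q.eval l ^ 4 = (20000 * q ^ 4).eval l := fun l => by simp
  simp only [hbound] at hB₁ hB₂ hB₃
  obtain ⟨μ₁, hμ₁, h₁⟩ := hf.uniform B₁ _ hB₁
  obtain ⟨μ₂, hμ₂, h₂⟩ := hf.uniform B₂ _ hB₂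
  obtain ⟨ε, hε, h₃⟩ := hS.uniform B₃ _ hB₃
  simp only [hrun₁] at h₁
  simp only [hrun₂] at h₂
  simp only [SKE.winProb, hrun₃] at h₃
  refine ⟨_, ((hε.add hμ₂).add (negligible_keyError.polynomial_mul p)).add hμ₁, fun l => ?_⟩
  change (construction f S).winProb l (A l) ≤ _
  simp only [winProb_construction, Pi.add_apply]
  have hlen : (((A l).stage₁.length + (A l).stage₂.length : ℕ) : ℝ) * keyError l ≤
      ((p.eval l : ℕ) : ℝ) * keyError l := by
    refine mul_le_mul_of_nonneg_right (Nat.cast_le.2 ?_) (keyError_nonneg l)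
    have e1 := length_le_sizeOps (EOQuery.size (K := Fin l ⊕ Fin l)) (A l).stage₁
    have e2 := length_le_sizeOps (EOQuery.size (K := Fin l ⊕ Fin l)) (A l).stage₂
    have e3 := hp l
    rw [TwoStageAdversary.size] at e3
    omega
  have key : (avg fun b : Bool => avg fun x : Bits l => avg fun dk : Bits l =>
      measuredGuess S (A l) x (f l dk x) (f l dk) (f l dk) b) ≤
      (avg fun b : Bool => avg fun x : Bits l => avg fun y : Bits l => avg fun dk : Bits l =>
        measuredGuess S (A l) x y (f l dk) (Function.update (f l dk) x y) b) +
        (μ₂ l + ((p.eval l : ℕ) : ℝ) * keyError l + μ₁ l) := by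
    refine avg_le_avg_add fun b => avg_le_avg_add fun x => ?_
    have e1 := (abs_le.1 (h₁ l (x, b))).2
    have e2 := measuredGuess_avg_le S (A l) x b
    have e3 := avg_le_avg_add (F := fun y : Bits l => avg fun g : Bits l → Bits l =>
      measuredGuess S (A l) x y g (Function.update g x y) b) (G := fun y : Bits l =>
      avg fun dk : Bits l => measuredGuess S (A l) x y (f l dk) (Function.update (f l dk) x y) b)
      -- Back from a uniform function to `f`, for each fixed `y`.
      (c := μ₂ l) fun y => by
        have := (abs_le.1 (h₂ l (x, y, b))).1
        simp only at this ⊢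
        linarith
    simp only at e1
    linarith
  have hswap : (avg fun b : Bool => avg fun x : Bits l => avg fun y : Bits l =>
      avg fun dk : Bits l =>
        measuredGuess S (A l) x y (f l dk) (Function.update (f l dk) x y) b) =
      avg fun x : Bits l => avg fun dk : Bits l => avg fun y : Bits l => avg fun b : Bool =>
        measuredGuess S (A l) x y (f l dk) (Function.update (f l dk) x y) b := by
    rw [avg_comm]
    refine congrArg avg (funext fun x => ?_)
    simp only [avg_comm (α := Bits l) (β := Bits l)
      (fun y dk => measuredGuess S (A l) x y (f l dk) (Function.update (f l dk) x y) _)]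
    rw [avg_comm]
    refine congrArg avg (funext fun dk => ?_)
    rw [avg_comm]
  -- For fixed `x` and `dk`, the average over `y` and `b` is the winning probability of `B₃`, with
  -- `y` as its uniform secret key.
  have hfin := avg_le fun x : Bits l => avg_le fun dk : Bits l => h₃ l (x, dk)
  simp only at hfin
  linarith

end QPKE

end

theorem mainTheorem1 (f : QPKE.KeyedFamily) (S : QPKE.SKE)
    (hf : f.IsQuantumSecurePRF) (hS : S.IsPostQuantumINDCCA) :
    (QPKE.construction f S).IsINDCCAEO :=
  QPKE.construction_isINDCCAEO f S hf hS
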